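/- Let $N\ge 2$, $\eta=2\pi/N$, $S(\theta)=\sinh\frac12(\theta+i\eta)/\sinh\frac12(\theta-i\eta)$, and let $F$ be the meromorphic function on $\mathbb C$ which for $0<\operatorname{Im}\theta<2\pi$ is $$F(\theta)=c_N\exp\int_0^\infty\frac{dt}{t}\,\frac{2\cosh\frac tN\,\sinh\frac{(N-1)t}{N}}{\sinh^2t}\Bigl(1-\cosh t\bigl(1-\tfrac{\theta}{i\pi}\bigr)\Bigr),$$ $$c_N=e^{i\pi\frac{N-1}N}\exp\int_0^\infty\frac{dt}{t\sinh t}\Bigl(1-\tfrac2N-\frac{\sinh t(1-\frac2N)}{\sinh t}\Bigr).$$ For $1\le\alpha\le N-2$ put $\eta_\alpha=\pi(1+\alpha)/N$, $S_{1\alpha}(\theta)=\prod_{j=0}^{\alpha-1}S\bigl(\theta+(\alpha-1-2j)\tfrac{i\eta}2\bigr)$ and $\Gamma_{1\alpha}^{1+\alpha}=i\,|\operatorname{Res}_{\theta=i\eta_\alpha}S_{1\alpha}(\theta)|^{1/2}$. Let $\varphi,\tau,\varkappa$ be meromorphic functions on $\mathbb C$, $\varphi$ being $2\pi i$-periodic,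 with $$\prod_{k=0}^{N-2}\varphi(z+ki\eta)\prod_{k=0}^{N-1}F(z+ki\eta)=1,\qquad \tau(z)\varphi(z)\varphi(-z)=1,\qquad\varkappa(z)\varphi(z)=1 .$$ For each $n\ge0$ let $\underline m(n)=(m_1(n),\dots,m_{N-1}(n))\in\mathbb Z_{\ge0}^{N-1}$ with $m_k(n+N)=m_k(n)+1$. For $\underline\theta\in\mathbb C^n$, $\underline z=(z_{kj})_{1\le k\le N-1,\,1\le j\le m_k}$ and a function $g$ of $\underline z$ put $$h(\underline\theta,\underline z)=\prod_{k=1}^{N-1}\Bigl(\prod_{j=1}^{m_k}\prod_{i=1}^n\varphi(z_{kj}-\theta_i)\prod_{1\le i<j\le m_k}\tau(z_{ki}-z_{kj})\Bigr)\prod_{1\le k<l\le N-1}\prod_{i=1}^{m_k}\prod_{j=1}^{m_l}\varkappa(z_{ki}-z_{lj}),$$ $$I_{n\underline m}(\underline\theta,g)=\Bigl(\prod_{k=1}^{N-1}\frac1{m_k!}\prod_{j=1}^{m_k}\int_{\mathcal C_{\underline\theta}}\frac{dz_{kj}}R\Bigr)h(\underline\theta,\underline z)\,g(\underline z),$$ where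 $\mathcal C_{\underline\theta}$ is the sum of small clockwise circles around $\theta_1,\dots,\theta_n$ and $R$ is the integral of $\varphi$ over a small clockwise circle around $0$. Let $\sigma_1\ne0$ and $s$ be complex numbers, and let $p_n(\underline\theta,\underline z)$, $\underline z=(z_{kj})_{j\le m_k(n)}$, $n\ge 0$, be entire functions that are symmetric in $z_{k1},\dots,z_{km_k}$ for each $k$, $2\pi i$-periodic in each $z_{kj}$, and satisfy: - (i') $p_n$ is symmetric in $\theta_1,\dots,\theta_n$; - (ii') $\sigma_1p_n(\theta_1+2\pi i,\theta_2,\dots,\underline z)=p_n(\theta_1,\theta_2,\dots,\underline z)$ for $n\ge1$; - (iii') if $n\ge N$ and $\theta_k-\theta_{k+1}=i\eta$ for $k=1,\dots,N-1$, then $p_n(\underline\theta,\underline z)|_{z_{k1}=\theta_k\,\forall k}=\sigma_1p_n(\underline\theta,\underline z)|_{z_{k1}=\theta_{k+1}\,\forall k}=\sigma_1p_{n-N}(\underline\theta',\underline z')+\tilde p$, where $\underline\theta'=(\theta_{N+1},\dots,\theta_n)$, $\underline z'=(z_{kj})_{j\ge2}$ and $\tilde p$ does not contribute after integration: $I_{n-N,\underline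 m(n-N)}(\underline\theta',\tilde p)=0$ for $\underline\theta'$ in general position; - (v') $p_n(\underline\theta+\mu,\underline z+\mu)=e^{s\mu}p_n(\underline\theta,\underline z)$. Let the constants $N_n$ satisfy, for $n\ge N$, $$N_n\Bigl(\operatorname*{Res}_{\theta=i\eta}\varphi(-\theta)\Bigr)^{N-1}\prod_{k=1}^{N-2}\varphi(ki\eta)^k\prod_{k=1}^{N-1}F(ki\eta)^{N-k}=N_{n-N}\,2i\prod_{\alpha=1}^{N-2}\sqrt2\,\Gamma_{1\alpha}^{1+\alpha}.$$ Then the functions $F_n(\underline\theta)=N_nI_{n\underline m(n)}(\underline\theta,p_n(\underline\theta,\cdot))\prod_{1\le i<j\le n}F(\theta_i-\theta_j)$ satisfy the following equations, where $\theta_{ij}=\theta_i-\theta_j$: (i), (ii), (v) whenever no difference of two arguments lies in $\{0,\pm i\eta\}+2\pi i\mathbb Z$, and the residue formulae whenever no difference of two of the rapidities that remain free lies in $i\eta\mathbb Z$. - (i) $F_n(\dots,\theta_i,\theta_{i+1},\dots)=F_n(\dots,\theta_{i+1},\theta_i,\dots)\,S(\theta_i-\theta_{i+1})$. - (ii) $\sigma_1F_n(\theta_1+i\pi,\theta_2,\dots,\theta_n)=F_n(\theta_2,\dots,\theta_n,\theta_1-i\pi)$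 for $n\ge 1$. - (iii), (iv) combined: for $n\ge N$, $$\operatorname*{Res}_{\theta_{N-1\,N}=i\eta}\cdots\operatorname*{Res}_{\theta_{12}=i\eta}F_n(\theta_1,\dots,\theta_n)=2i\,F_{n-N}(\theta_{N+1},\dots,\theta_n)\Bigl(1-\sigma_1\prod_{i=N+1}^nS(\theta_N-\theta_i)\Bigr)\prod_{\alpha=1}^{N-2}\sqrt2\,\Gamma_{1\alpha}^{1+\alpha}.$$ Equivalently, there are form factors $F_{\alpha1\cdots1}$ of one particle of type $\alpha=1,\dots,N-1$ followed by particles of type $1$, with $F_{1\cdots1}=F_n$, such that (iv) $\operatorname{Res}_{\theta_{12}=i\eta_\alpha}F_{\alpha1\cdots1}(\theta_1,\theta_2,\theta_3,\dots)=\sqrt2\,\Gamma_{1\alpha}^{1+\alpha}F_{\alpha+1,1\cdots1}(\theta_2+\tfrac{i\eta\alpha}2,\theta_3,\dots)$ for $\alpha\le N-2$, and (iii) $\operatorname{Res}_{\theta_{12}=i\pi}F_{N-1,1\cdots1}(\theta_1,\theta_2,\theta_3,\dots)=2i\,F_{1\cdots1}(\theta_3,\dots)\bigl(1-\sigma_1\prod_{i\ge3}S(\theta_2-\theta_i)\bigr)$.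 - (v) $F_n(\theta_1+\mu,\dots,\theta_n+\mu)=e^{s\mu}F_n(\theta_1,\dots,\theta_n)$. All functions of which residues are taken are meromorphic at the point in question. -/

import Mathlib

namespace ZNIsing

open Complex Filter Topology

noncomputable section

/-! ### Residues -/

/-- The residue of `f` at `a`: the value of `(2πi)⁻¹ ∮ f` over all small circles around `a`. -/
def residue (f : ℂ → ℂ) (a : ℂ) : ℂ :=
  limUnder (𝓝[>] (0 : ℝ)) fun r => (2 * Real.pi * I)⁻¹ * ∮ z in C(a, r), f z

/-- `f` is meromorphic at `a` with residue `c`. -/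
def HasResidue (f : ℂ → ℂ) (a c : ℂ) : Prop :=
  MeromorphicAt f a ∧
    ∀ᶠ r in 𝓝[>] (0 : ℝ), (2 * Real.pi * I)⁻¹ * (∮ z in C(a, r), f z) = c

/-! ### The model -/

/-- The fusion angle `η = 2π/N`. -/
def eta (N : ℕ) : ℝ := 2 * Real.pi / N

/-- The two-particle S-matrix of particles of type `1`. -/
def S (N : ℕ) (θ : ℂ) : ℂ :=
  sinh ((θ + 2 * Real.pi * I / N) / 2) / sinh ((θ - 2 * Real.pi * I / N) / 2)

/-- The S-matrix of a particle of type `1` and a particle of type `α`. The latter is the bound state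
of `α` particles of type `1`, whose rapidities are equally spaced by `iη` around its own. -/
def S1 (N α : ℕ) (θ : ℂ) : ℂ :=
  ∏ j ∈ Finset.range α, S N (θ + ((α : ℂ) - 1 - 2 * j) * (I * eta N / 2))

/-- The fusion angle `η_α` of `1 + α → 1 + α`, that is `π (1 + α) / N`
(for the masses `M sin (π α / N)`). -/
def etaB (N α : ℕ) : ℝ := Real.pi * (1 + α) / N

/-- The bound state intertwiner `Γ_{1α}^{1+α} = i |Res_{θ = iη_α} S_{1α}(θ)|^{1/2}`. -/
def Gam (N α : ℕ) : ℂ :=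
  I * (Real.sqrt ‖residue (S1 N α) (I * etaB N α)‖ : ℝ)

/-- The normalization constant `c_N` of the minimal form factor function. -/
def cN (N : ℕ) : ℂ :=
  exp (I * Real.pi * (N - 1) / N) *
    exp ((∫ t in Set.Ioi (0 : ℝ),
      1 / (t * Real.sinh t) *
        ((1 - 2 / N) - Real.sinh (t * (1 - 2 / N)) / Real.sinh t) : ℝ) : ℂ)

/-- `F` is the minimal form factor function: the meromorphic function on `ℂ` which is given by the
integral representation in the strip `0 < Im θ < 2π`, where the integral converges. The normal form
condition fixes the values at removable singularities (and makes the value at poles `0`). -/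
structure IsMinimalFormFactor (N : ℕ) (F : ℂ → ℂ) : Prop where
  meromorphic : MeromorphicNFOn F Set.univ
  eq_integral : ∀ θ : ℂ, 0 < θ.im → θ.im < 2 * Real.pi →
    F θ = cN N * exp (∫ t in Set.Ioi (0 : ℝ),
      1 / (t : ℂ) * (2 * cosh (t / N) * sinh (t * (N - 1) / N) / sinh t ^ 2) *
        (1 - cosh (t * (1 - θ / (I * Real.pi)))))

/-- The functional equations for the meromorphic functions `φ, τ, κ`; they are identities of
meromorphic functions, so they are required outside a discrete closed set. -/
structure IsPhiTauKappa (N : ℕ) (F φ τ κ : ℂ → ℂ) : Prop where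
  meromorphic_phi : MeromorphicNFOn φ Set.univ
  meromorphic_tau : MeromorphicNFOn τ Set.univ
  meromorphic_kappa : MeromorphicNFOn κ Set.univ
  periodic_phi : Function.Periodic φ (2 * Real.pi * I)
  phi_F : ∀ᶠ z in codiscrete ℂ,
    (∏ k ∈ Finset.range (N - 1), φ (z + k * (I * eta N))) *
      (∏ k ∈ Finset.range N, F (z + k * (I * eta N))) = 1
  tau_phi : ∀ᶠ z in codiscrete ℂ, τ z * φ z * φ (-z) = 1
  kappa_phi : ∀ᶠ z in codiscrete ℂ, κ z * φ z = 1

/-! ### Rapidities in general position -/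

/-- No rapidity difference lies in `{0, iη, -iη} + 2πiℤ`, where the poles are. -/
def Regular (N : ℕ) {n : ℕ} (θ : Fin n → ℂ) : Prop :=
  ∀ i j, i ≠ j → ∀ l : ℤ,
    θ i - θ j ≠ l * (2 * Real.pi * I) ∧ θ i - θ j ≠ I * eta N + l * (2 * Real.pi * I)

/-- No rapidity difference lies in `iηℤ`. -/
def Generic (N : ℕ) {n : ℕ} (θ : Fin n → ℂ) : Prop :=
  ∀ i j, i ≠ j → ∀ l : ℤ, θ i - θ j ≠ l * (I * eta N)

/-! ### The multiple contour integral -/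

/-- The integral of `g` over the sum over `i` of the clockwise circles of radius `ρ` around
`θ i`. -/
def contourIntegral {n : ℕ} (θ : Fin n → ℂ) (ρ : ℝ) (g : ℂ → ℂ) : ℂ :=
  ∑ i, -(∮ z in C(θ i, ρ), g z)

/-- The `M`-fold iterated integral, each variable running over the contour above. -/
def multiContourIntegral {n : ℕ} (θ : Fin n → ℂ) (ρ : ℝ) :
    (M : ℕ) → ((Fin M → ℂ) → ℂ) → ℂ
  | 0, f => f Fin.elim0
  | M + 1, f =>
      contourIntegral θ ρ fun z => multiContourIntegral θ ρ M fun w => f (Fin.cons z w)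

/-- The constant `R`, the integral of `φ(z - θ)` over a small clockwise circle around `θ`
(which does not depend on `θ`). -/
def R (φ : ℂ → ℂ) : ℂ :=
  limUnder (𝓝[>] (0 : ℝ)) fun ρ => -(∮ z in C(0, ρ), φ z)

/-- The integration variables `z_{kj}`, `k = 1, …, N-1`, `j = 1, …, m_k`. -/
abbrev ZVars (N : ℕ) (m : Fin (N - 1) → ℕ) : Type := (k : Fin (N - 1)) → Fin (m k) → ℂ

/-- The `h`-function. -/
def h (N : ℕ) (φ τ κ : ℂ → ℂ) {n : ℕ} {m : Fin (N - 1) → ℕ} (θ : Fin n → ℂ)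
    (z : ZVars N m) : ℂ :=
  (∏ k, ((∏ j, ∏ i, φ (z k j - θ i)) *
      ∏ i, ∏ j ∈ Finset.Ioi i, τ (z k i - z k j))) *
    ∏ k, ∏ l ∈ Finset.Ioi k, ∏ i, ∏ j, κ (z k i - z l j)

/-- The fundamental building block `I_{n,m}(θ, g)`: the integral of `h g` with respect to all
`dz_{kj} / R` over the contour that encloses the points `θ i` (circles of all sufficiently small
radii give the same value), divided by `∏ m_k!`. -/
def blockI (N : ℕ) (φ τ κ : ℂ → ℂ) {n : ℕ} (m : Fin (N - 1) → ℕ) (θ : Fin n → ℂ)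
    (g : ZVars N m → ℂ) : ℂ :=
  limUnder (𝓝[>] (0 : ℝ)) fun ρ =>
    (∏ k, ((m k).factorial : ℂ)⁻¹) * (R φ)⁻¹ ^ (∑ k, m k) *
      multiContourIntegral θ ρ (∑ k, m k) fun w =>
        h N φ τ κ θ (fun k j => w (finSigmaFinEquiv ⟨k, j⟩) : ZVars N m) *
          g fun k j => w (finSigmaFinEquiv ⟨k, j⟩)

/-! ### The p-functions -/

/-- The variables with `z_{k1} = a k` and the remaining ones `z_{k2}, z_{k3}, …` given by `z`. -/
def prepend {N : ℕ} {m m' : Fin (N - 1) → ℕ} (hm : ∀ k, m' k = m k + 1)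
    (a : Fin (N - 1) → ℂ) (z : ZVars N m) : ZVars N m' :=
  fun k j => (Fin.cons (a k) (z k) : Fin (m k + 1) → ℂ) (Fin.cast (hm k) j)

/-- `θ_k` for `k = 1, …, N-1`, in a list of `N + n` rapidities. -/
def lower {N n : ℕ} (θ : Fin (N + n) → ℂ) (k : Fin (N - 1)) : ℂ :=
  θ ⟨k, by omega⟩

/-- `θ_{k+1}` for `k = 1, …, N-1`, in a list of `N + n` rapidities. -/
def upper {N n : ℕ} (θ : Fin (N + n) → ℂ) (k : Fin (N - 1)) : ℂ :=
  θ ⟨k + 1, by omega⟩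

/-- The conditions on the family of p-functions `p n = p_{n, m(n)}` of an operator with statistics
factor `σ` and spin `s`. -/
structure IsPFunction (N : ℕ) (φ τ κ : ℂ → ℂ) (σ s : ℂ) (m : ℕ → Fin (N - 1) → ℕ)
    (hm : ∀ n k, m (N + n) k = m n k + 1)
    (p : (n : ℕ) → (Fin n → ℂ) → ZVars N (m n) → ℂ) : Prop where
  analytic : ∀ n, Differentiable ℂ fun x : (Fin n → ℂ) × ZVars N (m n) => p n x.1 x.2
  symm_z : ∀ n θ (z : ZVars N (m n)) (k : Fin (N - 1)) (e : Equiv.Perm (Fin (m n k))),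
    p n θ (Function.update z k (z k ∘ e)) = p n θ z
  periodic_z : ∀ n θ (z : ZVars N (m n)) (k : Fin (N - 1)) (j : Fin (m n k)),
    p n θ (Function.update z k (Function.update (z k) j (z k j + 2 * Real.pi * I))) = p n θ z
  /-- symmetry in the rapidities -/
  symm_theta : ∀ n θ (z : ZVars N (m n)) (e : Equiv.Perm (Fin n)), p n (θ ∘ e) z = p n θ z
  /-- the shift of the first rapidity by `2πi` -/
  shift : ∀ n (θ : Fin (n + 1) → ℂ) (z : ZVars N (m (n + 1))),
    σ * p (n + 1) (Function.update θ 0 (θ 0 + 2 * Real.pi * I)) z = p (n + 1) θ z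
  /-- the two specializations of the variables `z_{k1}` on a chain of `N` rapidities -/
  fusion : ∀ n (θ : Fin (N + n) → ℂ), (∀ k, lower θ k - upper θ k = I * eta N) →
    ∀ z' : ZVars N (m n),
      p (N + n) θ (prepend (hm n) (lower θ) z') = σ * p (N + n) θ (prepend (hm n) (upper θ) z')
  /-- the recursion on such a chain; `q` is a term that does not contribute after integration -/
  recursion : ∀ n (θ : Fin (N + n) → ℂ), (∀ k, lower θ k - upper θ k = I * eta N) →
    ∃ q : ZVars N (m n) → ℂ,
      (∀ z' : ZVars N (m n), p (N + n) θ (prepend (hm n) (lower θ) z') =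
        σ * p n (fun i => θ (Fin.natAdd N i)) z' + q z') ∧
      (Regular N (fun i => θ (Fin.natAdd N i)) →
        blockI N φ τ κ (m n) (fun i => θ (Fin.natAdd N i)) q = 0)
  /-- the common shift of all variables -/
  boost : ∀ n (θ : Fin n → ℂ) (z : ZVars N (m n)) (μ : ℂ),
    p n (fun i => θ i + μ) (fun k j => z k j + μ) = exp (s * μ) * p n θ z

/-! ### The form factors -/

/-- The form factor `F_n(θ) = K_n(θ) ∏_{i<j} F(θ_i - θ_j)` of `n` particles of type `1`, with
`K_n = N_n I_{n,m(n)}(θ, p_n)`. -/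
def formFactor (N : ℕ) (F φ τ κ : ℂ → ℂ) (c : ℕ → ℂ) (m : ℕ → Fin (N - 1) → ℕ)
    (p : (n : ℕ) → (Fin n → ℂ) → ZVars N (m n) → ℂ) (n : ℕ) (θ : Fin n → ℂ) : ℂ :=
  c n * blockI N φ τ κ (m n) θ (p n θ) * ∏ i, ∏ j ∈ Finset.Ioi i, F (θ i - θ j)

/-- The recursion relation for the normalization constants `N_n = c n`. -/
def NormRecursion (N : ℕ) (F φ : ℂ → ℂ) (c : ℕ → ℂ) : Prop :=
  ∀ n, c (N + n) * residue (fun θ => φ (-θ)) (I * eta N) ^ (N - 1) *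
      (∏ k ∈ Finset.Icc 1 (N - 2), φ (k * (I * eta N)) ^ k) *
      (∏ k ∈ Finset.Icc 1 (N - 1), F (k * (I * eta N)) ^ (N - k)) =
    c n * (2 * I) * ∏ α ∈ Finset.Icc 1 (N - 2), (Real.sqrt 2 : ℂ) * Gam N α

/-- The form factor of one particle of type `a + 1` (first argument), followed by `n` particles of
type `1`, obtained from those with `Fn` for particles of type `1` only: the residue at the
bound state pole of the particles of types `α = a + 1` and `1`, at rapidities `u + iη_α` and `u`,
is `√2 Γ_{1α}^{1+α}` times the form factor with a particle of type `α + 1` at the bound state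
rapidity `u + iηα/2`. -/
def boundFormFactor (N : ℕ) (Fn : (n : ℕ) → (Fin n → ℂ) → ℂ) :
    ℕ → (n : ℕ) → (Fin (n + 1) → ℂ) → ℂ
  | 0 => fun n => Fn (n + 1)
  | a + 1 => fun n θ =>
      let u : ℂ := θ 0 - (a + 1) * (I * eta N / 2)
      ((Real.sqrt 2 : ℂ) * Gam N (a + 1))⁻¹ *
        residue (fun t => boundFormFactor N Fn a (n + 1) (Fin.cons t (Fin.cons u (Fin.tail θ))))
          (u + I * etaB N (a + 1))

/-- `g` is the result of taking, for the function `f` of `n + 1 + r` rapidities, successively the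
`r` residues `Res_{θ_{12} = iη}`, `Res_{θ_{23} = iη}`, …, at rapidities in general position. -/
def HasIteratedResidue (N n : ℕ) (g : (Fin (n + 1) → ℂ) → ℂ) :
    (r : ℕ) → ((Fin (n + 1 + r) → ℂ) → ℂ) → Prop
  | 0, f => ∀ θ : Fin (n + 1) → ℂ, Generic N θ → f θ = g θ
  | r + 1, f => ∃ f₁ : (Fin (n + 1 + r) → ℂ) → ℂ,
      (∀ θ : Fin (n + 1 + r) → ℂ, Generic N θ →
        HasResidue (fun t => f (Fin.cons t θ)) (θ ⟨0, by omega⟩ + I * eta N) (f₁ θ)) ∧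
      HasIteratedResidue N n g r f₁

/-- The form factor equations for `Fn`, with statistics factor `σ` and spin `s`. -/
structure FormFactorEquations (N : ℕ) (σ s : ℂ) (Fn : (n : ℕ) → (Fin n → ℂ) → ℂ) : Prop where
  /-- Watson's equations -/
  watson : ∀ n (θ : Fin n → ℂ), Regular N θ → ∀ i j : Fin n, (j : ℕ) = i + 1 →
    Fn n θ = Fn n (θ ∘ Equiv.swap i j) * S N (θ i - θ j)
  /-- crossing -/
  crossing : ∀ n (θ₁ : ℂ) (θ : Fin n → ℂ),
    Regular N (Fin.cons (θ₁ + I * Real.pi) θ : Fin (n + 1) → ℂ) →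
    σ * Fn (n + 1) (Fin.cons (θ₁ + I * Real.pi) θ) = Fn (n + 1) (Fin.snoc θ (θ₁ - I * Real.pi))
  /-- the annihilation pole of the antiparticle, of type `N - 1`, and a particle of
  type `1` -/
  annihilation : ∀ n (θ : Fin (n + 1) → ℂ), Generic N θ →
    HasResidue (fun t => boundFormFactor N Fn (N - 2) (n + 1) (Fin.cons t θ))
      (θ 0 + I * Real.pi)
      (2 * I * Fn n (Fin.tail θ) * (1 - σ * ∏ i : Fin n, S N (θ 0 - θ i.succ)))
  /-- the bound state pole of the particles of types `a + 1` and `1`, `a + 1 ≤ N - 2` -/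
  bound : ∀ a, a + 2 < N → ∀ n (θ : Fin (n + 1) → ℂ), Generic N θ →
    HasResidue (fun t => boundFormFactor N Fn a (n + 1) (Fin.cons t θ))
      (θ 0 + I * etaB N (a + 1))
      ((Real.sqrt 2 : ℂ) * Gam N (a + 1) *
        boundFormFactor N Fn (a + 1) n
          (Fin.cons (θ 0 + (a + 1) * (I * eta N / 2)) (Fin.tail θ)))
  /-- bound states and annihilation combined: the recursion with particles of type `1` only -/
  combined : ∀ n, HasIteratedResidue N n
    (fun θ => 2 * I * Fn n (Fin.tail θ) * (1 - σ * ∏ i : Fin n, S N (θ 0 - θ i.succ)) *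
      ∏ α ∈ Finset.Icc 1 (N - 2), (Real.sqrt 2 : ℂ) * Gam N α)
    (N - 1) (Fn (n + 1 + (N - 1)))
  /-- Lorentz covariance -/
  boost : ∀ n (θ : Fin n → ℂ), Regular N θ → ∀ μ : ℂ,
    Fn n (fun i => θ i + μ) = exp (s * μ) * Fn n θ

end

end ZNIsing

namespace ZNIsing

open Complex Filter Topology

noncomputable section

/-! Everything is reduced to a finite sum over colourings of the rapidities. The integral
representation gives `F` as a constant times `sinh (θ/2)` times the exponential of a holomorphic
function on the strip `-η < Im θ < 2π + η` (`IsMinimalFormFactor.eq_of_mem_strip`). Hence `F(2πi -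
θ) = F(θ)`, `F(θ) = F(-θ) S(θ)`, and `F` is holomorphic outside `iηℤ`. Comparing the functional
equation of `φ` at `z` and `z + iη` then shows that `ψ(z) = φ(z) sinh (z/2) sinh ((z + iη)/2)` is
entire, zero-free, even and `iη`-periodic (`IsPhiTauKappa.exists_phiShape`). So `φ` has only simple
poles, at `0` and `-iη` modulo `2πi`, it satisfies `φ(-z) = φ(z - iη) = φ(z) S(z)`, and `τ`, `κ` are
entire and vanish at `0`.

The contour integrals therefore place each variable at a rapidity. The zeros of `τ` and `κ` forbid
two variables at one point, so a placement is a colouring `g` with values in `0, …, N - 1`, where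
colour `0` means no variable. All factors collapse to the product of `φ(θ_i - θ_j)` over `g j < g i`
(`placeWeight_filling`, `blockI_eq_colorSum`). Watson's equation, crossing and covariance follow
from the symmetry, the shift and the boost property of this sum together with the properties of `F`.

For the residues, the pole at `θ_j - θ_{j+1} = iη` comes from the factor `φ(θ_{j+1} - θ_j)`, present
only if the colour increases along this link. At the last link `θ_1 - θ_N` tends to `(N - 1) iη`,
which is `-iη` modulo `2πi`, so `φ(θ_1 - θ_N)` has a pole as well, with the opposite sign. In either
case `N` colours increase strictly along `N` points, so the chain is coloured `0, …, N - 1` in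
order, or the same up to a cyclic rotation. The chain variables then sit at `θ_2, …, θ_N` or at
`θ_1, …, θ_{N-1}`, and the recursion of the p-functions yields the factors `1` and `σ`. The weight
between chain and free rapidity does not depend on the colour of the latter (`prod_fin_skip`); the
functional equation cancels it against `F`, up to one factor `S` in the rotated case. The difference
of both contributions is the factor `1 - σ ∏ S` (`linkedFormFactor_close`). Form factors of bound
states are the intermediate residues, divided by the intertwiners, which do not vanish. -/

/-! ### Simple poles -/

/-- `f` has at most a simple pole at `a`, with residue `c`. -/
def HasSimplePole (f : ℂ → ℂ) (a c : ℂ) : Prop :=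
  ∃ g : ℂ → ℂ, AnalyticAt ℂ g a ∧ g a = c ∧ f =ᶠ[𝓝[≠] a] fun z => g z / (z - a)

namespace HasSimplePole

variable {f g : ℂ → ℂ} {a c d : ℂ}

theorem congr (hf : HasSimplePole f a c) (h : g =ᶠ[𝓝[≠] a] f) : HasSimplePole g a c := by
  obtain ⟨k, hk, hc, he⟩ := hf
  exact ⟨k, hk, hc, h.trans he⟩

theorem of_analyticAt (hf : AnalyticAt ℂ f a) : HasSimplePole f a 0 := by
  refine ⟨fun z => f z * (z - a), by fun_prop, by simp, ?_⟩
  filter_upwards [self_mem_nhdsWithin] with z hz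
  rw [mul_div_cancel_right₀ _ (sub_ne_zero.2 hz)]

theorem mul_analyticAt (hf : HasSimplePole f a c) (hg : AnalyticAt ℂ g a) :
    HasSimplePole (fun z => g z * f z) a (g a * c) := by
  obtain ⟨k, hk, hc, he⟩ := hf
  refine ⟨fun z => g z * k z, hg.mul hk, by simp [hc], ?_⟩
  filter_upwards [he] with z hz
  rw [hz, mul_div_assoc]

theorem const_mul (hf : HasSimplePole f a c) (b : ℂ) :
    HasSimplePole (fun z => b * f z) a (b * c) :=
  hf.mul_analyticAt (g := fun _ => b) analyticAt_const

theorem add (hf : HasSimplePole f a c) (hg : HasSimplePole g a d) :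
    HasSimplePole (fun z => f z + g z) a (c + d) := by
  obtain ⟨k, hk, hc, he⟩ := hf
  obtain ⟨k', hk', hc', he'⟩ := hg
  refine ⟨fun z => k z + k' z, hk.add hk', by simp [hc, hc'], ?_⟩
  filter_upwards [he, he'] with z hz hz'
  rw [hz, hz', add_div]

theorem sum {ι : Type*} (s : Finset ι) {f : ι → ℂ → ℂ} {c : ι → ℂ}
    (hf : ∀ i ∈ s, HasSimplePole (f i) a (c i)) :
    HasSimplePole (fun z => ∑ i ∈ s, f i z) a (∑ i ∈ s, c i) := by
  classical
  induction s using Finset.induction_on with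
  | empty => simpa using of_analyticAt (f := fun _ => 0) (a := a) analyticAt_const
  | insert i s hi ih =>
    simp only [Finset.sum_insert hi]
    exact (hf i (Finset.mem_insert_self _ _)).add
      (ih fun j hj => hf j (Finset.mem_insert_of_mem hj))

theorem comp_sub_const (hf : HasSimplePole f a c) (b : ℂ) :
    HasSimplePole (fun z => f (z - b)) (a + b) c := by
  obtain ⟨k, hk, hc, he⟩ := hf
  have ht : Tendsto (fun z : ℂ => z - b) (𝓝[≠] (a + b)) (𝓝[≠] a) := by
    refine tendsto_nhdsWithin_iff.2 ⟨?_, ?_⟩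
    · have : Tendsto (fun z : ℂ => z - b) (𝓝 (a + b)) (𝓝 (a + b - b)) :=
        (continuous_id.sub continuous_const).tendsto _
      rw [add_sub_cancel_right] at this
      exact this.mono_left nhdsWithin_le_nhds
    · filter_upwards [self_mem_nhdsWithin] with z hz h
      exact hz (by rw [Set.mem_singleton_iff] at *; rw [← h]; ring)
  refine ⟨fun z => k (z - b), ?_, by simp [hc], ?_⟩
  · refine AnalyticAt.comp_of_eq (f := fun z => z - b) hk (by fun_prop) (by ring)
  · filter_upwards [ht.eventually he] with z hz
    rw [hz]; congr 1; ring

theorem comp_const_sub (hf : HasSimplePole f a c) (b : ℂ) :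
    HasSimplePole (fun z => f (b - z)) (b - a) (-c) := by
  obtain ⟨k, hk, hc, he⟩ := hf
  have ht : Tendsto (fun z : ℂ => b - z) (𝓝[≠] (b - a)) (𝓝[≠] a) := by
    refine tendsto_nhdsWithin_iff.2 ⟨?_, ?_⟩
    · have : Tendsto (fun z : ℂ => b - z) (𝓝 (b - a)) (𝓝 (b - (b - a))) :=
        (continuous_const.sub continuous_id).tendsto _
      rw [sub_sub_cancel] at this
      exact this.mono_left nhdsWithin_le_nhds
    · filter_upwards [self_mem_nhdsWithin] with z hz h
      exact hz (by rw [Set.mem_singleton_iff] at *; rw [← h]; ring)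
  refine ⟨fun z => -k (b - z), ?_, by simp [hc], ?_⟩
  · exact (AnalyticAt.comp_of_eq (f := fun z => b - z) hk (by fun_prop) (by ring)).neg
  · filter_upwards [ht.eventually he] with z hz
    rw [hz, show z - (b - a) = -(b - z - a) by ring, neg_div_neg_eq]

/-- The integrals over small circles of `f h`, `h` entire, with a radius that works for all `h`. -/
theorem exists_circleIntegral_mul (hf : HasSimplePole f a c) :
    ∀ᶠ r in 𝓝[>] (0 : ℝ), ∀ h : ℂ → ℂ, Differentiable ℂ h →
      (∮ z in C(a, r), f z * h z) = 2 * Real.pi * I * (c * h a) := by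
  obtain ⟨k, hk, hc, he⟩ := hf
  obtain ⟨ε, hε, hkε⟩ := Metric.eventually_nhds_iff_ball.1 hk.eventually_analyticAt
  obtain ⟨δ, hδ, hfδ⟩ := Metric.eventually_nhds_iff_ball.1 (eventually_nhdsWithin_iff.1 he)
  have hpos : (0 : ℝ) < min ε δ := lt_min hε hδ
  filter_upwards [Ioo_mem_nhdsGT hpos] with r hr h hh
  have hr0 : 0 < r := hr.1
  have hcong : (∮ z in C(a, r), f z * h z) = ∮ z in C(a, r), (z - a)⁻¹ • (k z * h z) := by
    refine circleIntegral.integral_congr hr0.le fun z hz => ?_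
    have hz' : dist z a = r := hz
    have hne : z ≠ a := by
      rintro rfl
      rw [dist_self] at hz'
      exact hr0.ne hz'
    have := hfδ z (by rw [Metric.mem_ball, hz']; exact hr.2.trans_le (min_le_right _ _)) hne
    simp only [this, smul_eq_mul]
    ring
  have hd : DiffContOnCl ℂ (fun z => k z * h z) (Metric.ball a r) := by
    refine DifferentiableOn.diffContOnCl fun z hz => ?_
    have hz' : z ∈ Metric.closedBall a r := Metric.closure_ball_subset_closedBall hz
    have := hkε z (Metric.mem_ball.2 ((Metric.mem_closedBall.1 hz').trans_lt
      (hr.2.trans_le (min_le_left _ _))))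
    exact (this.differentiableAt.mul hh.differentiableAt).differentiableWithinAt
  rw [hcong, hd.circleIntegral_sub_inv_smul (Metric.mem_ball_self hr0), hc, smul_eq_mul]

theorem eventually_circleIntegral (hf : HasSimplePole f a c) :
    ∀ᶠ r in 𝓝[>] (0 : ℝ), (∮ z in C(a, r), f z) = 2 * Real.pi * I * c := by
  filter_upwards [hf.exists_circleIntegral_mul] with r hr
  simpa using hr (fun _ => 1) (differentiable_const _)

theorem hasResidue (hf : HasSimplePole f a c) : HasResidue f a c := by
  refine ⟨?_, ?_⟩
  · obtain ⟨k, hk, hc, he⟩ := hf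
    refine MeromorphicAt.congr (f := fun z => k z / (z - a)) ?_ he.symm
    exact hk.meromorphicAt.div (by fun_prop)
  · filter_upwards [hf.eventually_circleIntegral] with r hr
    rw [hr, ← mul_assoc, inv_mul_cancel₀ two_pi_I_ne_zero, one_mul]

theorem residue_eq (hf : HasSimplePole f a c) : residue f a = c :=
  (tendsto_const_nhds.congr' (hf.hasResidue.2.mono fun _ h => h.symm)).limUnder_eq

end HasSimplePole

/-- A quotient of analytic functions has a simple pole at a simple zero of the denominator. -/
theorem hasSimplePole_div {f g : ℂ → ℂ} {a g' : ℂ} (hf : AnalyticAt ℂ f a) (hg : AnalyticAt ℂ g a)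
    (h0 : g a = 0) (hd : HasDerivAt g g' a) (hg' : g' ≠ 0) :
    HasSimplePole (fun z => f z / g z) a (f a / g') := by
  have hsl : AnalyticAt ℂ (dslope g a) a := by
    obtain ⟨p, hp⟩ := hg
    exact ⟨_, hp.has_fpower_series_dslope_fslope⟩
  have hsa : dslope g a a = g' := by rw [dslope_same, hd.deriv]
  refine ⟨fun z => f z / dslope g a z, hf.div hsl (by rwa [hsa]), by simp [hd.deriv], ?_⟩
  filter_upwards [self_mem_nhdsWithin] with z hz
  have hz' : z - a ≠ 0 := sub_ne_zero.2 hz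
  rw [dslope_of_ne _ hz, slope_def_field, h0, sub_zero]
  by_cases hgz : g z = 0
  · simp [hgz]
  · field_simp

/-! ### Identities between meromorphic functions -/

/-- Two meromorphic functions on a connected set that agree frequently near a point agree outside
a discrete set. -/
theorem eventuallyEq_nhdsNE_of_frequently_eq {f g : ℂ → ℂ} {U : Set ℂ} (hU : IsPreconnected U)
    (hf : MeromorphicOn f U) (hg : MeromorphicOn g U) {a : ℂ} (ha : a ∈ U)
    (h : ∃ᶠ z in 𝓝[≠] a, f z = g z) {z : ℂ} (hz : z ∈ U) : f =ᶠ[𝓝[≠] z] g := by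
  have hm : MeromorphicOn (fun z => f z - g z) U := fun z hz => (hf z hz).sub (hg z hz)
  have hao : meromorphicOrderAt (fun z => f z - g z) a = ⊤ := by
    by_contra hne
    have := (meromorphicOrderAt_ne_top_iff_eventually_ne_zero (hm a ha)).1 hne
    exact h (this.mono fun z hz he => hz (sub_eq_zero.2 he))
  have hzo : meromorphicOrderAt (fun z => f z - g z) z = ⊤ := by
    by_contra hne
    exact hm.meromorphicOrderAt_ne_top_of_isPreconnected hU hz ha hne hao
  filter_upwards [meromorphicOrderAt_eq_top_iff.1 hzo] with w hw
  exact sub_eq_zero.1 hw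

/-- Meromorphic functions in normal form are determined by their values near the point. -/
theorem eq_of_meromorphicNFAt_of_eventuallyEq {f g : ℂ → ℂ} {a : ℂ} (hf : MeromorphicNFAt f a)
    (hg : MeromorphicNFAt g a) (h : f =ᶠ[𝓝[≠] a] g) : f a = g a :=
  ((hf.eventuallyEq_nhdsNE_iff_eventuallyEq_nhds hg).1 h).self_of_nhds

theorem eventually_codiscrete_iff {P : ℂ → Prop} :
    (∀ᶠ z in codiscrete ℂ, P z) ↔ ∀ a, ∀ᶠ z in 𝓝[≠] a, P z := by
  rw [codiscrete, Filter.Eventually, mem_codiscreteWithin]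
  simp only [Set.mem_univ, true_implies, Filter.disjoint_principal_right]
  refine forall_congr' fun a => ?_
  rw [Filter.Eventually]
  congr! 1
  ext x
  simp

/-! ### Integrals of `1 - cosh (t w)` against a decaying kernel -/

theorem norm_cosh_le_exp (z : ℂ) : ‖cosh z‖ ≤ Real.exp |z.re| := by
  have h1 : ‖exp z‖ ≤ Real.exp |z.re| := by
    rw [norm_exp]; exact Real.exp_le_exp.2 (le_abs_self _)
  have h2 : ‖exp (-z)‖ ≤ Real.exp |z.re| := by
    rw [norm_exp]; exact Real.exp_le_exp.2 (by simpa using neg_le_abs z.re)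
  rw [Complex.cosh, norm_div, Complex.norm_ofNat]
  linarith [norm_add_le (exp z) (exp (-z))]

theorem norm_sinh_le_mul_exp (z : ℂ) : ‖sinh z‖ ≤ ‖z‖ * Real.exp |z.re| := by
  -- Mean value inequality on the vertical strip `|Re w| ≤ |Re z|`, which is convex, contains `0`
  -- and `z`, and on which the derivative `cosh` is bounded by `exp |Re z|`.
  have hconv : Convex ℝ (re ⁻¹' (Set.Icc (-|z.re|) |z.re|)) :=
    (convex_Icc (-|z.re|) |z.re|).linear_preimage reLm
  have h := hconv.norm_image_sub_le_of_norm_deriv_le (𝕜 := ℂ) (f := sinh)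
    (C := Real.exp |z.re|) (x := 0) (y := z)
    (fun w _ => differentiable_sinh w) (fun w hw => by
      rw [Complex.deriv_sinh]
      exact (norm_cosh_le_exp w).trans (Real.exp_le_exp.2 (abs_le.2 hw)))
    (by simp) (abs_le.1 le_rfl)
  simpa [mul_comm] using h

/-- From `1 - cosh z = -2 sinh² (z/2)`. The quadratic vanishing at `0` compensates the double pole
of the kernels below. -/
theorem norm_one_sub_cosh_le (z : ℂ) : ‖1 - cosh z‖ ≤ ‖z‖ ^ 2 * Real.exp |z.re| := by
  have h : 1 - cosh z = -(2 * sinh (z / 2) ^ 2) := by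
    have h1 := Complex.cosh_two_mul (z / 2)
    have h2 := Complex.cosh_sq (z / 2)
    rw [mul_div_cancel₀ z (two_ne_zero)] at h1
    rw [h1, h2]; ring
  have h3 := norm_sinh_le_mul_exp (z / 2)
  have hre : |(z / 2).re| = |z.re| / 2 := by
    rw [show z / 2 = z / ((2 : ℝ) : ℂ) by simp, div_ofReal_re, abs_div, abs_two]
  rw [hre, norm_div, Complex.norm_ofNat] at h3
  rw [h, norm_neg, norm_mul, norm_pow, Complex.norm_ofNat]
  have hsq : ‖sinh (z / 2)‖ ^ 2 ≤ (‖z‖ / 2 * Real.exp (|z.re| / 2)) ^ 2 := by gcongr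
  have he : Real.exp (|z.re| / 2) ^ 2 = Real.exp |z.re| := by
    rw [← Real.exp_nat_mul]; congr 1; push_cast; ring
  rw [mul_pow, he, div_pow] at hsq
  have : 0 ≤ ‖z‖ ^ 2 * Real.exp |z.re| := by positivity
  linarith

/-- The kernel `k` is continuous on `(0, ∞)`, with at most a double pole at `0` and decay at any
exponential rate less than `b`. -/
structure KernelDecay (k : ℝ → ℝ) (b : ℝ) : Prop where
  continuousOn : ContinuousOn k (Set.Ioi 0)
  bound : ∀ c < b, ∃ C, ∀ t, 0 < t → t ^ 2 * |k t| ≤ C * Real.exp (-c * t)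

/-- The transform `∫ k(t) (1 - cosh (t w)) dt` over `(0, ∞)`. -/
def coshTransform (k : ℝ → ℝ) (w : ℂ) : ℂ :=
  ∫ t in Set.Ioi (0 : ℝ), (k t : ℂ) * (1 - cosh (t * w))

namespace KernelDecay

variable {k : ℝ → ℝ} {b : ℝ}

theorem aestronglyMeasurable_mul (hk : KernelDecay k b) {f : ℝ → ℂ} (hf : Continuous f) :
    MeasureTheory.AEStronglyMeasurable (fun t => (k t : ℂ) * f t)
      (MeasureTheory.volume.restrict (Set.Ioi 0)) :=
  ContinuousOn.aestronglyMeasurable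
    ((continuous_ofReal.comp_continuousOn hk.continuousOn).mul hf.continuousOn) measurableSet_Ioi

/-- The factor `t ^ 2` in the bound absorbs the pole of the kernel; a decay rate `c` strictly
between `r` and `b` then leaves an integrable exponential. -/
theorem integrableOn_of_norm_le (hk : KernelDecay k b) {f : ℝ → ℂ} (hf : Continuous f) {A r : ℝ}
    (hr : r < b) (hfb : ∀ t, 0 < t → ‖f t‖ ≤ A * t ^ 2 * Real.exp (r * t)) :
    MeasureTheory.IntegrableOn (fun t => (k t : ℂ) * f t) (Set.Ioi 0) := by
  obtain ⟨c, hrc, hcb⟩ := exists_between hr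
  obtain ⟨C, hC⟩ := hk.bound c hcb
  have hint := (integrableOn_exp_mul_Ioi (a := r - c) (by linarith) 0).const_mul (|A| * C)
  refine MeasureTheory.Integrable.mono' hint (hk.aestronglyMeasurable_mul hf) ?_
  refine (MeasureTheory.ae_restrict_iff' measurableSet_Ioi).2 (Eventually.of_forall fun t ht => ?_)
  have ht0 : (0 : ℝ) < t := ht
  rw [norm_mul, norm_real, Real.norm_eq_abs]
  calc |k t| * ‖f t‖ ≤ |k t| * (|A| * t ^ 2 * Real.exp (r * t)) := by
        refine mul_le_mul_of_nonneg_left ((hfb t ht0).trans ?_) (abs_nonneg _)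
        gcongr; exact le_abs_self A
    _ = |A| * (t ^ 2 * |k t|) * Real.exp (r * t) := by ring
    _ ≤ |A| * (C * Real.exp (-c * t)) * Real.exp (r * t) := by
        exact mul_le_mul_of_nonneg_right (mul_le_mul_of_nonneg_left (hC t ht0) (abs_nonneg _))
          (Real.exp_pos _).le
    _ = |A| * C * Real.exp ((r - c) * t) := by
        rw [show (r - c) * t = -c * t + r * t by ring, Real.exp_add]; ring

theorem integrableOn_one_sub_cosh (hk : KernelDecay k b) {w : ℂ} (hw : |w.re| < b) :
    MeasureTheory.IntegrableOn (fun t : ℝ => (k t : ℂ) * (1 - cosh (t * w))) (Set.Ioi 0) := by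
  refine hk.integrableOn_of_norm_le (A := ‖w‖ ^ 2) (r := |w.re|) (by fun_prop) hw fun t ht => ?_
  have := norm_one_sub_cosh_le (t * w)
  rw [re_ofReal_mul, abs_mul, abs_of_pos ht, norm_mul, norm_real, Real.norm_eq_abs,
    abs_of_pos ht] at this
  refine this.trans (le_of_eq ?_)
  rw [mul_comm t |w.re|]; ring

theorem norm_mul_sinh_le {w : ℂ} {t : ℝ} (ht : 0 < t) :
    ‖(t : ℂ) * sinh (t * w)‖ ≤ ‖w‖ * t ^ 2 * Real.exp (|w.re| * t) := by
  have := norm_sinh_le_mul_exp (t * w)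
  rw [re_ofReal_mul, abs_mul, abs_of_pos ht, norm_mul, norm_real, Real.norm_eq_abs,
    abs_of_pos ht] at this
  rw [norm_mul, norm_real, Real.norm_eq_abs, abs_of_pos ht, mul_comm |w.re| t]
  calc t * ‖sinh (t * w)‖ ≤ t * (t * ‖w‖ * Real.exp (t * |w.re|)) := by gcongr
    _ = _ := by ring

theorem integrableOn_mul_sinh (hk : KernelDecay k b) {w : ℂ} (hw : |w.re| < b) :
    MeasureTheory.IntegrableOn (fun t : ℝ => (k t : ℂ) * (t * sinh (t * w))) (Set.Ioi 0) :=
  hk.integrableOn_of_norm_le (by fun_prop) hw fun _ ht => norm_mul_sinh_le ht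

/-- Differentiation under the integral. Two intermediate rates are needed: `r` bounds `|Re v|` in a
neighbourhood of `w`, and `c > r` is the decay of the kernel, so that `exp ((r - c) t)` dominates
there. -/
theorem hasDerivAt_coshTransform (hk : KernelDecay k b) {w : ℂ} (hw : |w.re| < b) :
    HasDerivAt (coshTransform k)
      (∫ t in Set.Ioi (0 : ℝ), (k t : ℂ) * -(t * sinh (t * w))) w := by
  obtain ⟨r, hwr, hrb⟩ := exists_between hw
  obtain ⟨c, hrc, hcb⟩ := exists_between hrb
  obtain ⟨C, hC⟩ := hk.bound c hcb
  have hs : {v : ℂ | |v.re| < r} ∩ Metric.ball w 1 ∈ 𝓝 w := by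
    refine inter_mem ?_ (Metric.ball_mem_nhds w one_pos)
    exact (isOpen_lt (by fun_prop) continuous_const).mem_nhds hwr
  refine (hasDerivAt_integral_of_dominated_loc_of_deriv_le
    (F := fun v t => (k t : ℂ) * (1 - cosh (t * v)))
    (F' := fun v t => (k t : ℂ) * -(t * sinh (t * v)))
    (bound := fun t => (‖w‖ + 1) * C * Real.exp ((r - c) * t))
    hs (Eventually.of_forall fun v => hk.aestronglyMeasurable_mul (by fun_prop))
    (hk.integrableOn_one_sub_cosh hw) (hk.aestronglyMeasurable_mul (by fun_prop)) ?_ ?_ ?_).2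
  · refine (MeasureTheory.ae_restrict_iff' measurableSet_Ioi).2
      (Eventually.of_forall fun t ht v hv => ?_)
    have ht0 : (0 : ℝ) < t := ht
    have hvn : ‖v‖ ≤ ‖w‖ + 1 := by
      have h1 : ‖v - w‖ < 1 := mem_ball_iff_norm.1 hv.2
      have h2 := norm_le_norm_add_norm_sub' v w
      linarith
    have hvr : |v.re| ≤ r := le_of_lt hv.1
    rw [norm_mul, norm_neg, norm_real, Real.norm_eq_abs]
    calc |k t| * ‖(t : ℂ) * sinh (t * v)‖
        ≤ |k t| * ((‖w‖ + 1) * t ^ 2 * Real.exp (r * t)) := by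
          refine mul_le_mul_of_nonneg_left ((norm_mul_sinh_le ht0).trans ?_) (abs_nonneg _)
          gcongr
      _ = (‖w‖ + 1) * (t ^ 2 * |k t|) * Real.exp (r * t) := by ring
      _ ≤ (‖w‖ + 1) * (C * Real.exp (-c * t)) * Real.exp (r * t) := by
          exact mul_le_mul_of_nonneg_right (mul_le_mul_of_nonneg_left (hC t ht0) (by positivity))
            (Real.exp_pos _).le
      _ = (‖w‖ + 1) * C * Real.exp ((r - c) * t) := by
          rw [show (r - c) * t = -c * t + r * t by ring, Real.exp_add]; ring
  · exact (integrableOn_exp_mul_Ioi (a := r - c) (by linarith) 0).const_mul _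
  · refine Eventually.of_forall fun t v _ => ?_
    have h1 : HasDerivAt (fun v : ℂ => (t : ℂ) * v) t v := by
      simpa using (hasDerivAt_id v).const_mul (t : ℂ)
    have h2 := (h1.ccosh.const_sub 1).const_mul (k t : ℂ)
    exact h2.congr_deriv (by ring)

end KernelDecay

/-- Lets the linear factor in `div_sinh_le` be paid for by an arbitrarily small loss of exponential
rate. -/
theorem one_add_two_mul_le_exp {δ t : ℝ} (hδ : 0 < δ) (ht : 0 < t) :
    1 + 2 * t ≤ (1 + 2 / δ) * Real.exp (δ * t) := by
  have h1 : 1 + 2 * t ≤ (1 + 2 / δ) * (δ * t + 1) := by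
    have : (1 + 2 / δ) * (δ * t + 1) = 1 + 2 * t + δ * t + 2 / δ := by
      field_simp; ring
    rw [this]
    have : 0 < 2 / δ := by positivity
    have : 0 < δ * t := by positivity
    linarith
  refine h1.trans (mul_le_mul_of_nonneg_left (Real.add_one_le_exp _) (by positivity))

/-- After multiplication by `sinh t` this amounts to `(1 + 2t) exp (-2t) ≤ 1`. -/
theorem div_sinh_le {t : ℝ} (ht : 0 < t) : t / Real.sinh t ≤ (1 + 2 * t) * Real.exp (-t) := by
  have hs : 0 < Real.sinh t := Real.sinh_pos_iff.2 ht
  rw [div_le_iff₀ hs]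
  have h1 : 1 + 2 * t ≤ Real.exp (2 * t) := by linarith [Real.add_one_le_exp (2 * t)]
  have h2 : Real.exp (-t) * Real.sinh t = (1 - Real.exp (-(2 * t))) / 2 := by
    rw [Real.sinh_eq, mul_div_assoc', mul_sub, ← Real.exp_add, ← Real.exp_add]
    simp only [neg_add_cancel, Real.exp_zero]
    rw [show -t + -t = -(2 * t) by ring]
  rw [mul_assoc, h2, Real.exp_neg]
  have h3 : (1 + 2 * t) * (Real.exp (2 * t))⁻¹ ≤ 1 := by
    rw [← div_eq_mul_inv]; exact (div_le_one (Real.exp_pos _)).2 h1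
  nlinarith

theorem kernelDecay_inv_mul_sinh : KernelDecay (fun t => 1 / (t * Real.sinh t)) 1 := by
  constructor
  · refine ContinuousOn.div continuousOn_const (by fun_prop) fun t ht => ?_
    exact (mul_pos ht (Real.sinh_pos_iff.2 ht)).ne'
  · intro c hc
    refine ⟨1 + 2 / (1 - c), fun t ht => ?_⟩
    have hs : 0 < Real.sinh t := Real.sinh_pos_iff.2 ht
    have h1 : t ^ 2 * |1 / (t * Real.sinh t)| = t / Real.sinh t := by
      rw [abs_of_pos (by positivity)]; field_simp
    rw [h1]
    refine (div_sinh_le ht).trans ?_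
    calc (1 + 2 * t) * Real.exp (-t)
        ≤ (1 + 2 / (1 - c)) * Real.exp ((1 - c) * t) * Real.exp (-t) := by
          gcongr; exact one_add_two_mul_le_exp (by linarith) ht
      _ = _ := by rw [mul_assoc, ← Real.exp_add]; congr 2; ring

theorem kernelDecay_sinh_div {a : ℝ} (ha : 0 ≤ a) :
    KernelDecay (fun t => 1 / t * (Real.sinh (t * a) / Real.sinh t ^ 2)) (2 - a) := by
  constructor
  · refine ContinuousOn.mul (ContinuousOn.div continuousOn_const (by fun_prop) fun t ht => ?_)
      (ContinuousOn.div (by fun_prop) (by fun_prop) fun t ht => ?_)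
    · exact ne_of_gt ht
    · exact pow_ne_zero 2 (Real.sinh_pos_iff.2 ht).ne'
  · intro c hc
    -- `t / sinh t` enters squared, so each of its two factors may use up half of the gap between
    -- `c` and `2 - a`.
    have hδ : 0 < (2 - a - c) / 2 := by linarith
    refine ⟨a * (1 + 2 / ((2 - a - c) / 2)) ^ 2, fun t ht => ?_⟩
    have hs : 0 < Real.sinh t := Real.sinh_pos_iff.2 ht
    have hsa : 0 ≤ Real.sinh (t * a) := Real.sinh_nonneg_iff.2 (by positivity)
    have h1 : t ^ 2 * |1 / t * (Real.sinh (t * a) / Real.sinh t ^ 2)| =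
        t / Real.sinh t ^ 2 * Real.sinh (t * a) := by
      rw [abs_of_nonneg (by positivity)]; field_simp
    have h2 : Real.sinh (t * a) ≤ t * a * Real.exp (t * a) := by
      have := norm_sinh_le_mul_exp ((t * a : ℝ) : ℂ)
      rw [← ofReal_sinh, norm_real, norm_real, Real.norm_eq_abs, Real.norm_eq_abs,
        abs_of_nonneg hsa, ofReal_re, abs_of_nonneg (by positivity : 0 ≤ t * a)] at this
      exact this
    rw [h1]
    calc t / Real.sinh t ^ 2 * Real.sinh (t * a)
        ≤ t / Real.sinh t ^ 2 * (t * a * Real.exp (t * a)) := by gcongr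
      _ = a * (t / Real.sinh t) ^ 2 * Real.exp (t * a) := by ring
      _ ≤ a * ((1 + 2 / ((2 - a - c) / 2)) * Real.exp ((2 - a - c) / 2 * t) * Real.exp (-t)) ^ 2 *
            Real.exp (t * a) := by
          gcongr
          exact (div_sinh_le ht).trans (by gcongr; exact one_add_two_mul_le_exp hδ ht)
      _ = _ := by
          rw [mul_assoc (1 + _), ← Real.exp_add, mul_pow, ← Real.exp_nat_mul, mul_assoc, mul_assoc,
            ← Real.exp_add, mul_assoc]
          congr 3; push_cast; ring

/-! ### The integral of `sinh (t w) / sinh t` -/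

theorem hasSum_two_mul_exp {t : ℝ} (ht : 0 < t) :
    HasSum (fun n : ℕ => 2 * Real.exp (-(2 * n + 1) * t)) (1 / Real.sinh t) := by
  have h := (hasSum_geometric_of_lt_one (Real.exp_pos (-(2 * t))).le
    (Real.exp_lt_one_iff.2 (by linarith))).mul_left (2 * Real.exp (-t))
  have hs : 0 < Real.sinh t := Real.sinh_pos_iff.2 ht
  have h1 : 2 * Real.exp (-t) * (1 - Real.exp (-(2 * t)))⁻¹ = 1 / Real.sinh t := by
    have : 2 * Real.sinh t * Real.exp (-t) = 1 - Real.exp (-(2 * t)) := by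
      rw [Real.sinh_eq, mul_div_cancel₀ _ two_ne_zero, sub_mul, ← Real.exp_add, ← Real.exp_add,
        add_neg_cancel, Real.exp_zero, ← two_mul, mul_neg]
    rw [← this]
    have := Real.exp_pos (-t)
    field_simp
  rw [h1] at h
  refine h.congr_fun fun n => ?_
  rw [← Real.exp_nat_mul, mul_assoc, ← Real.exp_add]
  congr 2; ring

/-- Expand `1 / sinh t` into exponentials and integrate term by term; the result is the partial
fraction series of a tangent, with poles at the odd integers. The sum of the absolute values is
again `‖sinh (t w)‖ / sinh t`, whose integrability justifies the interchange. -/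
theorem hasSum_integral_sinh_div_sinh {w : ℂ} (hw : |w.re| < 1) :
    HasSum (fun n : ℕ => 1 / ((2 * n + 1 : ℂ) - w) - 1 / ((2 * n + 1 : ℂ) + w))
      (∫ t in Set.Ioi (0 : ℝ), ((1 / (t * Real.sinh t) : ℝ) : ℂ) * (t * sinh (t * w))) := by
  have hlt := abs_lt.1 hw
  have hre : ∀ n : ℕ, (-((2 * n + 1 : ℂ) - w)).re < 0 ∧ (-((2 * n + 1 : ℂ) + w)).re < 0 := by
    intro n
    have h0 : (0 : ℝ) ≤ n := Nat.cast_nonneg n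
    constructor <;> simp <;> linarith
  have hterm : ∀ n : ℕ, (∫ t in Set.Ioi (0 : ℝ),
      ((2 * Real.exp (-(2 * n + 1) * t) : ℝ) : ℂ) * sinh (t * w)) =
      1 / ((2 * n + 1 : ℂ) - w) - 1 / ((2 * n + 1 : ℂ) + w) := by
    intro n
    have h1 : ∀ t : ℝ, ((2 * Real.exp (-(2 * n + 1) * t) : ℝ) : ℂ) * sinh (t * w) =
        exp (-((2 * n + 1 : ℂ) - w) * t) - exp (-((2 * n + 1 : ℂ) + w) * t) := by
      intro t
      have h2 : exp (-((2 * n + 1 : ℂ) - w) * t) = exp (-(2 * n + 1) * t) * exp (t * w) := by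
        rw [← exp_add]; congr 1; ring
      have h3 : exp (-((2 * n + 1 : ℂ) + w) * t) = exp (-(2 * n + 1) * t) * exp (-(t * w)) := by
        rw [← exp_add]; congr 1; ring
      rw [h2, h3, Complex.sinh]; push_cast; ring
    simp_rw [h1]
    rw [MeasureTheory.integral_sub (integrableOn_exp_mul_complex_Ioi (hre n).1 0)
      (integrableOn_exp_mul_complex_Ioi (hre n).2 0), integral_exp_mul_complex_Ioi (hre n).1,
      integral_exp_mul_complex_Ioi (hre n).2]
    simp only [ofReal_zero, mul_zero, exp_zero]
    rw [neg_div_neg_eq, neg_div_neg_eq]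
  rw [← funext hterm]
  have hpos : ∀ᵐ t : ℝ ∂(MeasureTheory.volume.restrict (Set.Ioi 0)), 0 < t :=
    MeasureTheory.ae_restrict_mem measurableSet_Ioi
  refine MeasureTheory.hasSum_integral_of_dominated_convergence
    (fun n t => 2 * Real.exp (-(2 * n + 1) * t) * ‖sinh (t * w)‖) (fun n => ?_) (fun n => ?_)
    ?_ ?_ ?_
  · exact Continuous.aestronglyMeasurable (by fun_prop)
  · refine Eventually.of_forall fun t => ?_
    rw [norm_mul, norm_real, Real.norm_eq_abs, abs_of_pos (by positivity)]
  · filter_upwards [hpos] with t ht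
    exact ((hasSum_two_mul_exp ht).mul_right _).summable
  · refine (kernelDecay_inv_mul_sinh.integrableOn_mul_sinh hw).norm.congr ?_
    filter_upwards [hpos] with t ht
    rw [((hasSum_two_mul_exp ht).mul_right _).tsum_eq, norm_mul, norm_mul, norm_real, norm_real,
      Real.norm_eq_abs, Real.norm_eq_abs, abs_of_pos ht,
      abs_of_pos (one_div_pos.2 (mul_pos ht (Real.sinh_pos_iff.2 ht)))]
    have := (Real.sinh_pos_iff.2 ht).ne'
    field_simp
  · filter_upwards [hpos] with t ht
    have h := ((hasSum_ofReal.2 (hasSum_two_mul_exp ht)).mul_right (sinh (t * w)))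
    have hs : sinh (t : ℂ) ≠ 0 := by
      rw [← ofReal_sinh]; exact ofReal_ne_zero.2 (Real.sinh_pos_iff.2 ht).ne'
    have ht' : (t : ℂ) ≠ 0 := ofReal_ne_zero.2 ht.ne'
    have he : ((1 / (t * Real.sinh t) : ℝ) : ℂ) * (t * sinh (t * w)) =
        ((1 / Real.sinh t : ℝ) : ℂ) * sinh (t * w) := by
      push_cast
      field_simp
    rw [he]
    exact h

theorem cos_pi_mul_div_two_ne_zero {w : ℂ} (hw : |w.re| < 1) : cos (Real.pi * w / 2) ≠ 0 := by
  intro h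
  obtain ⟨k, hk⟩ := cos_eq_zero_iff.1 h
  have hpi : (Real.pi : ℂ) ≠ 0 := ofReal_ne_zero.2 Real.pi_ne_zero
  have hw' : w = (2 * k + 1 : ℤ) := by
    push_cast
    field_simp at hk
    exact hk
  rw [hw', intCast_re, ← Int.cast_abs] at hw
  have : |2 * k + 1| < 1 := by exact_mod_cast hw
  rw [Int.abs_lt_one_iff] at this
  omega

/-- The odd integers are all non-zero integers without the even ones: split the cotangent series at
`w` by parity, recognise the even integers as the series at `w / 2`, and use `2 cot 2x = cot x - tan
x`. -/
theorem hasSum_pi_mul_tan {w : ℂ} (hw : |w.re| < 1)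
    (hs : Summable fun n : ℕ => 1 / ((2 * n + 1 : ℂ) - w) - 1 / ((2 * n + 1 : ℂ) + w)) :
    (∑' n : ℕ, (1 / ((2 * n + 1 : ℂ) - w) - 1 / ((2 * n + 1 : ℂ) + w))) * cos (Real.pi * w / 2) =
      Real.pi / 2 * sin (Real.pi * w / 2) := by
  by_cases hw0 : w = 0
  · simp [hw0]
  have hlt := abs_lt.1 hw
  have hmem : ∀ v : ℂ, v ≠ 0 → |v.re| < 1 → v ∈ integerComplement := by
    rintro v hv0 hv ⟨k, rfl⟩
    rw [intCast_re, ← Int.cast_abs] at hv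
    have : |k| < 1 := by exact_mod_cast hv
    rw [Int.abs_lt_one_iff] at this
    exact hv0 (by simp [this])
  have h1 := cot_series_rep' (hmem w hw0 hw)
  have hw2 : w / 2 ∈ integerComplement := by
    refine hmem _ (div_ne_zero hw0 two_ne_zero) ?_
    rw [show w / 2 = w / ((2 : ℝ) : ℂ) by simp, div_ofReal_re, abs_div, abs_two]
    linarith [abs_nonneg w.re]
  have h2 := cot_series_rep' hw2
  -- The `n`-th term of the cotangent series has its poles at `±(n + 1)`, so odd indices belong to
  -- even integers.
  have hodd : ∀ k : ℕ, 1 / (w - ((2 * k + 1 : ℕ) + 1)) + 1 / (w + ((2 * k + 1 : ℕ) + 1)) =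
      1 / 2 * (1 / (w / 2 - (k + 1)) + 1 / (w / 2 + (k + 1))) := by
    intro k
    have e1 : w - ((2 * k + 1 : ℕ) + 1) = 2 * (w / 2 - (k + 1)) := by push_cast; ring
    have e2 : w + ((2 * k + 1 : ℕ) + 1) = 2 * (w / 2 + (k + 1)) := by push_cast; ring
    rw [e1, e2]
    simp only [one_div, mul_inv]
    ring
  have heven : ∀ k : ℕ, 1 / (w - ((2 * k : ℕ) + 1)) + 1 / (w + ((2 * k : ℕ) + 1)) =
      -(1 / ((2 * k + 1 : ℂ) - w) - 1 / ((2 * k + 1 : ℂ) + w)) := by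
    intro k
    have e1 : w - ((2 * k : ℕ) + 1) = -((2 * k + 1 : ℂ) - w) := by push_cast; ring
    have e2 : w + ((2 * k : ℕ) + 1) = (2 * k + 1 : ℂ) + w := by push_cast; ring
    rw [e1, e2, one_div_neg_eq_neg_one_div]
    ring
  have hsplit := tsum_even_add_odd
    (f := fun n : ℕ => 1 / (w - ((n : ℂ) + 1)) + 1 / (w + ((n : ℂ) + 1)))
    (by simp only [heven]; exact hs.neg)
    (by simp only [hodd]; exact (summable_cotTerm hw2).mul_left _)
  simp only [heven, hodd] at hsplit
  rw [tsum_neg, tsum_mul_left, ← h2, ← h1] at hsplit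
  have hc : cos (Real.pi * w / 2) ≠ 0 := cos_pi_mul_div_two_ne_zero hw
  have hsn : sin (Real.pi * w / 2) ≠ 0 := by
    intro h
    obtain ⟨k, hk⟩ := sin_eq_zero_iff.1 h
    have hpi : (Real.pi : ℂ) ≠ 0 := ofReal_ne_zero.2 Real.pi_ne_zero
    refine hw2 ⟨k, ?_⟩
    field_simp at hk
    rw [hk]; ring
  have hcot : Real.pi * cot (Real.pi * w) =
      Real.pi / 2 * (cot (Real.pi * (w / 2)) - sin (Real.pi * w / 2) / cos (Real.pi * w / 2)) := by
    rw [cot_eq_cos_div_sin, cot_eq_cos_div_sin,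
      show Real.pi * w = 2 * (Real.pi * w / 2) by ring, sin_two_mul, cos_two_mul',
      show Real.pi * (w / 2) = 2 * (Real.pi * w / 2) / 2 by ring]
    generalize hx : Real.pi * w / 2 = x at *
    rw [mul_div_cancel_left₀ _ (two_ne_zero' ℂ)]
    field_simp
  rw [hcot] at hsplit
  have hT : (∑' n : ℕ, (1 / ((2 * n + 1 : ℂ) - w) - 1 / ((2 * n + 1 : ℂ) + w))) =
      Real.pi / 2 * (sin (Real.pi * w / 2) / cos (Real.pi * w / 2)) := by
    have e : (1 : ℂ) / 2 * (1 / (w / 2)) = 1 / w := by field_simp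
    linear_combination -hsplit + e
  rw [hT]
  field_simp

/-- `exp ∫ (1 - cosh (t w)) / (t sinh t) dt = cos (π w / 2)`. -/
theorem exp_coshTransform_inv_mul_sinh {w : ℂ} (hw : |w.re| < 1) :
    exp (coshTransform (fun t => 1 / (t * Real.sinh t)) w) = cos (Real.pi * w / 2) := by
  set G := coshTransform (fun t => 1 / (t * Real.sinh t)) with hG
  set U : Set ℂ := re ⁻¹' Set.Ioo (-1) 1 with hU
  have hUo : IsOpen U := isOpen_Ioo.preimage continuous_re
  have hUc : Convex ℝ U := (convex_Ioo (-1 : ℝ) 1).linear_preimage reLm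
  -- Compare logarithmic derivatives: `-G'(v)` is `(π/2) tan (πv/2)`, so `exp (-G) cos (πv/2)` is
  -- constant on the strip, and it is `1` at `0`.
  have hd : ∀ v ∈ U, HasDerivAt (fun v => exp (-G v) * cos (Real.pi * v / 2)) 0 v := by
    intro v hv
    have hv1 : |v.re| < 1 := abs_lt.2 hv
    have h1 := kernelDecay_inv_mul_sinh.hasDerivAt_coshTransform hv1
    have hsum := hasSum_integral_sinh_div_sinh hv1
    have htan := hasSum_pi_mul_tan hv1 hsum.summable
    rw [hsum.tsum_eq] at htan
    simp only [mul_neg, MeasureTheory.integral_neg] at h1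
    have h2 : HasDerivAt (fun v : ℂ => Real.pi * v / 2) (Real.pi / 2) v := by
      simpa using ((hasDerivAt_id v).const_mul (Real.pi : ℂ)).div_const 2
    have h3 := h1.neg.cexp.mul h2.ccos
    refine h3.congr_deriv ?_
    simp only [Pi.neg_apply]
    linear_combination exp (-G v) * htan
  have h0 : (0 : ℂ) ∈ U := by simp [hU]
  have hconst := hUo.is_const_of_deriv_eq_zero (f := fun v => exp (-G v) * cos (Real.pi * v / 2))
    hUc.isPreconnected (fun v hv => (hd v hv).differentiableAt.differentiableWithinAt)
    (fun v hv => (hd v hv).deriv) (abs_lt.1 hw : w ∈ U) h0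
  have hG0 : G 0 = 0 := by simp [hG, coshTransform]
  simp only [hG0, neg_zero, mul_zero, zero_div, exp_zero, cos_zero, mul_one] at hconst
  rw [exp_neg] at hconst
  have := exp_ne_zero (G w)
  field_simp at hconst
  exact hconst.symm

/-! ### The half-argument hyperbolic sine -/

/-- The function `sinh (z / 2)`. -/
def sh (z : ℂ) : ℂ := sinh (z / 2)

/-- The complex fusion angle `iη`. -/
def ieta (N : ℕ) : ℂ := I * eta N

theorem ieta_eq (N : ℕ) : ieta N = 2 * Real.pi * I / N := by
  simp only [ieta, eta]; push_cast; ring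

theorem natCast_mul_ieta {N : ℕ} (hN : 2 ≤ N) : (N : ℂ) * ieta N = 2 * Real.pi * I := by
  have : (N : ℂ) ≠ 0 := by norm_cast; omega
  rw [ieta_eq]; field_simp

theorem ieta_ne_zero {N : ℕ} (hN : 2 ≤ N) : ieta N ≠ 0 := by
  intro h
  have := natCast_mul_ieta hN
  rw [h, mul_zero] at this
  exact two_pi_I_ne_zero this.symm

theorem eta_pos {N : ℕ} (hN : 2 ≤ N) : 0 < eta N := by
  have : (0 : ℝ) < N := by norm_cast; omega
  unfold eta; have := Real.pi_pos; positivity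

theorem natCast_mul_eta {N : ℕ} (hN : 2 ≤ N) : (N : ℝ) * eta N = 2 * Real.pi := by
  have : (N : ℝ) ≠ 0 := by norm_cast; omega
  rw [eta]; field_simp

theorem sh_eq_zero_iff {z : ℂ} : sh z = 0 ↔ ∃ l : ℤ, z = l * (2 * Real.pi * I) := by
  have h1 : sh z = 0 ↔ sin (z / 2 * I) = 0 := by
    rw [sin_mul_I, sh]; simp
  rw [h1, sin_eq_zero_iff]
  constructor
  · rintro ⟨k, hk⟩
    refine ⟨-k, ?_⟩
    have : z = -(z / 2 * I) * 2 * I := by ring_nf; simp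
    rw [this, hk]; push_cast; ring
  · rintro ⟨l, rfl⟩
    refine ⟨-l, ?_⟩
    push_cast; ring_nf; simp

theorem sh_zero : sh 0 = 0 := by simp [sh]

theorem sh_neg (z : ℂ) : sh (-z) = -sh z := by simp [sh, neg_div]

theorem sh_add_two_pi (z : ℂ) : sh (z + 2 * Real.pi * I) = -sh z := by
  rw [sh, sh, show (z + 2 * Real.pi * I) / 2 = z / 2 + Real.pi * I by ring, sinh_add,
    cosh_mul_I, sinh_mul_I]
  simp

theorem sh_sub_two_pi (z : ℂ) : sh (z - 2 * Real.pi * I) = -sh z := by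
  have := sh_add_two_pi (z - 2 * Real.pi * I)
  rw [sub_add_cancel] at this
  rw [this, neg_neg]

theorem differentiable_sh : Differentiable ℂ sh := by
  unfold sh; fun_prop

theorem analyticAt_sh (z : ℂ) : AnalyticAt ℂ sh z := differentiable_sh.analyticAt z

theorem S_eq (N : ℕ) (z : ℂ) : S N z = sh (z + ieta N) / sh (z - ieta N) := by
  rw [S, sh, sh, ieta_eq]

theorem sh_int_mul_ieta_ne_zero {N : ℕ} (hN : 2 ≤ N) {l : ℤ} (hl : ¬ (N : ℤ) ∣ l) :
    sh (l * ieta N) ≠ 0 := by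
  intro h
  obtain ⟨k, hk⟩ := sh_eq_zero_iff.1 h
  rw [← natCast_mul_ieta hN, ← mul_assoc] at hk
  have := mul_right_cancel₀ (ieta_ne_zero hN) hk
  exact hl ⟨k, by rw [mul_comm]; exact_mod_cast this⟩

theorem sh_ne_zero_of_forall_ne {N : ℕ} (hN : 2 ≤ N) {z : ℂ} (hz : ∀ l : ℤ, z ≠ l * ieta N)
    (k : ℤ) : sh (z + k * ieta N) ≠ 0 := by
  intro h
  obtain ⟨j, hj⟩ := sh_eq_zero_iff.1 h
  rw [← natCast_mul_ieta hN] at hj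
  refine hz (j * N - k) ?_
  push_cast
  linear_combination hj

/-! ### The minimal form factor -/

/-- The part of the logarithm of the minimal form factor which is analytic in the strip
`-η < Im θ < 2π + η`. -/
def extraLog (N : ℕ) (θ : ℂ) : ℂ :=
  coshTransform (fun t => 1 / t * (Real.sinh (t * (1 - 2 / N)) / Real.sinh t ^ 2))
    (1 - θ / (I * Real.pi))

theorem re_div_I_pi (θ : ℂ) : (θ / (I * Real.pi)).re = θ.im / Real.pi := by
  rw [show θ / (I * Real.pi) = (-I * θ) / (Real.pi : ℝ) by
    rw [div_mul_eq_div_div, div_I]; ring, div_ofReal_re]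
  simp

theorem one_sub_two_div_nonneg {N : ℕ} (hN : 2 ≤ N) : (0 : ℝ) ≤ 1 - 2 / N := by
  have h2 : (2 : ℝ) ≤ N := by exact_mod_cast hN
  rw [sub_nonneg, div_le_one (by linarith)]
  exact h2

/-- Under `w = 1 - θ / (iπ)` the strip becomes `|Re w| < 1 + 2/N`, which is the range of convergence
given by the decay of the kernel of `extraLog`. -/
theorem abs_re_lt_of_mem_strip {N : ℕ} {θ : ℂ} (h1 : -eta N < θ.im)
    (h2 : θ.im < 2 * Real.pi + eta N) :
    |(1 - θ / (I * Real.pi)).re| < 2 - (1 - 2 / N) := by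
  rw [sub_re, re_div_I_pi, one_re, abs_lt]
  have hpi := Real.pi_pos
  have he : eta N = Real.pi * (2 / N) := by rw [eta]; ring
  constructor
  · have : θ.im / Real.pi < 2 + 2 / N := by
      rw [div_lt_iff₀ hpi]; linarith [he]
    linarith
  · have : -(2 / N) < θ.im / Real.pi := by
      rw [lt_div_iff₀ hpi]; linarith [he]
    linarith

theorem analyticAt_extraLog {N : ℕ} (hN : 2 ≤ N) {θ : ℂ} (h1 : -eta N < θ.im)
    (h2 : θ.im < 2 * Real.pi + eta N) : AnalyticAt ℂ (extraLog N) θ := by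
  have hopen : IsOpen {θ : ℂ | -eta N < θ.im ∧ θ.im < 2 * Real.pi + eta N} :=
    (isOpen_lt continuous_const continuous_im).inter (isOpen_lt continuous_im continuous_const)
  refine DifferentiableOn.analyticAt (s := {θ : ℂ | -eta N < θ.im ∧ θ.im < 2 * Real.pi + eta N})
    (fun v hv => ?_) (hopen.mem_nhds ⟨h1, h2⟩)
  have hd := (kernelDecay_sinh_div (one_sub_two_div_nonneg hN)).hasDerivAt_coshTransform
    (abs_re_lt_of_mem_strip hv.1 hv.2)
  have hin : DifferentiableAt ℂ (fun v : ℂ => 1 - v / (I * Real.pi)) v := by fun_prop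
  exact (hd.differentiableAt.comp v hin).differentiableWithinAt

theorem sh_eq_cos (θ : ℂ) : cos (Real.pi * (1 - θ / (I * Real.pi)) / 2) = -I * sh θ := by
  have hpi : (Real.pi : ℂ) ≠ 0 := ofReal_ne_zero.2 Real.pi_ne_zero
  have : Real.pi * (1 - θ / (I * Real.pi)) / 2 = Real.pi / 2 - -(θ / 2 * I) := by
    field_simp; ring_nf; simp; ring
  rw [this, cos_pi_div_two_sub, sin_neg, sin_mul_I, sh]; ring

/-- The identity `2 cosh (t/N) sinh (t(N-1)/N) = sinh t + sinh (t(1 - 2/N))` splits the kernel. The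
first summand gives the elementary transform of `1 / (t sinh t)`, hence the factor `sinh (θ/2)`; the
second decays faster and stays holomorphic beyond the original strip. -/
theorem exp_integral_eq {N : ℕ} (hN : 2 ≤ N) {θ : ℂ} (h1 : 0 < θ.im) (h2 : θ.im < 2 * Real.pi) :
    exp (∫ t in Set.Ioi (0 : ℝ),
      1 / (t : ℂ) * (2 * cosh (t / N) * sinh (t * (N - 1) / N) / sinh t ^ 2) *
        (1 - cosh (t * (1 - θ / (I * Real.pi))))) = -I * sh θ * exp (extraLog N θ) := by
  have hη := eta_pos hN
  have hN0 : (N : ℂ) ≠ 0 := by norm_cast; omega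
  have hw1 : |(1 - θ / (I * Real.pi)).re| < 1 := by
    rw [sub_re, re_div_I_pi, one_re, abs_lt]
    have hpi := Real.pi_pos
    have : θ.im / Real.pi < 2 := by rw [div_lt_iff₀ hpi]; exact h2
    have : 0 < θ.im / Real.pi := by positivity
    constructor <;> linarith
  have hw2 := abs_re_lt_of_mem_strip (N := N) (θ := θ) (by linarith) (by linarith)
  have hsplit : (∫ t in Set.Ioi (0 : ℝ),
      1 / (t : ℂ) * (2 * cosh (t / N) * sinh (t * (N - 1) / N) / sinh t ^ 2) *
        (1 - cosh (t * (1 - θ / (I * Real.pi))))) =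
      coshTransform (fun t => 1 / (t * Real.sinh t)) (1 - θ / (I * Real.pi)) + extraLog N θ := by
    rw [coshTransform, extraLog, coshTransform, ← MeasureTheory.integral_add
      (kernelDecay_inv_mul_sinh.integrableOn_one_sub_cosh hw1)
      ((kernelDecay_sinh_div (one_sub_two_div_nonneg hN)).integrableOn_one_sub_cosh hw2)]
    refine MeasureTheory.setIntegral_congr_fun measurableSet_Ioi fun t ht => ?_
    have ht' : (t : ℂ) ≠ 0 := ofReal_ne_zero.2 (ne_of_gt ht)
    have hs : sinh (t : ℂ) ≠ 0 := by
      rw [← ofReal_sinh]; exact ofReal_ne_zero.2 (Real.sinh_pos_iff.2 ht).ne'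
    have hprod : 2 * cosh ((t : ℂ) / N) * sinh (t * (N - 1) / N) =
        sinh t + sinh (t * (1 - 2 / N)) := by
      have e1 : (t : ℂ) = t * (N - 1) / N + t / N := by field_simp; ring
      have e2 : (t : ℂ) * (1 - 2 / N) = t * (N - 1) / N - t / N := by field_simp; ring
      rw [e2]
      nth_rewrite 3 [e1]
      rw [sinh_add, sinh_sub]; ring
    simp only [hprod]
    push_cast
    field_simp
  rw [hsplit, exp_add, exp_coshTransform_inv_mul_sinh hw1, sh_eq_cos]

/-- With `b = θ / (iπ)` the two integrands differ by the kernel times `2 sinh t sinh (t b)`. One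
`sinh t` cancels, and `2 sinh (t a) sinh (t b) = cosh (t (a + b)) - cosh (t (a - b))` leaves
transforms of `1 / (t sinh t)` at `a ± b`, which are cosines. This is how the S-matrix arises from
the integral. -/
theorem extraLog_sub_extraLog_neg {N : ℕ} (hN : 2 ≤ N) {θ : ℂ} (h1 : -eta N < θ.im)
    (h2 : θ.im < eta N) :
    exp (extraLog N θ) * sh (θ - ieta N) = -(exp (extraLog N (-θ)) * sh (θ + ieta N)) := by
  have hη := eta_pos hN
  have hpi := Real.pi_pos
  set a : ℂ := 1 - 2 / N with ha
  set b : ℂ := θ / (I * Real.pi) with hb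
  have hare : a.re = 1 - 2 / N := by
    rw [ha, show (1 : ℂ) - 2 / N = ((1 - 2 / N : ℝ) : ℂ) by push_cast; ring, ofReal_re]
  have hbre : b.re = θ.im / Real.pi := re_div_I_pi θ
  have he : eta N = Real.pi * (2 / N) := by rw [eta]; ring
  have hb1 : b.re < 2 / N := by rw [hbre, div_lt_iff₀ hpi]; linarith
  have hb2 : -(2 / N) < b.re := by rw [hbre, lt_div_iff₀ hpi]; linarith
  have ha0 := one_sub_two_div_nonneg hN
  have hwa : |(a - b).re| < 1 := by
    rw [sub_re, hare, abs_lt]; constructor <;> linarith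
  have hwb : |(a + b).re| < 1 := by
    rw [add_re, hare, abs_lt]; constructor <;> linarith
  have hw1 := abs_re_lt_of_mem_strip (N := N) (θ := θ) h1 (by linarith)
  have hw2 := abs_re_lt_of_mem_strip (N := N) (θ := -θ) (by simpa using h2)
    (by rw [neg_im]; linarith)
  have hk := kernelDecay_sinh_div ha0
  have hdiff : extraLog N θ + coshTransform (fun t => 1 / (t * Real.sinh t)) (a + b) =
      extraLog N (-θ) + coshTransform (fun t => 1 / (t * Real.sinh t)) (a - b) := by
    simp only [extraLog, coshTransform]
    rw [← MeasureTheory.integral_add (hk.integrableOn_one_sub_cosh hw1)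
        (kernelDecay_inv_mul_sinh.integrableOn_one_sub_cosh hwb),
      ← MeasureTheory.integral_add (hk.integrableOn_one_sub_cosh hw2)
        (kernelDecay_inv_mul_sinh.integrableOn_one_sub_cosh hwa)]
    refine MeasureTheory.setIntegral_congr_fun measurableSet_Ioi fun t ht => ?_
    have ht' : (t : ℂ) ≠ 0 := ofReal_ne_zero.2 (ne_of_gt ht)
    have hs : sinh (t : ℂ) ≠ 0 := by
      rw [← ofReal_sinh]; exact ofReal_ne_zero.2 (Real.sinh_pos_iff.2 ht).ne'
    have e1 : (t : ℂ) * (1 - θ / (I * Real.pi)) = t - t * b := by rw [hb]; ring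
    have e2 : (t : ℂ) * (1 - -θ / (I * Real.pi)) = t + t * b := by rw [hb]; ring
    simp only [e1, e2]
    push_cast
    rw [← ha, mul_add (t : ℂ) a b, mul_sub (t : ℂ) a b, cosh_add, cosh_sub, cosh_add, cosh_sub]
    field_simp
    ring
  have hexp := congrArg exp hdiff
  rw [exp_add, exp_add, exp_coshTransform_inv_mul_sinh hwa,
    exp_coshTransform_inv_mul_sinh hwb] at hexp
  have hpi' : (Real.pi : ℂ) ≠ 0 := ofReal_ne_zero.2 Real.pi_ne_zero
  have hN0 : (N : ℂ) ≠ 0 := by norm_cast; omega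
  have c1 : cos (Real.pi * (a + b) / 2) = I * sh (θ - ieta N) := by
    have : Real.pi * (a + b) / 2 = Real.pi * (1 - (ieta N - θ) / (I * Real.pi)) / 2 := by
      rw [ha, hb, ieta_eq]; field_simp; ring
    rw [this, sh_eq_cos, ← neg_sub θ, sh_neg]; ring
  have c2 : cos (Real.pi * (a - b) / 2) = -I * sh (θ + ieta N) := by
    have : Real.pi * (a - b) / 2 = Real.pi * (1 - (θ + ieta N) / (I * Real.pi)) / 2 := by
      rw [ha, hb, ieta_eq]; field_simp; ring
    rw [this, sh_eq_cos]
  rw [c1, c2] at hexp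
  have hI := I_ne_zero
  apply mul_left_cancel₀ hI
  linear_combination hexp

theorem cN_ne_zero (N : ℕ) : cN N ≠ 0 := mul_ne_zero (exp_ne_zero _) (exp_ne_zero _)

namespace IsMinimalFormFactor

variable {N : ℕ} {F : ℂ → ℂ}

/-- The right-hand side is holomorphic on the larger strip, so the identity theorem carries the
formula over from the strip of the integral representation. Equality at every point uses the normal
form of `F`. -/
theorem eq_of_mem_strip (hN : 2 ≤ N) (hF : IsMinimalFormFactor N F) {θ : ℂ}
    (h1 : -eta N < θ.im) (h2 : θ.im < 2 * Real.pi + eta N) :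
    F θ = -I * cN N * sh θ * exp (extraLog N θ) := by
  set U : Set ℂ := im ⁻¹' Set.Ioo (-eta N) (2 * Real.pi + eta N)
  have hη := eta_pos hN
  have hpi := Real.pi_pos
  have hUc : IsPreconnected U :=
    ((convex_Ioo (-eta N) (2 * Real.pi + eta N)).linear_preimage imLm).isPreconnected
  have hana : ∀ v ∈ U, AnalyticAt ℂ (fun θ => -I * cN N * sh θ * exp (extraLog N θ)) v := by
    intro v hv
    exact (analyticAt_const.mul (analyticAt_sh v)).mul (analyticAt_extraLog hN hv.1 hv.2).cexp
  have hpt : (Real.pi * I : ℂ) ∈ U := by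
    refine ⟨?_, ?_⟩ <;> simp <;> linarith
  refine eq_of_meromorphicNFAt_of_eventuallyEq (hF.meromorphic trivial)
    (hana θ ⟨h1, h2⟩).meromorphicNFAt ?_
  refine eventuallyEq_nhdsNE_of_frequently_eq hUc (fun v _ => (hF.meromorphic trivial).meromorphicAt)
    (fun v hv => (hana v hv).meromorphicAt) hpt ?_ (⟨h1, h2⟩ : θ ∈ U)
  refine Eventually.frequently (eventually_nhdsWithin_of_eventually_nhds ?_)
  have : im ⁻¹' Set.Ioo 0 (2 * Real.pi) ∈ 𝓝 (Real.pi * I : ℂ) :=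
    (isOpen_Ioo.preimage continuous_im).mem_nhds (by constructor <;> simp <;> linarith)
  filter_upwards [this] with v hv
  rw [hF.eq_integral v hv.1 hv.2, exp_integral_eq hN hv.1 hv.2]
  ring

theorem analyticAt_of_mem_strip (hN : 2 ≤ N) (hF : IsMinimalFormFactor N F) {θ : ℂ}
    (h1 : -eta N < θ.im) (h2 : θ.im < 2 * Real.pi + eta N) : AnalyticAt ℂ F θ := by
  have hopen : im ⁻¹' Set.Ioo (-eta N) (2 * Real.pi + eta N) ∈ 𝓝 θ :=
    (isOpen_Ioo.preimage continuous_im).mem_nhds ⟨h1, h2⟩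
  refine ((analyticAt_const (v := -I * cN N)).mul (analyticAt_sh θ)).mul
    (analyticAt_extraLog hN h1 h2).cexp |>.congr ?_
  filter_upwards [hopen] with v hv
  exact (hF.eq_of_mem_strip hN hv.1 hv.2).symm

/-- The reflection `F(2πi - θ) = F(θ)`. -/
theorem reflect (hF : IsMinimalFormFactor N F) (θ : ℂ) : F (2 * Real.pi * I - θ) = F θ := by
  have hpi := Real.pi_pos
  have hnf : ∀ v, MeromorphicNFAt (fun θ => F (2 * Real.pi * I - θ)) v := fun v =>
    (meromorphicNFAt_comp_iff_of_deriv_ne_zero (g := fun θ => 2 * Real.pi * I - θ)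
      (by fun_prop) (by simp)).2 (hF.meromorphic trivial)
  refine eq_of_meromorphicNFAt_of_eventuallyEq (hnf θ) (hF.meromorphic trivial) ?_
  refine eventuallyEq_nhdsNE_of_frequently_eq (a := (Real.pi * I : ℂ)) isPreconnected_univ
    (fun v _ => (hnf v).meromorphicAt) (fun v _ => (hF.meromorphic trivial).meromorphicAt)
    trivial ?_ trivial
  refine Eventually.frequently (eventually_nhdsWithin_of_eventually_nhds ?_)
  have : im ⁻¹' Set.Ioo 0 (2 * Real.pi) ∈ 𝓝 (Real.pi * I : ℂ) :=
    (isOpen_Ioo.preimage continuous_im).mem_nhds (by constructor <;> simp <;> linarith)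
  filter_upwards [this] with v hv
  have him : (2 * Real.pi * I - v).im = 2 * Real.pi - v.im := by simp
  rw [hF.eq_integral v hv.1 hv.2, hF.eq_integral (2 * Real.pi * I - v)
    (by rw [him]; linarith [hv.2]) (by rw [him]; linarith [hv.1])]
  have hw : 1 - (2 * Real.pi * I - v) / (I * Real.pi) = -(1 - v / (I * Real.pi)) := by
    have hpi' : (Real.pi : ℂ) ≠ 0 := ofReal_ne_zero.2 Real.pi_ne_zero
    have := I_ne_zero
    field_simp; ring
  simp only [hw, mul_neg, cosh_neg]

theorem meromorphicNFAt_comp_neg (hF : IsMinimalFormFactor N F) (v : ℂ) :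
    MeromorphicNFAt (fun θ => F (-θ)) v :=
  (meromorphicNFAt_comp_iff_of_deriv_ne_zero (g := fun θ => -θ)
      (by fun_prop) (by simp)).2 (hF.meromorphic trivial)

/-- Watson's equation with the denominator cleared, as an identity of meromorphic functions. It
suffices to check it for `|Im θ| < η`, where `θ` and `-θ` both lie in the strip of the explicit
formula. -/
theorem eventually_mul_sh_eq (hN : 2 ≤ N) (hF : IsMinimalFormFactor N F) (a : ℂ) :
    (fun θ => F θ * sh (θ - ieta N)) =ᶠ[𝓝[≠] a] fun θ => F (-θ) * sh (θ + ieta N) := by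
  have hη := eta_pos hN
  have hpi := Real.pi_pos
  have hs1 : ∀ v, AnalyticAt ℂ (fun θ => sh (θ - ieta N)) v := fun v =>
    (differentiable_sh.comp (by fun_prop : Differentiable ℂ fun θ => θ - ieta N)).analyticAt v
  have hs2 : ∀ v, AnalyticAt ℂ (fun θ => sh (θ + ieta N)) v := fun v =>
    (differentiable_sh.comp (by fun_prop : Differentiable ℂ fun θ => θ + ieta N)).analyticAt v
  refine eventuallyEq_nhdsNE_of_frequently_eq (a := 0) isPreconnected_univ
    (fun v _ => (hF.meromorphic trivial).meromorphicAt.mul (hs1 v).meromorphicAt)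
    (fun v _ => (hF.meromorphicNFAt_comp_neg v).meromorphicAt.mul (hs2 v).meromorphicAt)
    trivial ?_ trivial
  refine Eventually.frequently (eventually_nhdsWithin_of_eventually_nhds ?_)
  have : im ⁻¹' Set.Ioo (-eta N) (eta N) ∈ 𝓝 (0 : ℂ) :=
    (isOpen_Ioo.preimage continuous_im).mem_nhds (by constructor <;> simp <;> linarith)
  filter_upwards [this] with v hv
  simp only [Pi.mul_apply]
  rw [hF.eq_of_mem_strip hN hv.1 (by linarith [hv.2]),
    hF.eq_of_mem_strip hN (θ := -v) (by rw [neg_im]; linarith [hv.2])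
      (by rw [neg_im]; linarith [hv.1]), sh_neg]
  linear_combination (-I * cN N * sh v) * extraLog_sub_extraLog_neg hN hv.1 hv.2

theorem eventually_eq_mul_S (hN : 2 ≤ N) (hF : IsMinimalFormFactor N F) {a : ℂ}
    (h1 : sh (a - ieta N) ≠ 0) :
    F =ᶠ[𝓝[≠] a] fun θ => F (-θ) * S N θ := by
  have hc : ∀ᶠ θ in 𝓝[≠] a, sh (θ - ieta N) ≠ 0 := by
    refine eventually_nhdsWithin_of_eventually_nhds (ContinuousAt.eventually_ne ?_ h1)
    exact (differentiable_sh.continuous.comp (by fun_prop)).continuousAt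
  filter_upwards [hF.eventually_mul_sh_eq hN a, hc] with θ hθ hs
  rw [S_eq, ← mul_div_assoc, ← hθ, mul_div_cancel_right₀ _ hs]

theorem analyticAt_S {a : ℂ} (h1 : sh (a - ieta N) ≠ 0) : AnalyticAt ℂ (S N) a := by
  rw [show S N = fun θ => sh (θ + ieta N) / sh (θ - ieta N) from funext (S_eq N)]
  refine AnalyticAt.div ?_ ?_ h1
  · exact (differentiable_sh.comp (by fun_prop : Differentiable ℂ fun θ => θ + ieta N)).analyticAt a
  · exact (differentiable_sh.comp (by fun_prop : Differentiable ℂ fun θ => θ - ieta N)).analyticAt a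

/-- Watson's equation for the minimal form factor. -/
theorem eq_mul_S (hN : 2 ≤ N) (hF : IsMinimalFormFactor N F) {θ : ℂ}
    (h1 : sh (θ - ieta N) ≠ 0) (h2 : sh (θ + ieta N) ≠ 0) : F θ = F (-θ) * S N θ := by
  refine eq_of_meromorphicNFAt_of_eventuallyEq (g := fun θ => F (-θ) * S N θ)
    (hF.meromorphic trivial) ?_ (hF.eventually_eq_mul_S hN h1)
  have := (meromorphicNFAt_mul_iff_left (f := fun θ => F (-θ)) (analyticAt_S h1) (by
    rw [S_eq]; exact div_ne_zero h2 h1)).2 (hF.meromorphicNFAt_comp_neg θ)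
  exact this

theorem analyticAt_neg_iff (hN : 2 ≤ N) (hF : IsMinimalFormFactor N F) {θ : ℂ}
    (h1 : sh (θ - ieta N) ≠ 0) (h2 : sh (θ + ieta N) ≠ 0) (h : AnalyticAt ℂ F (-θ)) :
    AnalyticAt ℂ F θ := by
  have hc1 : ∀ᶠ v in 𝓝 θ, sh (v - ieta N) ≠ 0 := ContinuousAt.eventually_ne
    (differentiable_sh.continuous.comp (by fun_prop)).continuousAt h1
  have hc2 : ∀ᶠ v in 𝓝 θ, sh (v + ieta N) ≠ 0 := ContinuousAt.eventually_ne
    (differentiable_sh.continuous.comp (by fun_prop)).continuousAt h2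
  refine AnalyticAt.congr (f := fun θ => F (-θ) * S N θ) ?_ ?_
  · exact (AnalyticAt.comp_of_eq h (f := fun θ => -θ) (by fun_prop) rfl).mul (analyticAt_S h1)
  · filter_upwards [hc1, hc2] with v hv1 hv2
    exact (hF.eq_mul_S hN hv1 hv2).symm

theorem analyticAt_reflect (hF : IsMinimalFormFactor N F) {θ : ℂ}
    (h : AnalyticAt ℂ F (2 * Real.pi * I - θ)) : AnalyticAt ℂ F θ := by
  have := AnalyticAt.comp_of_eq h (f := fun θ => 2 * Real.pi * I - θ) (by fun_prop) rfl
  refine this.congr (Eventually.of_forall fun v => ?_)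
  exact hF.reflect v

/-- The shift by `2πi` is composed of `θ ↦ -θ` (Watson's equation) and `θ ↦ 2πi - θ` (reflection),
and both preserve analyticity here. -/
theorem analyticAt_add_two_pi_iff (hN : 2 ≤ N) (hF : IsMinimalFormFactor N F) {θ : ℂ}
    (h1 : sh (θ - ieta N) ≠ 0) (h2 : sh (θ + ieta N) ≠ 0) :
    AnalyticAt ℂ F (θ + 2 * Real.pi * I) ↔ AnalyticAt ℂ F θ := by
  have e : 2 * Real.pi * I - (θ + 2 * Real.pi * I) = -θ := by ring
  constructor
  · intro h
    refine hF.analyticAt_neg_iff hN h1 h2 (hF.analyticAt_reflect ?_)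
    rwa [sub_neg_eq_add, add_comm]
  · intro h
    refine hF.analyticAt_reflect ?_
    rw [e]
    refine hF.analyticAt_neg_iff hN ?_ ?_ (by rwa [neg_neg])
    · rw [show -θ - ieta N = -(θ + ieta N) by ring, sh_neg]; exact neg_ne_zero.2 h2
    · rw [show -θ + ieta N = -(θ - ieta N) by ring, sh_neg]; exact neg_ne_zero.2 h1

/-- The minimal form factor is analytic outside `iηℤ`. -/
theorem analyticAt_of_forall_ne (hN : 2 ≤ N) (hF : IsMinimalFormFactor N F) {θ : ℂ}
    (h : ∀ l : ℤ, θ ≠ l * ieta N) : AnalyticAt ℂ F θ := by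
  have hpi : 0 < 2 * Real.pi := by linarith [Real.pi_pos]
  have key : ∀ l : ℤ, AnalyticAt ℂ F (θ + l * (2 * Real.pi * I)) ↔ AnalyticAt ℂ F θ := by
    have step : ∀ l : ℤ, AnalyticAt ℂ F (θ + (l + 1 : ℤ) * (2 * Real.pi * I)) ↔
        AnalyticAt ℂ F (θ + l * (2 * Real.pi * I)) := by
      intro l
      have e : θ + (l + 1 : ℤ) * (2 * Real.pi * I) =
          θ + l * (2 * Real.pi * I) + 2 * Real.pi * I := by push_cast; ring
      rw [e]
      refine hF.analyticAt_add_two_pi_iff hN ?_ ?_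
      · have := sh_ne_zero_of_forall_ne hN h (l * N - 1)
        convert this using 2
        push_cast
        linear_combination -(l : ℂ) * natCast_mul_ieta hN
      · have := sh_ne_zero_of_forall_ne hN h (l * N + 1)
        convert this using 2
        push_cast
        linear_combination -(l : ℂ) * natCast_mul_ieta hN
    intro l
    induction l using Int.induction_on with
    | zero => simp
    | succ i ih => exact (step i).trans ih
    | pred i ih =>
      have := step (-i - 1)
      rw [sub_add_cancel] at this
      exact this.symm.trans ih
  -- Translation into `0 ≤ Im θ < 2π`, inside the strip of the explicit formula.
  rw [← key (-⌊θ.im / (2 * Real.pi)⌋)]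
  have him : (θ + (-⌊θ.im / (2 * Real.pi)⌋ : ℤ) * (2 * Real.pi * I)).im =
      θ.im - ⌊θ.im / (2 * Real.pi)⌋ * (2 * Real.pi) := by
    simp; ring
  have hη := eta_pos hN
  have hfl := Int.floor_le (θ.im / (2 * Real.pi))
  have hlt := Int.lt_floor_add_one (θ.im / (2 * Real.pi))
  rw [le_div_iff₀ hpi] at hfl
  rw [div_lt_iff₀ hpi] at hlt
  refine hF.analyticAt_of_mem_strip hN ?_ ?_
  · rw [him]; linarith
  · rw [him]; linarith

end IsMinimalFormFactor

/-! ### The functions `φ`, `τ`, `κ` -/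

theorem eventually_nhdsNE_add {P : ℂ → Prop} (h : ∀ a, ∀ᶠ z in 𝓝[≠] a, P z) (c a : ℂ) :
    ∀ᶠ z in 𝓝[≠] a, P (z + c) := by
  have ht : Tendsto (fun z : ℂ => z + c) (𝓝[≠] a) (𝓝[≠] (a + c)) := by
    refine tendsto_nhdsWithin_iff.2 ⟨?_, ?_⟩
    · exact ((continuous_id.add continuous_const).tendsto a).mono_left nhdsWithin_le_nhds
    · filter_upwards [self_mem_nhdsWithin] with z hz h
      exact hz (add_right_cancel h)
  exact ht.eventually (h (a + c))

theorem eventually_nhdsNE_neg {P : ℂ → Prop} (h : ∀ a, ∀ᶠ z in 𝓝[≠] a, P z) (a : ℂ) :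
    ∀ᶠ z in 𝓝[≠] a, P (-z) := by
  have ht : Tendsto (fun z : ℂ => -z) (𝓝[≠] a) (𝓝[≠] (-a)) := by
    refine tendsto_nhdsWithin_iff.2 ⟨?_, ?_⟩
    · exact (continuous_neg.tendsto a).mono_left nhdsWithin_le_nhds
    · filter_upwards [self_mem_nhdsWithin] with z hz h
      exact hz (neg_injective h)
  exact ht.eventually (h (-a))

theorem eventually_sh_ne_zero (a : ℂ) : ∀ᶠ z in 𝓝[≠] a, sh z ≠ 0 := by
  by_contra hne
  have hf : ∃ᶠ z in 𝓝[≠] a, sh z = (fun _ => (0 : ℂ)) z :=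
    (not_eventually.1 hne).mono fun z hz => not_not.1 hz
  have := eventuallyEq_nhdsNE_of_frequently_eq isPreconnected_univ
    (fun v _ => (analyticAt_sh v).meromorphicAt) (fun v _ => by fun_prop) trivial hf
    (z := Real.pi * I) trivial
  have h0 := eq_of_meromorphicNFAt_of_eventuallyEq (analyticAt_sh _).meromorphicNFAt
    (analyticAt_const (v := (0 : ℂ))).meromorphicNFAt this
  rw [sh, show (Real.pi * I : ℂ) / 2 = (Real.pi / 2 : ℂ) * I by ring, sinh_mul_I,
    sin_pi_div_two, one_mul] at h0
  exact I_ne_zero h0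

theorem analyticAt_sh_add (c a : ℂ) : AnalyticAt ℂ (fun z => sh (z + c)) a :=
  (differentiable_sh.comp (by fun_prop : Differentiable ℂ fun z => z + c)).analyticAt a

/-- The structure of the function `φ`: it is `1 / (sinh (z/2) sinh ((z + iη)/2))` up to an entire
even `iη`-periodic function without zeros. -/
structure PhiShape (N : ℕ) (φ ψ : ℂ → ℂ) : Prop where
  differentiable : Differentiable ℂ ψ
  ne_zero : ∀ z, ψ z ≠ 0
  periodic : ∀ z, ψ (z + ieta N) = ψ z
  even : ∀ z, ψ (-z) = ψ z
  eq : ∀ z, φ z = ψ z / (sh z * sh (z + ieta N))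

namespace IsPhiTauKappa

variable {N : ℕ} {F φ τ κ : ℂ → ℂ}

theorem eventually_phi_F (hφ : IsPhiTauKappa N F φ τ κ) (a : ℂ) : ∀ᶠ z in 𝓝[≠] a,
    (∏ k ∈ Finset.range (N - 1), φ (z + k * ieta N)) *
      (∏ k ∈ Finset.range N, F (z + k * ieta N)) = 1 :=
  eventually_codiscrete_iff.1 hφ.phi_F a

theorem phi_add_pred_mul (hN : 2 ≤ N) (hφ : IsPhiTauKappa N F φ τ κ) (z : ℂ) :
    φ (z + (N - 1 : ℕ) * ieta N) = φ (z - ieta N) := by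
  rw [← hφ.periodic_phi (z - ieta N), ← natCast_mul_ieta hN]
  congr 1
  rw [Nat.cast_sub (by omega)]; push_cast; ring

/-- Divide the functional equation at `z + iη` by the one at `z`. All but the end factors cancel and
`φ(z - iη) F(-z) = φ(z) F(z)` remains, because `z + (N - 1) iη` is `z - iη` modulo `2πi` and `F(z +
2πi) = F(-z)`. Watson's equation then eliminates `F`. -/
theorem eventually_phi_shift (hN : 2 ≤ N) (hF : IsMinimalFormFactor N F)
    (hφ : IsPhiTauKappa N F φ τ κ) (a : ℂ) : ∀ᶠ z in 𝓝[≠] a,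
      φ (z - ieta N) * sh (z - ieta N) = φ z * sh (z + ieta N) := by
  filter_upwards [hφ.eventually_phi_F a, eventually_nhdsNE_add hφ.eventually_phi_F (ieta N) a,
    hF.eventually_mul_sh_eq hN a] with z h1 h2 h3
  rw [← hφ.phi_add_pred_mul hN z]
  obtain ⟨M, rfl⟩ : ∃ M, N = M + 2 := ⟨N - 2, by omega⟩
  simp only [show M + 2 - 1 = M + 1 from rfl] at h1 h2 ⊢
  set e := ieta (M + 2) with he
  rw [Finset.prod_range_succ' _ M, Finset.prod_range_succ' _ (M + 1)] at h1
  rw [Finset.prod_range_succ _ M, Finset.prod_range_succ _ (M + 1)] at h2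
  have hc : ∀ (f : ℂ → ℂ) (n : ℕ), (∏ k ∈ Finset.range n, f (z + e + k * e)) =
      ∏ k ∈ Finset.range n, f (z + (k + 1 : ℕ) * e) := fun f n =>
    Finset.prod_congr rfl fun k _ => by congr 1; push_cast; ring
  rw [hc φ, hc F] at h2
  have e1 : z + e + M * e = z + (M + 1 : ℕ) * e := by push_cast; ring
  have e2 : F (z + e + (M + 1 : ℕ) * e) = F (-z) := by
    rw [← hF.reflect, ← natCast_mul_ieta hN]
    congr 1
    push_cast; ring
  rw [e1, e2] at h2
  simp only [Nat.cast_zero, zero_mul, add_zero] at h1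
  set X := ∏ k ∈ Finset.range M, φ (z + (k + 1 : ℕ) * e)
  set Y := ∏ k ∈ Finset.range (M + 1), F (z + (k + 1 : ℕ) * e)
  have hne : X * Y * F (-z) ≠ 0 := by
    intro h0
    have : X * φ (z + (M + 1 : ℕ) * e) * (Y * F (-z)) =
      X * Y * F (-z) * φ (z + (M + 1 : ℕ) * e) := by ring
    rw [this, h0, zero_mul] at h2
    exact zero_ne_one h2
  apply mul_left_cancel₀ hne
  linear_combination sh (z - e) * h2 - sh (z - e) * h1 + X * φ z * Y * h3

/-- The preceding relation makes `φ(z) sh z sh (z + iη)` periodic under `iη`; here it is iterated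
`k` times. -/
theorem eventually_psi_shift (hN : 2 ≤ N) (hF : IsMinimalFormFactor N F)
    (hφ : IsPhiTauKappa N F φ τ κ) (k : ℕ) (a : ℂ) : ∀ᶠ z in 𝓝[≠] a,
      φ (z + k * ieta N) * (sh (z + k * ieta N) * sh (z + (k + 1 : ℕ) * ieta N)) =
        φ z * (sh z * sh (z + ieta N)) := by
  induction k with
  | zero => exact Eventually.of_forall fun z => by simp
  | succ k ih =>
    filter_upwards [ih, eventually_nhdsNE_add (hφ.eventually_phi_shift hN hF)
      ((k + 1 : ℕ) * ieta N) a] with z h1 h2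
    rw [← h1]
    have e1 : z + (k + 1 : ℕ) * ieta N - ieta N = z + k * ieta N := by push_cast; ring
    have e2 : z + (k + 1 : ℕ) * ieta N + ieta N = z + (k + 1 + 1 : ℕ) * ieta N := by
      push_cast; ring
    rw [e1, e2] at h2
    linear_combination -sh (z + (k + 1 : ℕ) * ieta N) * h2

/-- By periodicity `ψ ^ (N - 1)` is a product of the shifts of `ψ` that occur in the functional
equation. Inserting the explicit form of `F` gives `H ψ ^ (N - 1) = D`, where `H` is a product of
exponentials up to a constant and `D` collects the remaining factors `sh (z + k iη)`, `1 ≤ k ≤ N -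
2`. These do not vanish for `0 ≤ Im z < η`, so `N - 1` times the order of `ψ` is zero. -/
theorem order_psi_of_mem_strip (hN : 2 ≤ N) (hF : IsMinimalFormFactor N F)
    (hφ : IsPhiTauKappa N F φ τ κ) {a : ℂ} (h1 : 0 ≤ a.im) (h2 : a.im < eta N) :
    meromorphicOrderAt (fun z => φ z * (sh z * sh (z + ieta N))) a = 0 := by
  have hη := eta_pos hN
  have hNη := natCast_mul_eta hN
  have him : ∀ (v : ℂ) (k : ℕ), (v + k * ieta N).im = v.im + k * eta N := by
    intro v k; simp [ieta]
  set ψ : ℂ → ℂ := fun z => φ z * (sh z * sh (z + ieta N)) with hψ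
  set c : ℂ := -I * cN N with hc
  set H : ℂ → ℂ := fun z => ∏ k ∈ Finset.range N, (c * exp (extraLog N (z + k * ieta N))) with hH
  set D : ℂ → ℂ := fun z => ∏ k ∈ Finset.range (N - 2), sh (z + (k + 1 : ℕ) * ieta N) with hD
  have hmem : ∀ᶠ z in 𝓝[≠] a, -eta N < z.im ∧ z.im < eta N := by
    refine eventually_nhdsWithin_of_eventually_nhds ?_
    exact (isOpen_Ioo.preimage continuous_im).mem_nhds (⟨by linarith, h2⟩ : a.im ∈ Set.Ioo _ _)
  have hkN : ∀ k ∈ Finset.range N, ((k : ℝ) + 1) * eta N ≤ 2 * Real.pi := by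
    intro k hk
    rw [← hNη]
    have : ((k : ℝ) + 1) ≤ N := by exact_mod_cast Finset.mem_range.1 hk
    gcongr
  have hstrip : ∀ (v : ℂ), -eta N < v.im → v.im < eta N → ∀ k ∈ Finset.range N,
      -eta N < (v + k * ieta N).im ∧ (v + k * ieta N).im < 2 * Real.pi + eta N := by
    intro v hv1 hv2 k hk
    have hk0 : (0 : ℝ) ≤ k * eta N := by positivity
    have := hkN k hk
    rw [him]
    constructor <;> linarith
  have hev : (fun z => H z * ψ z ^ (N - 1)) =ᶠ[𝓝[≠] a] D := by
    have hall : ∀ᶠ z in 𝓝[≠] a, ∀ k ∈ Finset.range (N - 1),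
        φ (z + k * ieta N) * (sh (z + k * ieta N) * sh (z + (k + 1 : ℕ) * ieta N)) =
        φ z * (sh z * sh (z + ieta N)) :=
      (Filter.eventually_all_finset _).2 fun k _ => hφ.eventually_psi_shift hN hF k a
    filter_upwards [hφ.eventually_phi_F a, hall, hmem, eventually_sh_ne_zero a] with z h3 h4 h5 h6
    have hFz : (∏ k ∈ Finset.range N, F (z + k * ieta N)) =
        H z * ∏ k ∈ Finset.range N, sh (z + k * ieta N) := by
      rw [hH, ← Finset.prod_mul_distrib]
      refine Finset.prod_congr rfl fun k hk => ?_
      have := hstrip z h5.1 h5.2 k hk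
      rw [hF.eq_of_mem_strip hN this.1 this.2]; ring
    have hpow : ψ z ^ (N - 1) = (∏ k ∈ Finset.range (N - 1), φ (z + k * ieta N)) *
        ((∏ k ∈ Finset.range (N - 1), sh (z + k * ieta N)) *
          ∏ k ∈ Finset.range (N - 1), sh (z + (k + 1 : ℕ) * ieta N)) := by
      rw [← Finset.prod_mul_distrib, ← Finset.prod_mul_distrib, Finset.prod_congr rfl h4]
      simp [hψ]
    rw [hFz] at h3
    rw [hpow]
    simp only [hD]
    obtain ⟨M, rfl⟩ : ∃ M, N = M + 2 := ⟨N - 2, by omega⟩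
    simp only [show M + 2 - 1 = M + 1 from rfl, show M + 2 - 2 = M from rfl] at h3 ⊢
    have hA : ∏ k ∈ Finset.range (M + 1), sh (z + k * ieta (M + 2)) =
        (∏ k ∈ Finset.range M, sh (z + (k + 1 : ℕ) * ieta (M + 2))) * sh z := by
      rw [Finset.prod_range_succ']; simp
    rw [Finset.prod_range_succ' _ (M + 1)] at h3
    simp only [Nat.cast_zero, zero_mul, add_zero] at h3
    rw [hA]
    linear_combination
      (∏ k ∈ Finset.range M, sh (z + (k + 1 : ℕ) * ieta (M + 2))) * h3
  have hHa : AnalyticAt ℂ H a := by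
    refine Finset.analyticAt_fun_prod _ fun k hk => ?_
    have := hstrip a (by linarith) h2 k hk
    exact analyticAt_const.mul (AnalyticAt.cexp (AnalyticAt.comp_of_eq
      (f := fun z => z + k * ieta N) (analyticAt_extraLog hN this.1 this.2) (by fun_prop) rfl))
  have hH0 : H a ≠ 0 := Finset.prod_ne_zero_iff.2 fun k _ =>
    mul_ne_zero (mul_ne_zero (neg_ne_zero.2 I_ne_zero) (cN_ne_zero N)) (exp_ne_zero _)
  have hDa : AnalyticAt ℂ D a := Finset.analyticAt_fun_prod _ fun k _ => analyticAt_sh_add _ a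
  have hD0 : D a ≠ 0 := by
    refine Finset.prod_ne_zero_iff.2 fun k hk h0 => ?_
    obtain ⟨l, hl⟩ := sh_eq_zero_iff.1 h0
    have hl' := congrArg im hl
    rw [him] at hl'
    have : ((l : ℂ) * (2 * Real.pi * I)).im = l * (2 * Real.pi) := by simp
    rw [this, ← hNη] at hl'
    have hk' : (k : ℝ) + 1 + 1 ≤ N - 0 := by
      have := Finset.mem_range.1 hk
      have : k + 1 + 1 ≤ N := by omega
      rw [sub_zero]; exact_mod_cast this
    have hk0 : (0 : ℝ) ≤ k := Nat.cast_nonneg k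
    push_cast at hl'
    have hpos : 0 < (l : ℝ) * (N * eta N) := by rw [← hl']; nlinarith
    have hlt : (l : ℝ) * (N * eta N) < 1 * (N * eta N) := by rw [← hl']; nlinarith
    have hNη0 : 0 < (N : ℝ) * eta N := by rw [hNη]; linarith [Real.pi_pos]
    have l1 : (0 : ℝ) < l := pos_of_mul_pos_left hpos hNη0.le
    have l2 : (l : ℝ) < 1 := lt_of_mul_lt_mul_right hlt hNη0.le
    have l1' : 0 < l := by exact_mod_cast l1
    have l2' : l < 1 := by exact_mod_cast l2
    omega
  have hψm : MeromorphicAt ψ a := (hφ.meromorphic_phi trivial).meromorphicAt.mul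
    ((analyticAt_sh a).mul (analyticAt_sh_add _ a)).meromorphicAt
  have ho : meromorphicOrderAt (ψ ^ (N - 1)) a = 0 := by
    rw [← meromorphicOrderAt_mul_of_ne_zero hHa hH0,
      show H * ψ ^ (N - 1) = fun z => H z * ψ z ^ (N - 1) from rfl, meromorphicOrderAt_congr hev]
    exact (hDa.meromorphicNFAt.meromorphicOrderAt_eq_zero_iff).2 hD0
  rw [meromorphicOrderAt_pow hψm] at ho
  rcases mul_eq_zero.1 ho with h | h
  · exfalso
    have : N - 1 = 0 := by exact_mod_cast h
    omega
  · exact h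

theorem order_psi (hN : 2 ≤ N) (hF : IsMinimalFormFactor N F)
    (hφ : IsPhiTauKappa N F φ τ κ) (a : ℂ) :
    meromorphicOrderAt (fun z => φ z * (sh z * sh (z + ieta N))) a = 0 := by
  have hη := eta_pos hN
  set ψ : ℂ → ℂ := fun z => φ z * (sh z * sh (z + ieta N)) with hψ
  have step : ∀ a, meromorphicOrderAt ψ (a + ieta N) = meromorphicOrderAt ψ a := by
    intro a
    rw [← meromorphicOrderAt_comp_add_const_eq_meromorphicOrderAt]
    refine meromorphicOrderAt_congr ?_
    filter_upwards [hφ.eventually_psi_shift hN hF 1 a] with z hz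
    simp only [hψ, Function.comp_apply]
    rw [← hz]
    simp only [Nat.cast_one, one_mul]
    congr 3; push_cast; ring
  have key : ∀ l : ℤ, meromorphicOrderAt ψ (a + l * ieta N) = meromorphicOrderAt ψ a := by
    intro l
    induction l using Int.induction_on with
    | zero => simp
    | succ i ih => rw [← ih, ← step (a + (i : ℤ) * ieta N)]; congr 1; push_cast; ring
    | pred i ih => rw [← ih, ← step]; congr 1; push_cast; ring
  rw [← key (-⌊a.im / eta N⌋)]
  have him : (a + (-⌊a.im / eta N⌋ : ℤ) * ieta N).im = a.im - ⌊a.im / eta N⌋ * eta N := by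
    simp [ieta]; ring
  have hfl := Int.floor_le (a.im / eta N)
  have hlt := Int.lt_floor_add_one (a.im / eta N)
  rw [le_div_iff₀ hη] at hfl
  rw [div_lt_iff₀ hη] at hlt
  refine hφ.order_psi_of_mem_strip hN hF ?_ ?_
  · rw [him]; linarith
  · rw [him]; linarith

theorem sh_neg_add (hN : 2 ≤ N) (z : ℂ) {k : ℕ} (hk : k ≤ N) :
    sh (-z + k * ieta N) = sh (z + (N - k : ℕ) * ieta N) := by
  rw [show -z + k * ieta N = -(z + (N - k : ℕ) * ieta N - 2 * Real.pi * I) by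
    rw [← natCast_mul_ieta hN, Nat.cast_sub hk]; ring, sh_neg, sh_sub_two_pi, neg_neg]

/-- The points `-z + k iη` and `z + iη + (N - 1 - k) iη` add up to `2πi`, so the two products of `F`
agree by reflection. Cancelling them in the functional equations leaves the products of `φ`. -/
theorem eventually_prod_phi_neg (hN : 2 ≤ N) (hF : IsMinimalFormFactor N F)
    (hφ : IsPhiTauKappa N F φ τ κ) (a : ℂ) : ∀ᶠ z in 𝓝[≠] a,
      (∏ k ∈ Finset.range (N - 1), φ (-z + k * ieta N)) =
        ∏ k ∈ Finset.range (N - 1), φ (z + ieta N + k * ieta N) := by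
  filter_upwards [eventually_nhdsNE_neg hφ.eventually_phi_F a,
    eventually_nhdsNE_add hφ.eventually_phi_F (ieta N) a] with z h1 h2
  have hFe : (∏ k ∈ Finset.range N, F (-z + k * ieta N)) =
      ∏ k ∈ Finset.range N, F (z + ieta N + k * ieta N) := by
    rw [← Finset.prod_range_reflect (fun k : ℕ => F (z + ieta N + k * ieta N))]
    refine Finset.prod_congr rfl fun k hk => ?_
    have := Finset.mem_range.1 hk
    rw [← hF.reflect, ← natCast_mul_ieta hN]
    congr 1
    rw [Nat.cast_sub (by omega), Nat.cast_sub (by omega)]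
    push_cast; ring
  rw [hFe] at h1
  have hne : (∏ k ∈ Finset.range N, F (z + ieta N + k * ieta N)) ≠ 0 := by
    intro h0; rw [h0, mul_zero] at h1; exact zero_ne_one h1
  exact mul_right_cancel₀ hne (h1.trans h2.symm)

/-- Order zero everywhere makes the normal form of `φ(z) sh z sh (z + iη)` entire and zero-free. For
the evenness, the functional equation yields only equality of the `(N - 1)`-th powers of `ψ(-z)` and
`ψ(z)`, and rigidity of holomorphic functions does the rest. -/
theorem exists_phiShape (hN : 2 ≤ N) (hF : IsMinimalFormFactor N F)
    (hφ : IsPhiTauKappa N F φ τ κ) : ∃ ψ, PhiShape N φ ψ := by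
  set ψ₀ : ℂ → ℂ := fun z => φ z * (sh z * sh (z + ieta N)) with hψ₀
  have hm : MeromorphicOn ψ₀ Set.univ := fun z _ =>
    (hφ.meromorphic_phi trivial).meromorphicAt.mul
      ((analyticAt_sh z).mul (analyticAt_sh_add _ z)).meromorphicAt
  set ψ := toMeromorphicNFOn ψ₀ Set.univ with hψ
  have hnf : ∀ z, MeromorphicNFAt ψ z := fun z =>
    meromorphicNFOn_toMeromorphicNFOn ψ₀ Set.univ trivial
  have hord : ∀ z, meromorphicOrderAt ψ z = 0 := fun z => by
    rw [hψ, meromorphicOrderAt_toMeromorphicNFOn hm trivial, hφ.order_psi hN hF z]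
  have hana : ∀ z, AnalyticAt ℂ ψ z := fun z =>
    (hnf z).meromorphicOrderAt_nonneg_iff_analyticAt.1 (hord z).ge
  have hne : ∀ z, ψ z ≠ 0 := fun z => (hnf z).meromorphicOrderAt_eq_zero_iff.1 (hord z)
  have hev : ∀ z, ψ =ᶠ[𝓝[≠] z] ψ₀ := fun z => hm.toMeromorphicNFOn_eq_self_on_nhdsNE trivial
  have hper : ∀ z, ψ (z + ieta N) = ψ z := by
    intro z
    refine eq_of_meromorphicNFAt_of_eventuallyEq (f := fun z => ψ (z + ieta N))
      (AnalyticAt.comp_of_eq (hana (z + ieta N)) (f := fun z => z + ieta N)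
        (by fun_prop) rfl).meromorphicNFAt (hnf z) ?_
    filter_upwards [hev z, eventually_nhdsNE_add hev (ieta N) z |>.mono fun z h => h,
      hφ.eventually_psi_shift hN hF 1 z] with v h1 h2 h3
    rw [h1, h2, hψ₀]
    simp only
    rw [← h3]
    simp only [Nat.cast_one, one_mul]
    congr 3; push_cast; ring
  have heq : ∀ z, φ z = ψ z / (sh z * sh (z + ieta N)) := by
    intro z
    refine eq_of_meromorphicNFAt_of_eventuallyEq (g := fun z => ψ z / (sh z * sh (z + ieta N)))
      (hφ.meromorphic_phi trivial) ?_ ?_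
    · exact MeromorphicNFOn.div (hana z)
        ((analyticAt_sh z).mul (analyticAt_sh_add _ z)).meromorphicNFAt (Or.inr (hne z))
    · filter_upwards [hev z, eventually_sh_ne_zero z,
        eventually_nhdsNE_add eventually_sh_ne_zero (ieta N) z] with v h1 h2 h3
      rw [h1, hψ₀, mul_div_cancel_right₀ _ (mul_ne_zero h2 h3)]
  have hpern : ∀ (k : ℕ) z, ψ (z + k * ieta N) = ψ z := by
    intro k z
    induction k with
    | zero => simp
    | succ k ih => rw [← ih, ← hper (z + k * ieta N)]; congr 1; push_cast; ring
  have hdiff : Differentiable ℂ ψ := fun z => (hana z).differentiableAt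
  have hneg : Differentiable ℂ fun z => ψ (-z) := hdiff.comp differentiable_neg
  have hpow : ∀ z, ψ (-z) ^ (N - 1) = ψ z ^ (N - 1) := by
    intro z
    refine eq_of_meromorphicNFAt_of_eventuallyEq (f := fun z => ψ (-z) ^ (N - 1))
      (g := fun z => ψ z ^ (N - 1)) ((hneg.pow _).analyticAt z).meromorphicNFAt
      ((hdiff.pow _).analyticAt z).meromorphicNFAt ?_
    have hsh : ∀ᶠ v in 𝓝[≠] z, ∀ k ∈ Finset.range (N + 1), sh (v + k * ieta N) ≠ 0 :=
      (Filter.eventually_all_finset _).2 fun k _ =>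
        eventually_nhdsNE_add eventually_sh_ne_zero (k * ieta N) z
    filter_upwards [hφ.eventually_prod_phi_neg hN hF z, hsh] with v h1 h2
    simp only [heq, Finset.prod_div_distrib, hpern] at h1
    have e1 : (∏ k ∈ Finset.range (N - 1), (sh (-v + k * ieta N) *
        sh (-v + k * ieta N + ieta N))) = ∏ k ∈ Finset.range (N - 1),
        (sh (v + ieta N + k * ieta N) * sh (v + ieta N + k * ieta N + ieta N)) := by
      rw [← Finset.prod_range_reflect (fun k : ℕ =>
        (sh (v + ieta N + k * ieta N) * sh (v + ieta N + k * ieta N + ieta N)))]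
      refine Finset.prod_congr rfl fun k hk => ?_
      have hk' := Finset.mem_range.1 hk
      rw [show -v + k * ieta N + ieta N = -v + (k + 1 : ℕ) * ieta N by push_cast; ring,
        sh_neg_add hN v (by omega), sh_neg_add hN v (by omega), mul_comm]
      have c1 : ((N - 1 - 1 - k : ℕ) : ℂ) = N - 2 - k := by
        rw [show N - 1 - 1 - k = N - (k + 2) by omega, Nat.cast_sub (by omega)]
        push_cast; ring
      rw [c1, Nat.cast_sub (by omega), Nat.cast_sub (by omega)]
      congr 2 <;> (push_cast; ring)
    rw [e1] at h1
    have hne' : (∏ k ∈ Finset.range (N - 1),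
        (sh (v + ieta N + k * ieta N) * sh (v + ieta N + k * ieta N + ieta N))) ≠ 0 := by
      refine Finset.prod_ne_zero_iff.2 fun k hk => ?_
      have hk' := Finset.mem_range.1 hk
      refine mul_ne_zero ?_ ?_
      · have := h2 (k + 1) (Finset.mem_range.2 (by omega))
        convert this using 2; push_cast; ring
      · have := h2 (k + 2) (Finset.mem_range.2 (by omega))
        convert this using 2; push_cast; ring
    rw [div_left_inj' hne'] at h1
    simpa [hper] using h1
  -- The quotient `ψ(-z) / ψ(z)` is entire with values in the roots of unity, hence constant, and it
  -- is `1` at `0`.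
  have heven : ∀ z, ψ (-z) = ψ z := by
    set f : ℂ → ℂ := fun z => ψ (-z) / ψ z with hf
    have hfd : Differentiable ℂ f := hneg.div hdiff hne
    have hf1 : ∀ z, f z ^ (N - 1) = 1 := fun z => by
      rw [hf]; simp only
      rw [div_pow, hpow, div_self (pow_ne_zero _ (hne z))]
    have hf0 : ∀ z, f z ≠ 0 := fun z => div_ne_zero (hne _) (hne z)
    have hder : ∀ z, deriv f z = 0 := by
      intro z
      have h1 := (hfd z).hasDerivAt.pow (N - 1)
      have h2 : f ^ (N - 1) = fun _ => 1 := funext hf1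
      rw [h2] at h1
      have h3 := h1.unique (hasDerivAt_const z 1)
      have hN1 : ((N - 1 : ℕ) : ℂ) ≠ 0 := by norm_cast; omega
      rcases mul_eq_zero.1 h3 with h | h
      · exact absurd h (mul_ne_zero hN1 (pow_ne_zero _ (hf0 z)))
      · exact h
    intro z
    have := is_const_of_deriv_eq_zero hfd hder z 0
    simp only [hf, neg_zero, div_self (hne 0)] at this
    exact (div_eq_one_iff_eq (hne z)).1 this
  exact ⟨ψ, hdiff, hne, hper, heven, heq⟩

end IsPhiTauKappa

/-! ### Residues and symmetries of `φ`. -/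

theorem hasDerivAt_sh (z : ℂ) : HasDerivAt sh (cosh (z / 2) / 2) z := by
  have h : HasDerivAt (fun z : ℂ => z / 2) (1 / 2) z := (hasDerivAt_id z).div_const 2
  exact h.csinh.congr_deriv (by ring)

theorem sh_ieta_ne_zero {N : ℕ} (hN : 2 ≤ N) : sh (ieta N) ≠ 0 := by
  have := sh_int_mul_ieta_ne_zero hN (l := 1) (by
    intro h
    have := Int.le_of_dvd one_pos h
    omega)
  simpa using this

namespace PhiShape

variable {N : ℕ} {φ ψ : ℂ → ℂ}

theorem analyticAt (h : PhiShape N φ ψ) {z : ℂ} (h1 : sh z ≠ 0) (h2 : sh (z + ieta N) ≠ 0) :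
    AnalyticAt ℂ φ z := by
  rw [show φ = fun z => ψ z / (sh z * sh (z + ieta N)) from funext h.eq]
  exact (h.differentiable.analyticAt z).div ((analyticAt_sh z).mul (analyticAt_sh_add _ z))
    (mul_ne_zero h1 h2)

theorem apply_ne_zero (h : PhiShape N φ ψ) {z : ℂ} (h1 : sh z ≠ 0) (h2 : sh (z + ieta N) ≠ 0) :
    φ z ≠ 0 := by
  rw [h.eq]; exact div_ne_zero (h.ne_zero z) (mul_ne_zero h1 h2)

/-- A symmetry of `φ` about `-iη/2`, from evenness and periodicity of `ψ`. It exchanges the poles at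
`0` and `-iη`, which therefore have opposite residues. -/
theorem apply_neg (h : PhiShape N φ ψ) (z : ℂ) : φ (-z) = φ (z - ieta N) := by
  have hp : ψ (z - ieta N) = ψ z := by rw [← h.periodic, sub_add_cancel]
  rw [h.eq, h.eq, h.even, hp, sub_add_cancel, sh_neg,
    show -z + ieta N = -(z - ieta N) by ring, sh_neg]
  ring

/-- This shift is the source of the S-matrices in the annihilation residue. -/
theorem apply_sub (h : PhiShape N φ ψ) {z : ℂ} (h2 : sh (z + ieta N) ≠ 0) :
    φ (z - ieta N) = φ z * S N z := by
  have hp : ψ (z - ieta N) = ψ z := by rw [← h.periodic, sub_add_cancel]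
  rw [h.eq, h.eq, hp, sub_add_cancel, S_eq, div_mul_div_comm]
  rw [mul_assoc, mul_comm (sh (z + ieta N)) (sh (z - ieta N)), ← mul_assoc,
    mul_div_mul_right _ _ h2, mul_comm (sh z)]

/-- The residue of `φ` at `0`. -/
theorem hasSimplePole_zero (hN : 2 ≤ N) (h : PhiShape N φ ψ) :
    HasSimplePole φ 0 (ψ 0 / (sh (ieta N) / 2)) := by
  have hd : HasDerivAt (fun z => sh z * sh (z + ieta N)) (sh (ieta N) / 2) 0 := by
    have h1 := (hasDerivAt_sh 0).mul (HasDerivAt.comp_add_const 0 (ieta N)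
      (hasDerivAt_sh (0 + ieta N)))
    refine h1.congr_deriv ?_
    simp [sh_zero]; ring
  have := hasSimplePole_div (h.differentiable.analyticAt 0)
    ((analyticAt_sh 0).mul (analyticAt_sh_add (ieta N) 0)) (by simp [sh_zero]) hd
    (div_ne_zero (sh_ieta_ne_zero hN) two_ne_zero)
  exact this.congr (Eventually.of_forall h.eq)

/-- The residue of `φ` at `-iη`. -/
theorem hasSimplePole_neg_ieta (hN : 2 ≤ N) (h : PhiShape N φ ψ) :
    HasSimplePole φ (-ieta N) (-(ψ 0 / (sh (ieta N) / 2))) := by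
  have h1 := (h.hasSimplePole_zero hN).comp_const_sub (-ieta N)
  rw [sub_zero] at h1
  refine h1.congr (Eventually.of_forall fun z => ?_)
  simp only
  rw [show -ieta N - z = -z - ieta N by ring, ← h.apply_neg, neg_neg]

theorem hasSimplePole_comp_neg (hN : 2 ≤ N) (h : PhiShape N φ ψ) :
    HasSimplePole (fun z => φ (-z)) (ieta N) (ψ 0 / (sh (ieta N) / 2)) := by
  have h1 := (h.hasSimplePole_neg_ieta hN).comp_const_sub 0
  simpa using h1

theorem residue_ne_zero (hN : 2 ≤ N) (h : PhiShape N φ ψ) : ψ 0 / (sh (ieta N) / 2) ≠ 0 :=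
  div_ne_zero (h.ne_zero 0) (div_ne_zero (sh_ieta_ne_zero hN) two_ne_zero)

theorem R_eq (hN : 2 ≤ N) (h : PhiShape N φ ψ) :
    R φ = -(2 * Real.pi * I * (ψ 0 / (sh (ieta N) / 2))) := by
  refine (tendsto_const_nhds.congr' ?_).limUnder_eq
  filter_upwards [(h.hasSimplePole_zero hN).eventually_circleIntegral] with r hr
  rw [hr]

theorem R_ne_zero (hN : 2 ≤ N) (h : PhiShape N φ ψ) : R φ ≠ 0 := by
  rw [h.R_eq hN]
  exact neg_ne_zero.2 (mul_ne_zero two_pi_I_ne_zero (h.residue_ne_zero hN))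

end PhiShape

/-! ### `τ` and `κ` as entire functions, and their cancellations with `φ`. -/

namespace IsPhiTauKappa

variable {N : ℕ} {F φ τ κ ψ : ℂ → ℂ}

theorem tau_eq (hφ : IsPhiTauKappa N F φ τ κ) (h : PhiShape N φ ψ) (z : ℂ) :
    τ z = sh z ^ 2 * sh (z + ieta N) * sh (z - ieta N) / ψ z ^ 2 := by
  refine eq_of_meromorphicNFAt_of_eventuallyEq
    (g := fun z => sh z ^ 2 * sh (z + ieta N) * sh (z - ieta N) / ψ z ^ 2)
    (hφ.meromorphic_tau trivial) (AnalyticAt.meromorphicNFAt ?_) ?_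
  · refine AnalyticAt.div ?_ ((h.differentiable.analyticAt z).pow 2) (pow_ne_zero _ (h.ne_zero z))
    refine (((analyticAt_sh z).pow 2).mul (analyticAt_sh_add _ z)).mul ?_
    simpa only [sub_eq_add_neg] using analyticAt_sh_add (-ieta N) z
  · have hm := eventually_nhdsNE_add eventually_sh_ne_zero (-ieta N) z
    simp only [← sub_eq_add_neg] at hm
    filter_upwards [eventually_codiscrete_iff.1 hφ.tau_phi z, eventually_sh_ne_zero z,
      eventually_nhdsNE_add eventually_sh_ne_zero (ieta N) z, hm] with v h1 h2 h3 h4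
    rw [h.eq v, h.eq (-v), h.even, sh_neg, show -v + ieta N = -(v - ieta N) by ring, sh_neg] at h1
    have := h.ne_zero v
    field_simp at h1 ⊢
    linear_combination h1

theorem kappa_eq (hφ : IsPhiTauKappa N F φ τ κ) (h : PhiShape N φ ψ) (z : ℂ) :
    κ z = sh z * sh (z + ieta N) / ψ z := by
  refine eq_of_meromorphicNFAt_of_eventuallyEq
    (g := fun z => sh z * sh (z + ieta N) / ψ z)
    (hφ.meromorphic_kappa trivial) (AnalyticAt.meromorphicNFAt ?_) ?_
  · exact ((analyticAt_sh z).mul (analyticAt_sh_add _ z)).div (h.differentiable.analyticAt z)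
      (h.ne_zero z)
  · filter_upwards [eventually_codiscrete_iff.1 hφ.kappa_phi z, eventually_sh_ne_zero z,
      eventually_nhdsNE_add eventually_sh_ne_zero (ieta N) z] with v h1 h2 h3
    rw [h.eq v] at h1
    have := h.ne_zero v
    field_simp at h1 ⊢
    linear_combination h1

theorem differentiable_tau (hφ : IsPhiTauKappa N F φ τ κ) (h : PhiShape N φ ψ) :
    Differentiable ℂ τ := by
  rw [show τ = _ from funext (hφ.tau_eq h)]
  have h1 : Differentiable ℂ fun z => sh (z + ieta N) := differentiable_sh.comp (by fun_prop)
  have h2 : Differentiable ℂ fun z => sh (z - ieta N) := differentiable_sh.comp (by fun_prop)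
  exact (((differentiable_sh.pow 2).mul h1).mul h2).div (h.differentiable.pow 2)
    fun z => pow_ne_zero _ (h.ne_zero z)

theorem differentiable_kappa (hφ : IsPhiTauKappa N F φ τ κ) (h : PhiShape N φ ψ) :
    Differentiable ℂ κ := by
  rw [show κ = _ from funext (hφ.kappa_eq h)]
  have h1 : Differentiable ℂ fun z => sh (z + ieta N) := differentiable_sh.comp (by fun_prop)
  exact (differentiable_sh.mul h1).div h.differentiable h.ne_zero

theorem tau_zero (hφ : IsPhiTauKappa N F φ τ κ) (h : PhiShape N φ ψ) : τ 0 = 0 := by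
  rw [hφ.tau_eq h, sh_zero]; simp

theorem kappa_zero (hφ : IsPhiTauKappa N F φ τ κ) (h : PhiShape N φ ψ) : κ 0 = 0 := by
  rw [hφ.kappa_eq h, sh_zero]; simp

theorem phi_mul_phi_neg_mul_tau (hφ : IsPhiTauKappa N F φ τ κ) (h : PhiShape N φ ψ) {z : ℂ}
    (h1 : sh z ≠ 0) (h2 : sh (z + ieta N) ≠ 0) (h3 : sh (z - ieta N) ≠ 0) :
    φ (-z) * φ z * τ z = 1 := by
  have := h.ne_zero z
  rw [hφ.tau_eq h, h.eq z, h.eq (-z), h.even, sh_neg, show -z + ieta N = -(z - ieta N) by ring,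
    sh_neg]
  field_simp

theorem phi_mul_kappa (hφ : IsPhiTauKappa N F φ τ κ) (h : PhiShape N φ ψ) {z : ℂ}
    (h1 : sh z ≠ 0) (h2 : sh (z + ieta N) ≠ 0) : φ z * κ z = 1 := by
  have := h.ne_zero z
  rw [hφ.kappa_eq h, h.eq z]
  field_simp

/-- The defining functional equation of `φ` holds at every point outside `iηℤ`. -/
theorem prod_phi_mul_prod_F (hN : 2 ≤ N) (hF : IsMinimalFormFactor N F)
    (hφ : IsPhiTauKappa N F φ τ κ) (h : PhiShape N φ ψ) {z : ℂ}
    (hz : ∀ l : ℤ, z ≠ l * ieta N) :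
    (∏ k ∈ Finset.range (N - 1), φ (z + k * ieta N)) *
      (∏ k ∈ Finset.range N, F (z + k * ieta N)) = 1 := by
  have hz' : ∀ (k : ℕ) (l : ℤ), z + k * ieta N ≠ l * ieta N := by
    intro k l he
    refine hz (l - k) ?_
    push_cast
    linear_combination he
  refine eq_of_meromorphicNFAt_of_eventuallyEq (a := z)
    (f := fun z => (∏ k ∈ Finset.range (N - 1), φ (z + k * ieta N)) *
      (∏ k ∈ Finset.range N, F (z + k * ieta N))) (g := fun _ => 1)
    (AnalyticAt.meromorphicNFAt ?_) analyticAt_const.meromorphicNFAt (hφ.eventually_phi_F z)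
  refine AnalyticAt.mul (Finset.analyticAt_fun_prod _ fun k _ => ?_)
    (Finset.analyticAt_fun_prod _ fun k _ => ?_)
  · refine AnalyticAt.comp_of_eq (f := fun z => z + k * ieta N) (h.analyticAt ?_ ?_)
      (by fun_prop) rfl
    · simpa using sh_ne_zero_of_forall_ne hN (hz' k) 0
    · simpa using sh_ne_zero_of_forall_ne hN (hz' k) 1
  · exact AnalyticAt.comp_of_eq (f := fun z => z + k * ieta N)
      (hF.analyticAt_of_forall_ne hN (hz' k)) (by fun_prop) rfl

end IsPhiTauKappa

/-! ### Evaluation of the multiple contour integral -/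

/-- Induction on the number of variables. The hypothesis says that a contour integral against `u` is
a combination of point evaluations, at one radius for all entire test functions. This uniformity is
needed because the values of the other variables enter the test function. -/
theorem multiContourIntegral_prod_mul {n : ℕ} {θ : Fin n → ℂ} {ρ : ℝ} {u : ℂ → ℂ} {c : Fin n → ℂ}
    (hu : ∀ h : ℂ → ℂ, Differentiable ℂ h →
      contourIntegral θ ρ (fun z => u z * h z) = ∑ i, c i * h (θ i)) (M : ℕ) :
    ∀ H : (Fin M → ℂ) → ℂ, Differentiable ℂ H →
      multiContourIntegral θ ρ M (fun w => (∏ a, u (w a)) * H w) =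
        ∑ e : Fin M → Fin n, (∏ a, c (e a)) * H (θ ∘ e) := by
  induction M with
  | zero =>
    intro H _
    rw [Fintype.sum_unique]
    simp only [multiContourIntegral, Finset.univ_eq_empty, Finset.prod_empty, one_mul]
    congr 1
    exact Subsingleton.elim _ _
  | succ M ih =>
    intro H hH
    have hcons : ∀ z : ℂ, Differentiable ℂ fun w : Fin M → ℂ => H (Fin.cons z w) := fun z =>
      hH.comp (differentiable_pi.2 fun i => by
        refine Fin.cases ?_ (fun i => ?_) i
        · simp only [Fin.cons_zero]; fun_prop
        · simp only [Fin.cons_succ]; fun_prop)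
    have hcons' : ∀ w : Fin M → ℂ, Differentiable ℂ fun z : ℂ => H (Fin.cons z w) := fun w =>
      hH.comp (differentiable_pi.2 fun i => by
        refine Fin.cases ?_ (fun i => ?_) i
        · simp only [Fin.cons_zero]; fun_prop
        · simp only [Fin.cons_succ]; fun_prop)
    have hin : ∀ z : ℂ, multiContourIntegral θ ρ M
        (fun w => (∏ a, u ((Fin.cons z w : Fin (M + 1) → ℂ) a)) * H (Fin.cons z w)) =
        u z * ∑ e : Fin M → Fin n, (∏ a, c (e a)) * H (Fin.cons z (θ ∘ e)) := by
      intro z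
      have := ih (fun w => u z * H (Fin.cons z w)) ((hcons z).const_mul (u z))
      rw [Finset.mul_sum]
      convert this using 2
      · ext w
        rw [Fin.prod_univ_succ]
        simp only [Fin.cons_zero, Fin.cons_succ]
        ring
      · ring
    simp only [multiContourIntegral]
    simp only [hin]
    rw [hu _ (Differentiable.fun_sum fun e _ => (hcons' (θ ∘ e)).const_mul _)]
    simp only [Finset.mul_sum]
    rw [← Fintype.sum_prod_type']
    refine Fintype.sum_equiv (Fin.consEquiv fun _ : Fin (M + 1) => Fin n) _ _ fun x => ?_
    simp only [Fin.consEquiv_apply, Fin.prod_univ_succ, Fin.cons_zero, Fin.cons_succ]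
    rw [mul_assoc]
    congr 3
    funext i
    refine Fin.cases ?_ (fun i => ?_) i <;> simp

theorem Regular.sh_ne_zero {N n : ℕ} {θ : Fin n → ℂ} (hθ : Regular N θ) {i j : Fin n}
    (hij : i ≠ j) : sh (θ i - θ j) ≠ 0 ∧ sh (θ i - θ j + ieta N) ≠ 0 ∧
      sh (θ i - θ j - ieta N) ≠ 0 := by
  refine ⟨fun h => ?_, fun h => ?_, fun h => ?_⟩
  · obtain ⟨l, hl⟩ := sh_eq_zero_iff.1 h
    exact (hθ i j hij l).1 hl
  · obtain ⟨l, hl⟩ := sh_eq_zero_iff.1 h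
    refine (hθ j i hij.symm (-l)).2 ?_
    rw [← ieta]; push_cast
    linear_combination -hl
  · obtain ⟨l, hl⟩ := sh_eq_zero_iff.1 h
    refine (hθ i j hij l).2 ?_
    rw [← ieta]
    linear_combination hl

/-- A small circle around `θ_i` sees only the simple pole of `φ(z - θ_i)`, as the other factors are
holomorphic there by regularity. The constant `R` contains `2πi` and the clockwise orientation. -/
theorem eventually_contourIntegral_prod_phi {N n : ℕ} (hN : 2 ≤ N) {φ ψ : ℂ → ℂ}
    (h : PhiShape N φ ψ) {θ : Fin n → ℂ} (hθ : Regular N θ) :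
    ∀ᶠ ρ in 𝓝[>] (0 : ℝ), ∀ f : ℂ → ℂ, Differentiable ℂ f →
      contourIntegral θ ρ (fun z => (∏ i, φ (z - θ i)) * f z) =
        ∑ i, (R φ * ∏ j ∈ Finset.univ.erase i, φ (θ i - θ j)) * f (θ i) := by
  have hp : ∀ i, HasSimplePole (fun z => ∏ i, φ (z - θ i)) (θ i)
      ((∏ j ∈ Finset.univ.erase i, φ (θ i - θ j)) * (ψ 0 / (sh (ieta N) / 2))) := by
    intro i
    have h1 := (h.hasSimplePole_zero hN).comp_sub_const (θ i)
    rw [zero_add] at h1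
    have h2 : AnalyticAt ℂ (fun z => ∏ j ∈ Finset.univ.erase i, φ (z - θ j)) (θ i) := by
      refine Finset.analyticAt_fun_prod _ fun j hj => ?_
      have hne := hθ.sh_ne_zero (Finset.ne_of_mem_erase hj).symm
      exact AnalyticAt.comp_of_eq (f := fun z => z - θ j) (h.analyticAt hne.1 hne.2.1)
        (by fun_prop) rfl
    refine (h1.mul_analyticAt h2).congr (Eventually.of_forall fun z => ?_)
    simp only
    rw [Finset.prod_erase_mul _ _ (Finset.mem_univ i)]
  filter_upwards [Filter.eventually_all.2 fun i => (hp i).exists_circleIntegral_mul] with ρ hρ f hf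
  rw [contourIntegral]
  refine Finset.sum_congr rfl fun i _ => ?_
  rw [hρ i f hf, h.R_eq hN]
  ring

/-! ### Colourings -/

/-- The product of `φ(θ_i - θ_j)` over all pairs where the colour of `i` exceeds that of `j`. -/
def pairWeight {N n : ℕ} (φ : ℂ → ℂ) (θ : Fin n → ℂ) (g : Fin n → Fin N) : ℂ :=
  ∏ i, ∏ j, if g j < g i then φ (θ i - θ j) else 1

/-- The ways to number the points of each colour `k + 1`. -/
abbrev Filling {N n : ℕ} (m : Fin (N - 1) → ℕ) (g : Fin n → Fin N) : Type :=
  (k : Fin (N - 1)) → (Fin (m k) ≃ {i : Fin n // (g i : ℕ) = k + 1})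

/-- The integration variables placed at the points of their colour. -/
def fillVars {N n : ℕ} {m : Fin (N - 1) → ℕ} {g : Fin n → Fin N} (θ : Fin n → ℂ)
    (ε : Filling m g) : ZVars N m :=
  fun k j => θ (ε k j).1

/-- The mean value of `G` over the fillings of a colouring. -/
def fillMean {N n : ℕ} (m : Fin (N - 1) → ℕ) (θ : Fin n → ℂ) (g : Fin n → Fin N)
    (G : ZVars N m → ℂ) : ℂ :=
  (∏ k, ((m k).factorial : ℂ)⁻¹) * ∑ ε : Filling m g, G (fillVars θ ε)

/-- The sum over colourings that the multiple contour integral evaluates to. -/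
def colorSum {N n : ℕ} (φ : ℂ → ℂ) (m : Fin (N - 1) → ℕ) (θ : Fin n → ℂ)
    (G : ZVars N m → ℂ) : ℂ :=
  ∑ g : Fin n → Fin N, pairWeight φ θ g * fillMean m θ g G

/-- A product over all points, sorted by colour. -/
theorem prod_eq_prod_mul_prod_filling {N n : ℕ} {m : Fin (N - 1) → ℕ} {g : Fin n → Fin N}
    (ε : Filling m g) (Q : Fin n → ℂ) :
    ∏ i, Q i = (∏ i with (g i : ℕ) = 0, Q i) * ∏ k, ∏ j, Q (ε k j).1 := by
  rw [← Finset.prod_filter_mul_prod_filter_not Finset.univ (fun i => (g i : ℕ) = 0)]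
  congr 1
  rw [← Fintype.prod_sigma']
  symm
  refine Finset.prod_nbij (fun s : (k : Fin (N - 1)) × Fin (m k) => (ε s.1 s.2).1) ?_ ?_ ?_ ?_
  · intro s _
    have := (ε s.1 s.2).2
    simp only [Finset.mem_filter, Finset.mem_univ, true_and]
    omega
  · rintro ⟨k, j⟩ _ ⟨k', j'⟩ _ he
    simp only at he
    have h1 := (ε k j).2
    have h2 := (ε k' j').2
    rw [he, h2] at h1
    obtain rfl : k = k' := Fin.ext (by omega)
    have : j = j' := (ε k).injective (Subtype.ext he)
    rw [this]
  · intro i hi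
    have hi0 : (g i : ℕ) ≠ 0 := by simpa using hi
    have hlt := (g i).2
    let k : Fin (N - 1) := ⟨g i - 1, by omega⟩
    obtain ⟨j, hj⟩ := (ε k).surjective ⟨i, by simp only [k]; omega⟩
    exact ⟨⟨k, j⟩, by simp, by simp only [hj]⟩
  · intros; rfl

/-- The weight of a placement of the integration variables at rapidities. -/
def placeWeight {N n : ℕ} {m : Fin (N - 1) → ℕ} (φ τ κ : ℂ → ℂ) (θ : Fin n → ℂ)
    (f : (k : Fin (N - 1)) → Fin (m k) → Fin n) : ℂ :=
  (∏ k, ∏ j, ∏ i ∈ Finset.univ.erase (f k j), φ (θ (f k j) - θ i)) *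
    ((∏ k, ∏ i, ∏ j ∈ Finset.Ioi i, τ (θ (f k i) - θ (f k j))) *
      ∏ k, ∏ l ∈ Finset.Ioi k, ∏ i, ∏ j, κ (θ (f k i) - θ (f l j)))

/-- Two variables at the same rapidity produce a factor `τ 0` or `κ 0`. -/
theorem placeWeight_eq_zero {N n : ℕ} {m : Fin (N - 1) → ℕ} {φ τ κ : ℂ → ℂ} (hτ : τ 0 = 0)
    (hκ : κ 0 = 0) (θ : Fin n → ℂ) {f : (k : Fin (N - 1)) → Fin (m k) → Fin n}
    (hf : ¬ Function.Injective fun s : (k : Fin (N - 1)) × Fin (m k) => f s.1 s.2) :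
    placeWeight φ τ κ θ f = 0 := by
  have main : ∀ (k l : Fin (N - 1)) (i : Fin (m k)) (j : Fin (m l)), f k i = f l j →
      (⟨k, i⟩ : (k : Fin (N - 1)) × Fin (m k)) ≠ ⟨l, j⟩ → k ≤ l → placeWeight φ τ κ θ f = 0 := by
    intro k l i j he hne hkl
    rw [placeWeight]
    rcases hkl.lt_or_eq with hlt | rfl
    · refine mul_eq_zero_of_right _ (mul_eq_zero_of_right _ ?_)
      refine Finset.prod_eq_zero (Finset.mem_univ k) (Finset.prod_eq_zero (Finset.mem_Ioi.2 hlt)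
        (Finset.prod_eq_zero (Finset.mem_univ i) (Finset.prod_eq_zero (Finset.mem_univ j) ?_)))
      rw [he, sub_self, hκ]
    · refine mul_eq_zero_of_right _ (mul_eq_zero_of_left ?_ _)
      have hij : i ≠ j := fun h => hne (by rw [h])
      rcases lt_or_gt_of_ne hij with h | h
      · refine Finset.prod_eq_zero (Finset.mem_univ k) (Finset.prod_eq_zero (Finset.mem_univ i)
          (Finset.prod_eq_zero (Finset.mem_Ioi.2 h) ?_))
        rw [he, sub_self, hτ]
      · refine Finset.prod_eq_zero (Finset.mem_univ k) (Finset.prod_eq_zero (Finset.mem_univ j)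
          (Finset.prod_eq_zero (Finset.mem_Ioi.2 h) ?_))
        rw [he, sub_self, hτ]
  rw [Function.Injective] at hf
  push Not at hf
  obtain ⟨⟨k, i⟩, ⟨l, j⟩, he, hne⟩ := hf
  rcases le_total k l with hkl | hkl
  · exact main k l i j he hne hkl
  · exact main l k j i he.symm hne.symm hkl

theorem prod_pairs_mul {ι : Type*} [Fintype ι] [LinearOrder ι] [LocallyFiniteOrderTop ι]
    [LocallyFiniteOrderBot ι] (f g : ι → ι → ℂ)
    (h : ∀ i j, i < j → f i j * f j i * g i j = 1) :
    (∏ i, ∏ j ∈ {i}ᶜ, f i j) * ∏ i, ∏ j ∈ Finset.Ioi i, g i j = 1 := by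
  rw [← Finset.prod_prod_Ioi_mul_eq_prod_prod_off_diag fun j i => f i j,
    ← Finset.prod_mul_distrib]
  refine Finset.prod_eq_one fun i _ => ?_
  rw [← Finset.prod_mul_distrib]
  exact Finset.prod_eq_one fun j hj => h i j (Finset.mem_Ioi.1 hj)

/-- Two variables `z, z'` of one colour contribute `φ(z - z') φ(z' - z) τ(z - z') = 1`. For colours
`k < l` the factor `κ(z_k - z_l)` cancels `φ(z_k - z_l)` and leaves `φ(z_l - z_k)`. A variable and a
rapidity of colour `0` contribute a single `φ`. So one `φ` survives for each pair of different
colours, with the higher colour first. -/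
theorem placeWeight_filling {N n : ℕ} {m : Fin (N - 1) → ℕ} {F φ τ κ ψ : ℂ → ℂ}
    (hφ : IsPhiTauKappa N F φ τ κ) (h : PhiShape N φ ψ) {θ : Fin n → ℂ} (hθ : Regular N θ)
    {g : Fin n → Fin N} (ε : Filling m g) :
    placeWeight φ τ κ θ (fun k j => (ε k j).1) = pairWeight φ θ g := by
  classical
  set z : ZVars N m := fun k j => θ (ε k j).1 with hz
  have hcol : ∀ k j, (g (ε k j).1 : ℕ) = k + 1 := fun k j => (ε k j).2
  have hinj : ∀ k l i j, k ≠ l → (ε k i).1 ≠ (ε l j).1 := by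
    intro k l i j hkl he
    have h1 := hcol k i
    rw [he, hcol l j] at h1
    exact hkl (Fin.ext (by omega))
  have hinj' : ∀ k i j, i ≠ j → (ε k i).1 ≠ (ε k j).1 := fun k i j hij he =>
    hij ((ε k).injective (Subtype.ext he))
  set Φ : Fin (N - 1) → Fin (N - 1) → ℂ := fun k l => ∏ i, ∏ j, φ (z k i - z l j) with hΦ
  -- The factors of one variable, sorted into rapidities of colour `0`, other variables of its own
  -- colour, and variables of the other colours.
  have hA : ∀ k j, ∏ i ∈ Finset.univ.erase (ε k j).1, φ (θ (ε k j).1 - θ i) =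
      (∏ i with (g i : ℕ) = 0, φ (z k j - θ i)) * ((∏ i ∈ {j}ᶜ, φ (z k j - z k i)) *
        ∏ l ∈ {k}ᶜ, ∏ i, φ (z k j - z l i)) := by
    intro k j
    have h1 : ∏ i ∈ Finset.univ.erase (ε k j).1, φ (θ (ε k j).1 - θ i) =
        ∏ i, if i = (ε k j).1 then 1 else φ (θ (ε k j).1 - θ i) := by
      rw [← Finset.mul_prod_erase _ _ (Finset.mem_univ (ε k j).1), if_pos rfl, one_mul]
      exact Finset.prod_congr rfl fun i hi => by rw [if_neg (Finset.ne_of_mem_erase hi)]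
    rw [h1, prod_eq_prod_mul_prod_filling ε]
    congr 1
    · refine Finset.prod_congr rfl fun i hi => ?_
      rw [if_neg]
      rintro rfl
      have := hcol k j
      rw [(Finset.mem_filter.1 hi).2] at this
      omega
    · rw [← Finset.prod_mul_prod_compl {k}, Finset.prod_singleton]
      congr 1
      · rw [← Finset.prod_mul_prod_compl {j}, Finset.prod_singleton, if_pos rfl, one_mul]
        refine Finset.prod_congr rfl fun i hi => ?_
        rw [if_neg (hinj' k i j (by simpa using hi))]
      · refine Finset.prod_congr rfl fun l hl => Finset.prod_congr rfl fun i _ => ?_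
        rw [if_neg (hinj l k i j (by simpa using hl))]
  have hP : pairWeight φ θ g = ∏ k, ∏ j, ((∏ i with (g i : ℕ) = 0, φ (z k j - θ i)) *
      ∏ l, if l < k then ∏ i, φ (z k j - z l i) else 1) := by
    rw [pairWeight, prod_eq_prod_mul_prod_filling ε, Finset.prod_eq_one, one_mul]
    · refine Finset.prod_congr rfl fun k _ => Finset.prod_congr rfl fun j _ => ?_
      rw [prod_eq_prod_mul_prod_filling ε]
      congr 1
      · refine Finset.prod_congr rfl fun i hi => ?_
        rw [if_pos]
        rw [Fin.lt_def, hcol k j, (Finset.mem_filter.1 hi).2]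
        omega
      · refine Finset.prod_congr rfl fun l _ => ?_
        by_cases hlk : l < k
        · rw [if_pos hlk]
          refine Finset.prod_congr rfl fun i _ => ?_
          rw [if_pos]
          rw [Fin.lt_def, hcol, hcol]
          have := Fin.lt_def.1 hlk
          omega
        · rw [if_neg hlk]
          refine Finset.prod_eq_one fun i _ => ?_
          rw [if_neg]
          rw [Fin.lt_def, hcol, hcol]
          rw [Fin.lt_def] at hlk
          omega
    · intro i hi
      refine Finset.prod_eq_one fun j _ => ?_
      rw [if_neg]
      rw [Fin.lt_def, (Finset.mem_filter.1 hi).2]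
      omega
  have hsame : ∀ k, (∏ j, ∏ i ∈ {j}ᶜ, φ (z k j - z k i)) *
      ∏ i, ∏ j ∈ Finset.Ioi i, τ (z k i - z k j) = 1 := by
    intro k
    refine prod_pairs_mul (fun j i => φ (z k j - z k i)) (fun i j => τ (z k i - z k j))
      fun i j hij => ?_
    have hne := hθ.sh_ne_zero (hinj' k i j hij.ne)
    have := hφ.phi_mul_phi_neg_mul_tau h hne.1 hne.2.1 hne.2.2
    rw [neg_sub] at this
    rw [mul_comm (φ _) (φ _)]
    exact this
  have hdiff : (∏ k, ∏ l ∈ {k}ᶜ, Φ k l) *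
      ∏ k, ∏ l ∈ Finset.Ioi k, ∏ i, ∏ j, κ (z k i - z l j) =
      ∏ k, ∏ l, if l < k then Φ k l else 1 := by
    have hr : (∏ k, ∏ l, if l < k then Φ k l else 1) =
        ∏ k, ∏ l ∈ {k}ᶜ, if l < k then Φ k l else 1 := by
      refine Finset.prod_congr rfl fun k _ => ?_
      rw [← Finset.prod_mul_prod_compl {k}, Finset.prod_singleton, if_neg (lt_irrefl k), one_mul]
    rw [hr, ← Finset.prod_prod_Ioi_mul_eq_prod_prod_off_diag fun l k => Φ k l,
      ← Finset.prod_prod_Ioi_mul_eq_prod_prod_off_diag fun l k => if l < k then Φ k l else 1,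
      ← Finset.prod_mul_distrib]
    refine Finset.prod_congr rfl fun k _ => ?_
    rw [← Finset.prod_mul_distrib]
    refine Finset.prod_congr rfl fun l hl => ?_
    have hkl := Finset.mem_Ioi.1 hl
    rw [if_neg hkl.not_gt, if_pos hkl, one_mul, mul_comm (Φ k l), mul_assoc]
    have : Φ k l * ∏ i, ∏ j, κ (z k i - z l j) = 1 := by
      rw [hΦ, ← Finset.prod_mul_distrib]
      refine Finset.prod_eq_one fun i _ => ?_
      rw [← Finset.prod_mul_distrib]
      refine Finset.prod_eq_one fun j _ => ?_
      have hne := hθ.sh_ne_zero (hinj k l i j hkl.ne)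
      exact hφ.phi_mul_kappa h hne.1 hne.2.1
    rw [this, mul_one]
  have e1 : ∏ k, ∏ j, ∏ l ∈ {k}ᶜ, ∏ i, φ (z k j - z l i) = ∏ k, ∏ l ∈ {k}ᶜ, Φ k l :=
    Finset.prod_congr rfl fun k _ => Finset.prod_comm
  have e2 : (∏ k, ∏ j, ∏ l, if l < k then ∏ i, φ (z k j - z l i) else 1) =
      ∏ k, ∏ l, if l < k then Φ k l else 1 := by
    refine Finset.prod_congr rfl fun k _ => ?_
    rw [Finset.prod_comm]
    refine Finset.prod_congr rfl fun l _ => ?_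
    by_cases hlk : l < k
    · simp only [if_pos hlk, hΦ]
    · simp only [if_neg hlk, Finset.prod_const_one]
  rw [placeWeight, hP]
  simp only [hA, Finset.prod_mul_distrib]
  rw [e1, e2, ← hdiff]
  have hs := Finset.prod_congr rfl fun k (_ : k ∈ Finset.univ) => hsame k
  rw [Finset.prod_mul_distrib, Finset.prod_const_one] at hs
  linear_combination (∏ k, ∏ j, ∏ i with (g i : ℕ) = 0, φ (z k j - θ i)) *
    (∏ k, ∏ l ∈ {k}ᶜ, Φ k l) * (∏ k, ∏ l ∈ Finset.Ioi k, ∏ i, ∏ j, κ (z k i - z l j)) * hs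

/-- A sum over injective placements, sorted by the colouring they define. -/
theorem sum_placements_eq {N n : ℕ} (hN : 2 ≤ N) {m : Fin (N - 1) → ℕ}
    (X : ((k : Fin (N - 1)) → Fin (m k) → Fin n) → ℂ)
    (hX : ∀ f, ¬ (Function.Injective fun s : (k : Fin (N - 1)) × Fin (m k) => f s.1 s.2) →
      X f = 0) :
    ∑ f, X f = ∑ g : Fin n → Fin N, ∑ ε : Filling m g, X fun k j => (ε k j).1 := by
  classical
  rw [← Fintype.sum_sigma']
  rw [← Finset.sum_filter_add_sum_filter_not Finset.univ
    (fun f : (k : Fin (N - 1)) → Fin (m k) → Fin n =>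
      Function.Injective fun s : (k : Fin (N - 1)) × Fin (m k) => f s.1 s.2),
    Finset.sum_eq_zero (s := Finset.filter (fun f => ¬ _) _) fun f hf =>
      hX f (Finset.mem_filter.1 hf).2, add_zero]
  symm
  refine Finset.sum_nbij
    (fun s : (g : Fin n → Fin N) × Filling m g => fun k j => (s.2 k j).1) ?_ ?_ ?_ ?_
  · rintro ⟨g, ε⟩ _
    simp only [Finset.mem_filter, Finset.mem_univ, true_and]
    rintro ⟨k, j⟩ ⟨k', j'⟩ he
    simp only at he
    have h1 := (ε k j).2
    have h2 := (ε k' j').2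
    rw [he, h2] at h1
    obtain rfl : k = k' := Fin.ext (by omega)
    rw [(ε k).injective (Subtype.ext he)]
  · rintro ⟨g, ε⟩ _ ⟨g', ε'⟩ _ he
    simp only at he
    have hcol : ∀ (g g' : Fin n → Fin N) (ε : Filling m g) (ε' : Filling m g'),
        (fun k j => (ε k j).1) = (fun k j => (ε' k j).1) → ∀ i, (g i : ℕ) ≠ 0 → g' i = g i := by
      intro g g' ε ε' he i hi
      have hlt := (g i).2
      let k : Fin (N - 1) := ⟨g i - 1, by omega⟩
      obtain ⟨j, hj⟩ := (ε k).surjective ⟨i, by simp only [k]; omega⟩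
      have h1 : (ε' k j).1 = i := by
        rw [← congrFun (congrFun he k) j, hj]
      have h2 := (ε' k j).2
      rw [h1] at h2
      refine Fin.ext ?_
      rw [h2]; simp only [k]; omega
    obtain rfl : g = g' := by
      funext i
      by_cases hi : (g i : ℕ) = 0
      · by_cases hi' : (g' i : ℕ) = 0
        · exact Fin.ext (hi.trans hi'.symm)
        · exact hcol g' g ε' ε he.symm i hi'
      · exact (hcol g g' ε ε' he i hi).symm
    congr 1
    funext k
    refine Equiv.ext fun j => Subtype.ext ?_
    exact congrFun (congrFun he k) j
  · intro f hf
    have hinj := (Finset.mem_filter.1 (Finset.mem_coe.1 hf)).2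
    -- An occupied rapidity gets the index of its kind of variable, raised by one; `0` is kept for
    -- unoccupied ones.
    let g : Fin n → Fin N := fun i =>
      if h : ∃ s : (k : Fin (N - 1)) × Fin (m k), f s.1 s.2 = i then
        ⟨h.choose.1 + 1, by have := h.choose.1.2; omega⟩ else ⟨0, by omega⟩
    have hg : ∀ k j, (g (f k j) : ℕ) = k + 1 := by
      intro k j
      have h : ∃ s : (k : Fin (N - 1)) × Fin (m k), f s.1 s.2 = f k j := ⟨⟨k, j⟩, rfl⟩
      have hs : h.choose = ⟨k, j⟩ := hinj h.choose_spec
      simp only [g, dif_pos h, hs]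
    have hb : ∀ k : Fin (N - 1), Function.Bijective
        (fun j => (⟨f k j, hg k j⟩ : {i : Fin n // (g i : ℕ) = k + 1})) := by
      intro k
      constructor
      · intro j j' he
        have : (⟨k, j⟩ : (k : Fin (N - 1)) × Fin (m k)) = ⟨k, j'⟩ :=
          hinj (Subtype.ext_iff.1 he)
        simpa using this
      · rintro ⟨i, hi⟩
        have h : ∃ s : (k : Fin (N - 1)) × Fin (m k), f s.1 s.2 = i := by
          by_contra hno
          simp only [g, dif_neg hno] at hi
          omega
        obtain ⟨⟨k', j⟩, rfl⟩ := h
        have := hg k' j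
        rw [this] at hi
        obtain rfl : k' = k := Fin.ext (by omega)
        exact ⟨j, rfl⟩
    exact ⟨⟨g, fun k => Equiv.ofBijective _ (hb k)⟩, by simp, rfl⟩
  · intros; rfl

theorem differentiable_finset_prod {E ι : Type*} [NormedAddCommGroup E] [NormedSpace ℂ E]
    (s : Finset ι) {f : ι → E → ℂ} (hf : ∀ i ∈ s, Differentiable ℂ (f i)) :
    Differentiable ℂ fun x => ∏ i ∈ s, f i x := by
  classical
  induction s using Finset.induction_on with
  | empty => simp
  | insert i s hi ih =>
    simp only [Finset.prod_insert hi]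
    exact (hf i (Finset.mem_insert_self _ _)).mul
      (ih fun j hj => hf j (Finset.mem_insert_of_mem hj))

theorem differentiable_tau_kappa_part {N : ℕ} {m : Fin (N - 1) → ℕ} {τ κ : ℂ → ℂ}
    (hτ : Differentiable ℂ τ) (hκ : Differentiable ℂ κ) :
    Differentiable ℂ fun z : ZVars N m =>
      (∏ k, ∏ i, ∏ j ∈ Finset.Ioi i, τ (z k i - z k j)) *
        ∏ k, ∏ l ∈ Finset.Ioi k, ∏ i, ∏ j, κ (z k i - z l j) := by
  have hd : ∀ k l i j, Differentiable ℂ fun z : ZVars N m => z k i - z l j := by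
    intros; fun_prop
  refine Differentiable.mul ?_ ?_
  · exact differentiable_finset_prod _ fun k _ => differentiable_finset_prod _ fun i _ =>
      differentiable_finset_prod _ fun j _ => hτ.comp (hd k k i j)
  · exact differentiable_finset_prod _ fun k _ => differentiable_finset_prod _ fun l _ =>
      differentiable_finset_prod _ fun i _ => differentiable_finset_prod _ fun j _ =>
        hκ.comp (hd k l i j)

/-- The multiple contour integral is a sum over colourings of the rapidities. -/
theorem blockI_eq_colorSum {N n : ℕ} (hN : 2 ≤ N) {F φ τ κ ψ : ℂ → ℂ}
    (hφ : IsPhiTauKappa N F φ τ κ) (h : PhiShape N φ ψ) (m : Fin (N - 1) → ℕ) {θ : Fin n → ℂ}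
    (hθ : Regular N θ) {G : ZVars N m → ℂ} (hG : Differentiable ℂ G) :
    blockI N φ τ κ m θ G = colorSum φ m θ G := by
  have hRne := h.R_ne_zero hN
  set T : ZVars N m → ℂ := fun z =>
    (∏ k, ∏ i, ∏ j ∈ Finset.Ioi i, τ (z k i - z k j)) *
        ∏ k, ∏ l ∈ Finset.Ioi k, ∏ i, ∏ j, κ (z k i - z l j) with hT
  have hTd : Differentiable ℂ T :=
    differentiable_tau_kappa_part (hφ.differentiable_tau h) (hφ.differentiable_kappa h)
  let unc : (Fin (∑ k, m k) → ℂ) → ZVars N m := fun w k j => w (finSigmaFinEquiv ⟨k, j⟩)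
  have hunc : Differentiable ℂ unc := by
    refine differentiable_pi.2 fun k => differentiable_pi.2 fun j => ?_
    simp only [unc]; fun_prop
  have hprod : ∀ (Q : Fin (∑ k, m k) → ℂ), ∏ a, Q a = ∏ k, ∏ j, Q (finSigmaFinEquiv ⟨k, j⟩) := by
    intro Q
    rw [← Fintype.prod_sigma', ← Equiv.prod_comp finSigmaFinEquiv]
  have hint : ∀ w : Fin (∑ k, m k) → ℂ, ZNIsing.h N φ τ κ θ (unc w) * G (unc w) =
      (∏ a, ∏ i, φ (w a - θ i)) * (T (unc w) * G (unc w)) := by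
    intro w
    rw [hprod, ZNIsing.h, Finset.prod_mul_distrib, hT]
    ring
  have hval : ∀ᶠ ρ in 𝓝[>] (0 : ℝ), (∏ k, ((m k).factorial : ℂ)⁻¹) * (R φ)⁻¹ ^ (∑ k, m k) *
      multiContourIntegral θ ρ (∑ k, m k) (fun w =>
        ZNIsing.h N φ τ κ θ (unc w) * G (unc w)) = colorSum φ m θ G := by
    filter_upwards [eventually_contourIntegral_prod_phi hN h hθ] with ρ hρ
    simp only [hint]
    rw [multiContourIntegral_prod_mul hρ _ (fun w => T (unc w) * G (unc w))
      ((hTd.comp hunc).mul (hG.comp hunc))]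
    simp only [Finset.prod_mul_distrib, Finset.prod_const, Finset.card_univ, Fintype.card_fin]
    simp only [mul_assoc, ← Finset.mul_sum]
    -- Each residue brings a factor `R`, which the normalization of `dz / R` removes.
    rw [← mul_assoc ((R φ)⁻¹ ^ _), ← mul_pow, inv_mul_cancel₀ hRne, one_pow, one_mul]
    have hsum : (∑ e : Fin (∑ k, m k) → Fin n, (∏ a, ∏ j ∈ Finset.univ.erase (e a),
        φ (θ (e a) - θ j)) * (T (unc (θ ∘ e)) * G (unc (θ ∘ e)))) =
        ∑ f : (k : Fin (N - 1)) → Fin (m k) → Fin n,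
          placeWeight φ τ κ θ f * G fun k j => θ (f k j) := by
      refine Fintype.sum_equiv ((Equiv.arrowCongr finSigmaFinEquiv (Equiv.refl (Fin n))).symm.trans
        (Equiv.piCurry fun (k : Fin (N - 1)) (_ : Fin (m k)) => Fin n)) _ _ fun e => ?_
      rw [hprod, ← mul_assoc]
      rfl
    rw [hsum, sum_placements_eq hN _ fun f hf => by
      rw [placeWeight_eq_zero (hφ.tau_zero h) (hφ.kappa_zero h) θ hf, zero_mul], colorSum,
      Finset.mul_sum]
    refine Finset.sum_congr rfl fun g _ => ?_
    rw [fillMean, mul_left_comm, Finset.mul_sum (a := pairWeight φ θ g)]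
    congr 1
    refine Finset.sum_congr rfl fun ε _ => ?_
    rw [← placeWeight_filling hφ h hθ ε]
    rfl
  exact (tendsto_const_nhds.congr' (hval.mono fun _ hρ => hρ.symm)).limUnder_eq

/-! ### Watson's equations, crossing and Lorentz covariance -/

theorem contourIntegral_comp_perm {n : ℕ} (θ : Fin n → ℂ) (e : Equiv.Perm (Fin n)) (ρ : ℝ)
    (g : ℂ → ℂ) : contourIntegral (θ ∘ e) ρ g = contourIntegral θ ρ g := by
  simp only [contourIntegral, Function.comp_apply]
  exact Equiv.sum_comp e fun i => -(∮ z in C(θ i, ρ), g z)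

theorem multiContourIntegral_comp_perm {n : ℕ} (θ : Fin n → ℂ) (e : Equiv.Perm (Fin n)) (ρ : ℝ)
    (M : ℕ) (f : (Fin M → ℂ) → ℂ) :
    multiContourIntegral (θ ∘ e) ρ M f = multiContourIntegral θ ρ M f := by
  induction M with
  | zero => rfl
  | succ M ih => simp only [multiContourIntegral, ih, contourIntegral_comp_perm]

theorem blockI_comp_perm {N n : ℕ} (φ τ κ : ℂ → ℂ) (m : Fin (N - 1) → ℕ) (θ : Fin n → ℂ)
    (e : Equiv.Perm (Fin n)) (G : ZVars N m → ℂ) :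
    blockI N φ τ κ m (θ ∘ e) G = blockI N φ τ κ m θ G := by
  have hh : ∀ z : ZVars N m, h N φ τ κ (θ ∘ e) z = h N φ τ κ θ z := by
    intro z
    simp only [h, Function.comp_apply]
    congr 1
    refine Finset.prod_congr rfl fun k _ => ?_
    congr 1
    exact Finset.prod_congr rfl fun j _ => Equiv.prod_comp e fun i => φ (z k j - θ i)
  simp only [blockI, multiContourIntegral_comp_perm, hh]

/-- The product of `F(θ_i - θ_j)` over `i < j`. -/
def pairF {n : ℕ} (F : ℂ → ℂ) (θ : Fin n → ℂ) : ℂ :=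
  ∏ i, ∏ j, if i < j then F (θ i - θ j) else 1

theorem pairF_eq {n : ℕ} (F : ℂ → ℂ) (θ : Fin n → ℂ) :
    ∏ i, ∏ j ∈ Finset.Ioi i, F (θ i - θ j) = pairF F θ := by
  refine Finset.prod_congr rfl fun i _ => ?_
  rw [← Finset.prod_filter]
  congr 1
  ext j
  simp

/-- Exchanging neighbours reverses the order of no other pair. -/
theorem pairF_swap {n : ℕ} (F : ℂ → ℂ) (θ : Fin n → ℂ) {i j : Fin n} (hij : (j : ℕ) = i + 1) :
    ∃ P : ℂ, pairF F θ = P * F (θ i - θ j) ∧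
      pairF F (θ ∘ Equiv.swap i j) = P * F (θ j - θ i) := by
  have hne : i ≠ j := by rintro rfl; omega
  have hlt : i < j := Fin.lt_def.2 (by omega)
  have h1 : (i, j) ∈ (Finset.univ : Finset (Fin n × Fin n)) := Finset.mem_univ _
  have h2 : (j, i) ∈ (Finset.univ : Finset (Fin n × Fin n)).erase (i, j) :=
    Finset.mem_erase.2 ⟨fun h => hne (Prod.ext_iff.1 h).2, Finset.mem_univ _⟩
  have e1 : pairF F θ = ∏ x : Fin n × Fin n, if x.1 < x.2 then F (θ x.1 - θ x.2) else 1 := by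
    rw [pairF, Fintype.prod_prod_type]
  have e2 : pairF F (θ ∘ Equiv.swap i j) = ∏ x : Fin n × Fin n,
      if Equiv.swap i j x.1 < Equiv.swap i j x.2 then F (θ x.1 - θ x.2) else 1 := by
    rw [pairF, ← Fintype.prod_prod_type', ← Equiv.prod_comp
      ((Equiv.swap i j).prodCongr (Equiv.swap i j))]
    simp
  refine ⟨∏ x ∈ (Finset.univ.erase (i, j)).erase (j, i),
    if x.1 < x.2 then F (θ x.1 - θ x.2) else 1, ?_, ?_⟩
  · rw [e1, ← Finset.mul_prod_erase _ _ h1, ← Finset.mul_prod_erase _ _ h2]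
    simp only [if_pos hlt, if_neg hlt.not_gt]
    ring
  · rw [e2, ← Finset.mul_prod_erase _ _ h1, ← Finset.mul_prod_erase _ _ h2]
    simp only [Equiv.swap_apply_left, Equiv.swap_apply_right, if_pos hlt, if_neg hlt.not_gt]
    rw [one_mul, mul_comm]
    congr 1
    refine Finset.prod_congr rfl fun x hx => ?_
    have hx1 := Finset.ne_of_mem_erase hx
    have hx2 := Finset.ne_of_mem_erase (Finset.mem_of_mem_erase hx)
    obtain ⟨a, b⟩ := x
    congr 1
    simp only [ne_eq, Prod.mk.injEq, not_and] at hx1 hx2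
    simp only [eq_iff_iff, Equiv.swap_apply_def, Fin.lt_def]
    simp only [Fin.ext_iff] at hx1 hx2 ⊢
    split_ifs <;> omega

theorem pairF_cons {n : ℕ} (F : ℂ → ℂ) (x : ℂ) (θ : Fin n → ℂ) :
    pairF F (Fin.cons x θ : Fin (n + 1) → ℂ) = (∏ i, F (x - θ i)) * pairF F θ := by
  simp [pairF, Fin.prod_univ_succ]

theorem pairF_snoc {n : ℕ} (F : ℂ → ℂ) (x : ℂ) (θ : Fin n → ℂ) :
    pairF F (Fin.snoc θ x : Fin (n + 1) → ℂ) = (∏ i, F (θ i - x)) * pairF F θ := by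
  have h : ∀ i : Fin n, ¬ (Fin.last n < i.castSucc) := fun i => (Fin.castSucc_lt_last i).not_gt
  simp [pairF, Fin.prod_univ_castSucc, Finset.prod_mul_distrib, mul_comm, h, Fin.castSucc_lt_last]

theorem Regular.ne_two_pi {N n : ℕ} {θ θ' : Fin n → ℂ} (hθ : Regular N θ)
    (h : ∀ i, ∃ l : ℤ, θ' i = θ i + l * (2 * Real.pi * I)) : Regular N θ' := by
  choose l hl using h
  intro i j hij k
  rw [hl, hl]
  refine ⟨fun he => (hθ i j hij (k - l i + l j)).1 ?_, fun he => (hθ i j hij (k - l i + l j)).2 ?_⟩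
  · push_cast; linear_combination he
  · push_cast; linear_combination he

/-! ### Invariance of the p-functions under simultaneous changes of the integration variables. -/

namespace IsPFunction

variable {N : ℕ} {φ τ κ : ℂ → ℂ} {σ s : ℂ} {m : ℕ → Fin (N - 1) → ℕ}
  {hm : ∀ n k, m (N + n) k = m n k + 1} {p : (n : ℕ) → (Fin n → ℂ) → ZVars N (m n) → ℂ}

theorem symm_z_all (hp : IsPFunction N φ τ κ σ s m hm p) {n : ℕ} (θ : Fin n → ℂ)
    (z : ZVars N (m n)) (e : (k : Fin (N - 1)) → Equiv.Perm (Fin (m n k))) :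
    p n θ (fun k => z k ∘ e k) = p n θ z := by
  have main : ∀ t : Finset (Fin (N - 1)),
      p n θ (fun k => if k ∈ t then z k ∘ e k else z k) = p n θ z := by
    intro t
    induction t using Finset.induction_on with
    | empty => simp
    | insert a t ha ih =>
      rw [← ih, ← hp.symm_z n θ (fun k => if k ∈ t then z k ∘ e k else z k) a (e a)]
      congr 1
      funext k
      by_cases hk : k = a
      · subst hk
        simp [ha]
      · simp [hk]
  simpa using main Finset.univ

theorem periodic_z_all (hp : IsPFunction N φ τ κ σ s m hm p) {n : ℕ} (θ : Fin n → ℂ)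
    (z z' : ZVars N (m n)) (h : ∀ k j, z' k j = z k j ∨ z' k j = z k j + 2 * Real.pi * I) :
    p n θ z' = p n θ z := by
  classical
  have main : ∀ t : Finset ((k : Fin (N - 1)) × Fin (m n k)),
      p n θ (fun k j => if ⟨k, j⟩ ∈ t then z k j + 2 * Real.pi * I else z k j) = p n θ z := by
    intro t
    induction t using Finset.induction_on with
    | empty => simp
    | insert a t ha ih =>
      obtain ⟨a, b⟩ := a
      rw [← ih, ← hp.periodic_z n θ
        (fun k j => if ⟨k, j⟩ ∈ t then z k j + 2 * Real.pi * I else z k j) a b]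
      congr 1
      funext k j
      by_cases hk : k = a
      · subst hk
        by_cases hj : j = b
        · subst hj
          simp [ha]
        · simp [hj]
      · simp [hk]
  rw [← main (Finset.univ.filter fun s => z' s.1 s.2 ≠ z s.1 s.2)]
  congr 1
  funext k j
  by_cases hz : z' k j = z k j
  · simp [hz]
  · simp only [Finset.mem_filter, Finset.mem_univ, true_and, ne_eq, hz, not_false_eq_true, if_true]
    exact (h k j).resolve_left hz

theorem differentiable_z (hp : IsPFunction N φ τ κ σ s m hm p) {n : ℕ} (θ : Fin n → ℂ) :
    Differentiable ℂ (p n θ) :=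
  (hp.analytic n).comp ((differentiable_const θ).prodMk differentiable_id)

end IsPFunction

section Equations

variable {N : ℕ} {F φ τ κ ψ : ℂ → ℂ} {σ s : ℂ} {m : ℕ → Fin (N - 1) → ℕ}
  {hm : ∀ n k, m (N + n) k = m n k + 1} {p : (n : ℕ) → (Fin n → ℂ) → ZVars N (m n) → ℂ}

theorem formFactor_eq (c : ℕ → ℂ) (n : ℕ) (θ : Fin n → ℂ) :
    formFactor N F φ τ κ c m p n θ = c n * blockI N φ τ κ (m n) θ (p n θ) * pairF F θ := by
  rw [formFactor, pairF_eq]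

theorem formFactor_eq_colorSum (hN : 2 ≤ N) (hφ : IsPhiTauKappa N F φ τ κ) (h : PhiShape N φ ψ)
    (hp : IsPFunction N φ τ κ σ s m hm p) (c : ℕ → ℂ) {n : ℕ} {θ : Fin n → ℂ}
    (hθ : Regular N θ) :
    formFactor N F φ τ κ c m p n θ = c n * colorSum φ (m n) θ (p n θ) * pairF F θ := by
  rw [formFactor_eq, blockI_eq_colorSum hN hφ h (m n) hθ (hp.differentiable_z θ)]

theorem blockI_p_comp_perm (hp : IsPFunction N φ τ κ σ s m hm p) {n : ℕ} (θ : Fin n → ℂ)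
    (e : Equiv.Perm (Fin n)) :
    blockI N φ τ κ (m n) (θ ∘ e) (p n (θ ∘ e)) = blockI N φ τ κ (m n) θ (p n θ) := by
  rw [blockI_comp_perm, show p n (θ ∘ e) = p n θ from funext fun z => hp.symm_theta n θ z e]

/-- The block is symmetric in the rapidities, so the S-matrix comes from the single factor `F` whose
argument changes sign. -/
theorem formFactor_watson (hN : 2 ≤ N) (hF : IsMinimalFormFactor N F)
    (hp : IsPFunction N φ τ κ σ s m hm p) (c : ℕ → ℂ) {n : ℕ} {θ : Fin n → ℂ}
    (hθ : Regular N θ) {i j : Fin n} (hij : (j : ℕ) = i + 1) :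
    formFactor N F φ τ κ c m p n θ =
      formFactor N F φ τ κ c m p n (θ ∘ Equiv.swap i j) * S N (θ i - θ j) := by
  have hne := hθ.sh_ne_zero (show i ≠ j by rintro rfl; omega)
  obtain ⟨P, h1, h2⟩ := pairF_swap F θ hij
  rw [formFactor_eq, formFactor_eq, blockI_p_comp_perm hp, h1, h2,
    hF.eq_mul_S hN hne.2.2 hne.2.1, neg_sub]
  ring

theorem formFactor_boost (hN : 2 ≤ N) (hφ : IsPhiTauKappa N F φ τ κ) (h : PhiShape N φ ψ)
    (hp : IsPFunction N φ τ κ σ s m hm p) (c : ℕ → ℂ) {n : ℕ} {θ : Fin n → ℂ}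
    (hθ : Regular N θ) (μ : ℂ) :
    formFactor N F φ τ κ c m p n (fun i => θ i + μ) =
      exp (s * μ) * formFactor N F φ τ κ c m p n θ := by
  have hθ' : Regular N (fun i => θ i + μ) := by
    intro i j hij l
    rw [add_sub_add_right_eq_sub]
    exact hθ i j hij l
  rw [formFactor_eq_colorSum hN hφ h hp c hθ, formFactor_eq_colorSum hN hφ h hp c hθ']
  have h1 : colorSum φ (m n) (fun i => θ i + μ) (p n fun i => θ i + μ) =
      exp (s * μ) * colorSum φ (m n) θ (p n θ) := by
    simp only [colorSum, Finset.mul_sum]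
    refine Finset.sum_congr rfl fun g _ => ?_
    have hw : pairWeight φ (fun i => θ i + μ) g = pairWeight φ θ g := by
      simp only [pairWeight, add_sub_add_right_eq_sub]
    have hf : ∀ ε : Filling (m n) g, p n (fun i => θ i + μ) (fillVars (fun i => θ i + μ) ε) =
        exp (s * μ) * p n θ (fillVars θ ε) := fun ε => hp.boost n θ (fillVars θ ε) μ
    simp only [hw, fillMean, hf, ← Finset.mul_sum]
    ring
  have h2 : pairF F (fun i => θ i + μ) = pairF F θ := by
    simp only [pairF, add_sub_add_right_eq_sub]
  rw [h1, h2]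
  ring

/-- All weights are `2πi`-periodic, and a variable sitting at the shifted rapidity is moved back by
the periodicity of `p` in `z`. Only the explicit dependence of `p` on the rapidity remains, and it
yields `σ`. -/
theorem colorSum_shift (hφ : IsPhiTauKappa N F φ τ κ)
    (hp : IsPFunction N φ τ κ σ s m hm p) {n : ℕ} (x : ℂ) (θ : Fin n → ℂ) :
    σ * colorSum φ (m (n + 1)) (Fin.cons (x + 2 * Real.pi * I) θ)
        (p (n + 1) (Fin.cons (x + 2 * Real.pi * I) θ)) =
      colorSum φ (m (n + 1)) (Fin.cons x θ : Fin (n + 1) → ℂ) (p (n + 1) (Fin.cons x θ)) := by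
  set Θ : Fin (n + 1) → ℂ := Fin.cons x θ with hΘ
  set Θ' : Fin (n + 1) → ℂ := Fin.cons (x + 2 * Real.pi * I) θ with hΘ'
  have hupd : Θ' = Function.update Θ 0 (Θ 0 + 2 * Real.pi * I) := by
    funext i
    refine Fin.cases ?_ (fun i => ?_) i
    · simp [hΘ, hΘ']
    · simp [hΘ, hΘ', Fin.succ_ne_zero]
  have hor : ∀ i, Θ' i = Θ i ∨ Θ' i = Θ i + 2 * Real.pi * I := by
    intro i
    refine Fin.cases ?_ (fun i => ?_) i
    · right; simp [hΘ, hΘ']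
    · left; simp [hΘ, hΘ']
  have hdiff : ∀ i j, φ (Θ' i - Θ' j) = φ (Θ i - Θ j) := by
    intro i j
    rcases hor i with hi | hi <;> rcases hor j with hj | hj <;> rw [hi, hj]
    · rw [← sub_sub, hφ.periodic_phi.sub_eq]
    · rw [add_sub_right_comm, hφ.periodic_phi]
    · rw [add_sub_add_right_eq_sub]
  simp only [colorSum, Finset.mul_sum]
  refine Finset.sum_congr rfl fun g _ => ?_
  have hw : pairWeight φ Θ' g = pairWeight φ Θ g := by simp only [pairWeight, hdiff]
  have hf : ∀ ε : Filling (m (n + 1)) g, σ * p (n + 1) Θ' (fillVars Θ' ε) =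
      p (n + 1) Θ (fillVars Θ ε) := by
    intro ε
    rw [hupd, hp.shift, ← hupd]
    exact hp.periodic_z_all Θ _ _ fun k j => hor _
  simp only [hw, fillMean, ← hf, ← Finset.mul_sum]
  ring

/-- Moving the first rapidity to the end is a rotation, which the block does not see; the arguments
of `F` match by reflection. -/
theorem formFactor_crossing (hN : 2 ≤ N) (hF : IsMinimalFormFactor N F)
    (hφ : IsPhiTauKappa N F φ τ κ) (h : PhiShape N φ ψ)
    (hp : IsPFunction N φ τ κ σ s m hm p) (c : ℕ → ℂ) {n : ℕ} (θ₁ : ℂ) {θ : Fin n → ℂ}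
    (hθ : Regular N (Fin.cons (θ₁ + I * Real.pi) θ : Fin (n + 1) → ℂ)) :
    σ * formFactor N F φ τ κ c m p (n + 1) (Fin.cons (θ₁ + I * Real.pi) θ) =
      formFactor N F φ τ κ c m p (n + 1) (Fin.snoc θ (θ₁ - I * Real.pi)) := by
  set x := θ₁ - I * Real.pi with hx
  have hx' : θ₁ + I * Real.pi = x + 2 * Real.pi * I := by rw [hx]; ring
  rw [hx'] at hθ ⊢
  have hreg : Regular N (Fin.cons x θ : Fin (n + 1) → ℂ) := by
    refine hθ.ne_two_pi fun i => ?_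
    refine Fin.cases ⟨-1, ?_⟩ (fun i => ⟨0, ?_⟩) i
    · simp
    · simp
  have hrot : (Fin.snoc θ x : Fin (n + 1) → ℂ) = (Fin.cons x θ : Fin (n + 1) → ℂ) ∘ finRotate _ :=
    Fin.snoc_eq_cons_rotate θ x
  rw [formFactor_eq_colorSum hN hφ h hp c hθ, formFactor_eq, pairF_snoc, hrot,
    blockI_p_comp_perm hp, blockI_eq_colorSum hN hφ h _ hreg (hp.differentiable_z _),
    ← colorSum_shift hφ hp x θ, pairF_cons]
  have hFe : ∏ i, F (x + 2 * Real.pi * I - θ i) = ∏ i, F (θ i - x) := by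
    refine Finset.prod_congr rfl fun i _ => ?_
    rw [← hF.reflect]
    congr 1
    ring
  rw [hFe]
  ring

end Equations

/-! ### Iterated residues -/

/-- The pair factor of a colouring; at the pairs in `L` the function `φ` is replaced by its
residue `ρ`, and the colours have to be in the order that produces the pole. -/
def linkFactor {N T : ℕ} (φ : ℂ → ℂ) (ρ : ℂ) (L : Finset (Fin T × Fin T)) (g : Fin T → Fin N)
    (Θ : Fin T → ℂ) (x : Fin T × Fin T) : ℂ :=
  if x ∈ L then (if g x.2 < g x.1 then ρ else 0)
  else (if g x.2 < g x.1 then φ (Θ x.1 - Θ x.2) else 1)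

/-- The form factor after some residues were taken, with the pairs in `L` as the poles. -/
def linkedFormFactor {N : ℕ} (F φ : ℂ → ℂ) (ρ : ℂ) (c : ℕ → ℂ) (m : ℕ → Fin (N - 1) → ℕ)
    (p : (n : ℕ) → (Fin n → ℂ) → ZVars N (m n) → ℂ) {T : ℕ} (L : Finset (Fin T × Fin T))
    (Θ : Fin T → ℂ) : ℂ :=
  c T * ∑ g : Fin T → Fin N, pairF F Θ * fillMean (m T) Θ g (p T Θ) *
    ∏ x, linkFactor φ ρ L g Θ x

/-- The pairs `(j + 1, j)` of neighbours in a chain that consists of the first `k + 1` points. -/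
def chainLinks (T k : ℕ) : Finset (Fin T × Fin T) :=
  Finset.univ.filter fun x => (x.1 : ℕ) = x.2 + 1 ∧ (x.1 : ℕ) ≤ k

theorem mem_chainLinks {T k : ℕ} {x : Fin T × Fin T} :
    x ∈ chainLinks T k ↔ (x.1 : ℕ) = x.2 + 1 ∧ (x.1 : ℕ) ≤ k := by
  simp [chainLinks]

/-- The rapidities `θ` preceded by `k` further ones, spaced by `iη` above the first one. -/
def chain (N k : ℕ) {q T : ℕ} (hq : 0 < q) (hT : T = q + k) (θ : Fin q → ℂ) (i : Fin T) : ℂ :=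
  if _ : (i : ℕ) < k then θ ⟨0, hq⟩ + ((k : ℂ) - i) * ieta N else θ ⟨i - k, by omega⟩

/-- The rapidities `θ` preceded by a chain of `k + 1` ones, the last of which is `t`. -/
def chainCurve (N k : ℕ) {q T : ℕ} (hT : T = q + 1 + k) (θ : Fin q → ℂ) (t : ℂ) (i : Fin T) : ℂ :=
  if _ : (i : ℕ) ≤ k then t + ((k : ℂ) - i) * ieta N else θ ⟨i - (k + 1), by omega⟩

theorem chain_cons {N k q T : ℕ} (hT : T = q + 1 + k) (θ : Fin q → ℂ) (t : ℂ) :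
    chain N k (Nat.succ_pos q) hT (Fin.cons t θ) = chainCurve N k hT θ t := by
  funext i
  rw [chain, chainCurve]
  rcases lt_trichotomy (i : ℕ) k with h | h | h
  · rw [dif_pos h, dif_pos h.le]; rfl
  · rw [dif_neg (by omega), dif_pos h.le]
    have h0 : (⟨(i : ℕ) - k, by omega⟩ : Fin (q + 1)) = 0 := Fin.ext (by simp [h])
    have hi : ((i : ℕ) : ℂ) = k := by rw [h]
    rw [h0, Fin.cons_zero, hi]
    ring
  · rw [dif_neg (by omega), dif_neg (by omega)]
    have : (⟨(i : ℕ) - k, by omega⟩ : Fin (q + 1)) =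
        Fin.succ ⟨i - (k + 1), by omega⟩ := Fin.ext (by simp; omega)
    rw [this, Fin.cons_succ]

theorem chain_succ {N k q T : ℕ} (hq : 0 < q) (hT : T = q + 1 + k) (hT' : T = q + (k + 1))
    (θ : Fin q → ℂ) :
    chain N (k + 1) hq hT' θ = chainCurve N k hT θ (θ ⟨0, hq⟩ + ieta N) := by
  funext i
  rw [chain, chainCurve]
  by_cases h : (i : ℕ) ≤ k
  · rw [dif_pos (by omega), dif_pos h]; push_cast; ring
  · rw [dif_neg (by omega), dif_neg h]

theorem chainCurve_of_le {N k q T : ℕ} (hT : T = q + 1 + k) (θ : Fin q → ℂ) (t : ℂ) {i : Fin T}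
    (hi : (i : ℕ) ≤ k) : chainCurve N k hT θ t i = t + ((k : ℂ) - i) * ieta N := by
  rw [chainCurve, dif_pos hi]

theorem chainCurve_of_lt {N k q T : ℕ} (hT : T = q + 1 + k) (θ : Fin q → ℂ) (t : ℂ) {i : Fin T}
    (hi : k < (i : ℕ)) : chainCurve N k hT θ t i = θ ⟨i - (k + 1), by omega⟩ := by
  rw [chainCurve, dif_neg (by omega)]

theorem differentiable_chainCurve {N k q T : ℕ} (hT : T = q + 1 + k) (θ : Fin q → ℂ) :
    Differentiable ℂ (chainCurve N k hT θ) := by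
  refine differentiable_pi.2 fun i => ?_
  by_cases hi : (i : ℕ) ≤ k
  · simp only [chainCurve_of_le hT θ _ hi]; fun_prop
  · simp only [chainCurve_of_lt hT θ _ (not_le.1 hi)]; fun_prop

/-! ### Analyticity and poles of the pair factors along a curve of chains. -/

section Step

variable {N : ℕ} {F φ ψ : ℂ → ℂ} {k q T : ℕ} {θ : Fin q → ℂ}

theorem Generic.ne_add (hθ : Generic N θ) {i j : Fin q} (hij : i ≠ j) (a l : ℤ) :
    θ i - θ j + a * ieta N ≠ l * ieta N := by
  intro h
  refine hθ i j hij (l - a) ?_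
  rw [← ieta]; push_cast
  linear_combination h

/-- On a curve of chains, the differences of the rapidities in the limit. -/
theorem chainCurve_sub_cases (hq : 0 < q) (hT : T = q + 1 + k) (hθ : Generic N θ) {i j : Fin T}
    (hi : (i : ℕ) ≤ k) (hj : k < (j : ℕ)) :
    (∀ l : ℤ, chainCurve N k hT θ (θ ⟨0, hq⟩ + ieta N) i -
      chainCurve N k hT θ (θ ⟨0, hq⟩ + ieta N) j ≠ l * ieta N) ∨
    ((j : ℕ) = k + 1 ∧ chainCurve N k hT θ (θ ⟨0, hq⟩ + ieta N) i -
      chainCurve N k hT θ (θ ⟨0, hq⟩ + ieta N) j = (k + 1 - i : ℕ) * ieta N) := by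
  rw [chainCurve_of_le hT θ _ hi, chainCurve_of_lt hT θ _ hj]
  by_cases hj' : (j : ℕ) = k + 1
  · right
    refine ⟨hj', ?_⟩
    have : (⟨(j : ℕ) - (k + 1), by omega⟩ : Fin q) = ⟨0, hq⟩ := Fin.ext (by simp [hj'])
    rw [this, Nat.cast_sub (by omega)]
    push_cast; ring
  · left
    intro l he
    have hne : (⟨0, hq⟩ : Fin q) ≠ ⟨(j : ℕ) - (k + 1), by omega⟩ := by
      intro h
      have := Fin.ext_iff.1 h
      simp only at this
      omega
    refine hθ.ne_add hne (k + 1 - i) l ?_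
    rw [← he]; push_cast; ring

/-- If the difference depends on `t`, its limit is either outside `iηℤ` or, since `i < j`, equal to
`l iη` with `0 < l < N`, where `F` is holomorphic by the explicit formula. -/
theorem analyticAt_F_chainCurve (hN : 2 ≤ N) (hF : IsMinimalFormFactor N F) (hk : k + 2 ≤ N)
    (hq : 0 < q) (hT : T = q + 1 + k) (hθ : Generic N θ) {i j : Fin T} (hij : i < j) :
    AnalyticAt ℂ (fun t => F (chainCurve N k hT θ t i - chainCurve N k hT θ t j))
      (θ ⟨0, hq⟩ + ieta N) := by
  have hlt := Fin.lt_def.1 hij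
  by_cases hj : (j : ℕ) ≤ k
  · simp only [chainCurve_of_le hT θ _ hj, chainCurve_of_le hT θ _ (hlt.le.trans hj),
      add_sub_add_left_eq_sub]
    exact analyticAt_const
  by_cases hi : (i : ℕ) ≤ k
  · have hd := differentiable_pi.1 (differentiable_chainCurve (N := N) hT θ)
    refine AnalyticAt.comp_of_eq ?_ (((hd i).sub (hd j)).analyticAt _) rfl
    rcases chainCurve_sub_cases hq hT hθ hi (not_le.1 hj) with h | ⟨_, h⟩
    · exact hF.analyticAt_of_forall_ne hN h
    · rw [h]
      have hη := eta_pos hN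
      have him : (((k + 1 - i : ℕ) : ℂ) * ieta N).im = ((k + 1 - i : ℕ) : ℝ) * eta N := by
        simp [ieta]
      have h1 : ((k + 1 - i : ℕ) : ℝ) ≤ N := by
        have : k + 1 - (i : ℕ) ≤ N := by omega
        exact_mod_cast this
      have h0 : (0 : ℝ) ≤ ((k + 1 - i : ℕ) : ℝ) := Nat.cast_nonneg _
      have hNη := natCast_mul_eta hN
      refine hF.analyticAt_of_mem_strip hN ?_ ?_ <;> rw [him] <;> nlinarith
  · simp only [chainCurve_of_lt hT θ _ (not_le.1 hj), chainCurve_of_lt hT θ _ (not_le.1 hi)]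
    exact analyticAt_const

theorem analyticAt_pairF_chainCurve (hN : 2 ≤ N) (hF : IsMinimalFormFactor N F) (hk : k + 2 ≤ N)
    (hq : 0 < q) (hT : T = q + 1 + k) (hθ : Generic N θ) :
    AnalyticAt ℂ (fun t => pairF F (chainCurve N k hT θ t)) (θ ⟨0, hq⟩ + ieta N) := by
  refine Finset.analyticAt_fun_prod _ fun i _ => Finset.analyticAt_fun_prod _ fun j _ => ?_
  by_cases hij : i < j
  · simp only [if_pos hij]
    exact analyticAt_F_chainCurve hN hF hk hq hT hθ hij
  · simp only [if_neg hij]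
    exact analyticAt_const

theorem PhiShape.analyticAt_of_forall_ne (hN : 2 ≤ N) (h : PhiShape N φ ψ) {z : ℂ}
    (hz : ∀ l : ℤ, z ≠ l * ieta N) : AnalyticAt ℂ φ z := by
  refine h.analyticAt ?_ ?_
  · simpa using sh_ne_zero_of_forall_ne hN hz 0
  · simpa using sh_ne_zero_of_forall_ne hN hz 1

theorem PhiShape.analyticAt_int_mul (hN : 2 ≤ N) (h : PhiShape N φ ψ) {l : ℤ}
    (h1 : ¬ (N : ℤ) ∣ l) (h2 : ¬ (N : ℤ) ∣ l + 1) : AnalyticAt ℂ φ (l * ieta N) := by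
  refine h.analyticAt (sh_int_mul_ieta_ne_zero hN h1) ?_
  have := sh_int_mul_ieta_ne_zero hN h2
  rwa [Int.cast_add, Int.cast_one, add_one_mul] at this

theorem int_not_dvd_of_pos_of_lt {a l : ℤ} (h1 : 0 < l) (h2 : l < a) : ¬ a ∣ l := fun hd => by
  have := Int.le_of_dvd h1 hd
  omega

/-- On a curve of chains, only two of the pair factors can be singular in the limit. -/
theorem analyticAt_phi_chainCurve (hN : 2 ≤ N) (h : PhiShape N φ ψ) (hk : k + 2 ≤ N)
    (hq : 0 < q) (hT : T = q + 1 + k) (hθ : Generic N θ) {i j : Fin T}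
    (hA : ¬ ((i : ℕ) = k + 1 ∧ (j : ℕ) = k))
    (hB : k + 2 = N → ¬ ((i : ℕ) = 0 ∧ (j : ℕ) = k + 1)) :
    AnalyticAt ℂ (fun t => φ (chainCurve N k hT θ t i - chainCurve N k hT θ t j))
      (θ ⟨0, hq⟩ + ieta N) := by
  have hd := differentiable_pi.1 (differentiable_chainCurve (N := N) hT θ)
  by_cases hi : (i : ℕ) ≤ k <;> by_cases hj : (j : ℕ) ≤ k
  · simp only [chainCurve_of_le hT θ _ hj, chainCurve_of_le hT θ _ hi, add_sub_add_left_eq_sub]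
    exact analyticAt_const
  · refine AnalyticAt.comp_of_eq ?_ (((hd i).sub (hd j)).analyticAt _) rfl
    rcases chainCurve_sub_cases hq hT hθ hi (not_le.1 hj) with h' | ⟨hj', h'⟩
    · exact h.analyticAt_of_forall_ne hN h'
    -- `φ` is singular at `l iη` only for `l ≡ 0` or `l ≡ -1` modulo `N`. Here `1 ≤ l ≤ k + 1 ≤ N -
    -- 1`, and `l = N - 1` would be the closing pair excluded by `hB`.
    · rw [h', ← Int.cast_natCast]
      refine h.analyticAt_int_mul hN (int_not_dvd_of_pos_of_lt ?_ ?_)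
        (int_not_dvd_of_pos_of_lt ?_ ?_)
      · omega
      · omega
      · omega
      · by_cases hkN : k + 2 = N
        · have : (i : ℕ) ≠ 0 := fun h0 => hB hkN ⟨h0, hj'⟩
          omega
        · omega
  · refine AnalyticAt.comp_of_eq ?_ (((hd i).sub (hd j)).analyticAt _) rfl
    rw [← neg_sub]
    rcases chainCurve_sub_cases hq hT hθ hj (not_le.1 hi) with h' | ⟨hi', h'⟩
    · refine h.analyticAt_of_forall_ne hN fun l he => h' (-l) ?_
      push_cast; linear_combination -he
    · rw [h', ← Int.cast_natCast, ← neg_mul, ← Int.cast_neg]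
      have : (j : ℕ) ≠ k := fun h0 => hA ⟨hi', h0⟩
      refine h.analyticAt_int_mul hN ?_ ?_
      · rw [dvd_neg]
        exact int_not_dvd_of_pos_of_lt (by omega) (by omega)
      · rw [← dvd_neg]
        exact int_not_dvd_of_pos_of_lt (by omega) (by omega)
  · simp only [chainCurve_of_lt hT θ _ (not_le.1 hj), chainCurve_of_lt hT θ _ (not_le.1 hi)]
    exact analyticAt_const

/-- The pole of the pair `(k + 1, k)`. -/
theorem hasSimplePole_phi_chainCurve_link (hN : 2 ≤ N) (h : PhiShape N φ ψ) (hq : 0 < q)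
    (hT : T = q + 1 + k) {i j : Fin T} (hi : (i : ℕ) = k + 1) (hj : (j : ℕ) = k) :
    HasSimplePole (fun t => φ (chainCurve N k hT θ t i - chainCurve N k hT θ t j))
      (θ ⟨0, hq⟩ + ieta N) (ψ 0 / (sh (ieta N) / 2)) := by
  -- The moving rapidity `t` enters with a minus sign, which reverses the sign of the residue at
  -- `-iη`.
  have h1 := (h.hasSimplePole_neg_ieta hN).comp_const_sub (θ ⟨0, hq⟩)
  rw [sub_neg_eq_add, neg_neg] at h1
  refine h1.congr (Eventually.of_forall fun t => ?_)
  simp only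
  rw [chainCurve_of_le hT θ _ hj.le, chainCurve_of_lt hT θ _ (by omega), hj]
  have : (⟨(i : ℕ) - (k + 1), by omega⟩ : Fin q) = ⟨0, hq⟩ := Fin.ext (by simp [hi])
  rw [this]
  congr 1; ring

/-- The pole of the pair `(0, N - 1)` that closes the chain. -/
theorem hasSimplePole_phi_chainCurve_close (hN : 2 ≤ N) (h : PhiShape N φ ψ)
    (hper : Function.Periodic φ (2 * Real.pi * I)) (hk : k + 2 = N) (hq : 0 < q)
    (hT : T = q + 1 + k) {i j : Fin T} (hi : (i : ℕ) = 0) (hj : (j : ℕ) = k + 1) :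
    HasSimplePole (fun t => φ (chainCurve N k hT θ t i - chainCurve N k hT θ t j))
      (θ ⟨0, hq⟩ + ieta N) (-(ψ 0 / (sh (ieta N) / 2))) := by
  -- Here `t` enters with a plus sign: the difference tends to `(N - 1) iη = -iη + 2πi`, and the
  -- residue at `-iη` keeps its sign. The sign relative to the link pole becomes the minus sign in
  -- `1 - σ ∏ S`.
  have h1 := (h.hasSimplePole_neg_ieta hN).comp_sub_const (θ ⟨0, hq⟩ + 2 * ieta N)
  rw [show -ieta N + (θ ⟨0, hq⟩ + 2 * ieta N) = θ ⟨0, hq⟩ + ieta N by ring] at h1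
  refine h1.congr (Eventually.of_forall fun t => ?_)
  simp only
  rw [chainCurve_of_le hT θ _ (by omega), chainCurve_of_lt hT θ _ (by omega), hi,
    ← hper (t - (θ ⟨0, hq⟩ + 2 * ieta N)), ← natCast_mul_ieta hN]
  have : (⟨(j : ℕ) - (k + 1), by omega⟩ : Fin q) = ⟨0, hq⟩ := Fin.ext (by simp [hj])
  rw [this]
  congr 1
  rw [← hk]; push_cast; ring

end Step

/-! ### One residue: adding a link to the chain, or closing it. -/

section Residues

variable {N : ℕ} {F φ τ κ ψ : ℂ → ℂ} {σ s : ℂ} {m : ℕ → Fin (N - 1) → ℕ}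
  {hm : ∀ n k, m (N + n) k = m n k + 1} {p : (n : ℕ) → (Fin n → ℂ) → ZVars N (m n) → ℂ}

theorem differentiable_fillMean_chainCurve (hp : IsPFunction N φ τ κ σ s m hm p) {k q T : ℕ}
    (hT : T = q + 1 + k) (θ : Fin q → ℂ) (g : Fin T → Fin N) :
    Differentiable ℂ fun t =>
      fillMean (m T) (chainCurve N k hT θ t) g (p T (chainCurve N k hT θ t)) := by
  have hc := differentiable_chainCurve (N := N) hT θ
  simp only [fillMean]
  refine Differentiable.const_mul (Differentiable.fun_sum fun ε _ => ?_) _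
  refine (hp.analytic T).comp (hc.prodMk ?_)
  exact differentiable_pi.2 fun k => differentiable_pi.2 fun j => differentiable_pi.1 hc _

theorem analyticAt_linkFactor (hN : 2 ≤ N) (h : PhiShape N φ ψ) {k q T : ℕ} (hk : k + 2 ≤ N)
    (hq : 0 < q) (hT : T = q + 1 + k) {θ : Fin q → ℂ} (hθ : Generic N θ) (ρ : ℂ)
    (L : Finset (Fin T × Fin T)) (g : Fin T → Fin N) {x : Fin T × Fin T}
    (hA : ¬ ((x.1 : ℕ) = k + 1 ∧ (x.2 : ℕ) = k))
    (hB : k + 2 = N → ¬ ((x.1 : ℕ) = 0 ∧ (x.2 : ℕ) = k + 1)) :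
    AnalyticAt ℂ (fun t => linkFactor φ ρ L g (chainCurve N k hT θ t) x)
      (θ ⟨0, hq⟩ + ieta N) := by
  unfold linkFactor
  split_ifs
  · exact analyticAt_const
  · exact analyticAt_const
  · exact analyticAt_phi_chainCurve hN h hk hq hT hθ hA hB
  · exact analyticAt_const

/-- The residue at the next link of the chain, as long as the chain does not close. -/
theorem hasSimplePole_linkedFormFactor (hN : 2 ≤ N) (hF : IsMinimalFormFactor N F)
    (h : PhiShape N φ ψ) (hp : IsPFunction N φ τ κ σ s m hm p) (c : ℕ → ℂ) {k q T : ℕ}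
    (hk : k + 2 < N) (hq : 0 < q) (hT : T = q + 1 + k) (hT' : T = q + (k + 1)) {θ : Fin q → ℂ}
    (hθ : Generic N θ) :
    HasSimplePole (fun t => linkedFormFactor F φ (ψ 0 / (sh (ieta N) / 2)) c m p (chainLinks T k)
        (chain N k (Nat.succ_pos q) hT (Fin.cons t θ)))
      (θ ⟨0, hq⟩ + ieta N)
      (linkedFormFactor F φ (ψ 0 / (sh (ieta N) / 2)) c m p (chainLinks T (k + 1))
        (chain N (k + 1) hq hT' θ)) := by
  set ρ := ψ 0 / (sh (ieta N) / 2) with hρ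
  simp only [chain_cons hT, chain_succ hq hT hT']
  simp only [linkedFormFactor]
  refine HasSimplePole.const_mul (HasSimplePole.sum _ fun g _ => ?_) _
  -- The new link, from the moving end of the chain to the first rapidity behind it; its pair factor
  -- is the only singular one.
  let A : Fin T × Fin T := (⟨k + 1, by omega⟩, ⟨k, by omega⟩)
  have hAmem : A ∉ chainLinks T k := by rw [mem_chainLinks]; simp [A]
  have hAmem' : A ∈ chainLinks T (k + 1) := by rw [mem_chainLinks]; simp [A]
  have hpole : HasSimplePole (fun t => linkFactor φ ρ (chainLinks T k) g (chainCurve N k hT θ t) A)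
      (θ ⟨0, hq⟩ + ieta N) (linkFactor φ ρ (chainLinks T (k + 1)) g
        (chainCurve N k hT θ (θ ⟨0, hq⟩ + ieta N)) A) := by
    simp only [linkFactor, if_neg hAmem, if_pos hAmem']
    split_ifs
    · exact hasSimplePole_phi_chainCurve_link hN h hq hT rfl rfl
    · exact HasSimplePole.of_analyticAt analyticAt_const
  have hrest : AnalyticAt ℂ (fun t => pairF F (chainCurve N k hT θ t) *
      fillMean (m T) (chainCurve N k hT θ t) g (p T (chainCurve N k hT θ t)) *
      ∏ x ∈ Finset.univ.erase A, linkFactor φ ρ (chainLinks T k) g (chainCurve N k hT θ t) x)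
      (θ ⟨0, hq⟩ + ieta N) := by
    refine ((analyticAt_pairF_chainCurve hN hF (by omega) hq hT hθ).mul
      ((differentiable_fillMean_chainCurve hp hT θ g).analyticAt _)).mul
      (Finset.analyticAt_fun_prod _ fun x hx => ?_)
    refine analyticAt_linkFactor hN h (by omega) hq hT hθ ρ _ g (fun hx' => ?_) (by omega)
    exact Finset.ne_of_mem_erase hx (Prod.ext (Fin.ext hx'.1) (Fin.ext hx'.2))
  have hmul := hpole.mul_analyticAt hrest
  have hsame : ∏ x ∈ Finset.univ.erase A, linkFactor φ ρ (chainLinks T k) g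
      (chainCurve N k hT θ (θ ⟨0, hq⟩ + ieta N)) x =
      ∏ x ∈ Finset.univ.erase A, linkFactor φ ρ (chainLinks T (k + 1)) g
      (chainCurve N k hT θ (θ ⟨0, hq⟩ + ieta N)) x := by
    refine Finset.prod_congr rfl fun x hx => ?_
    have hx' := Finset.ne_of_mem_erase hx
    have hiff : x ∈ chainLinks T k ↔ x ∈ chainLinks T (k + 1) := by
      rw [mem_chainLinks, mem_chainLinks]
      refine ⟨fun h => ⟨h.1, by omega⟩, fun h => ⟨h.1, ?_⟩⟩
      by_contra hgt
      exact hx' (Prod.ext (Fin.ext (by simp only [A]; omega)) (Fin.ext (by simp only [A]; omega)))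
    simp only [linkFactor, hiff]
  rw [hsame] at hmul
  rw [mul_assoc, Finset.prod_erase_mul _ _ (Finset.mem_univ A)] at hmul
  refine hmul.congr (Eventually.of_forall fun t => ?_)
  simp only
  rw [mul_assoc _ _ (linkFactor _ _ _ _ _ A), Finset.prod_erase_mul _ _ (Finset.mem_univ A)]

/-- The residue at the last link of a chain of `N` points, where the closing pair contributes,
too. -/
theorem hasSimplePole_linkedFormFactor_close (hN : 2 ≤ N) (hF : IsMinimalFormFactor N F)
    (hφ : IsPhiTauKappa N F φ τ κ)
    (h : PhiShape N φ ψ) (hp : IsPFunction N φ τ κ σ s m hm p) (c : ℕ → ℂ) {k q T : ℕ}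
    (hk : k + 2 = N) (hq : 0 < q) (hT : T = q + 1 + k) (hT' : T = q + (k + 1)) {θ : Fin q → ℂ}
    (hθ : Generic N θ) {A B : Fin T × Fin T}
    (hA : (A.1 : ℕ) = k + 1 ∧ (A.2 : ℕ) = k) (hB : (B.1 : ℕ) = 0 ∧ (B.2 : ℕ) = k + 1) :
    HasSimplePole (fun t => linkedFormFactor F φ (ψ 0 / (sh (ieta N) / 2)) c m p (chainLinks T k)
        (chain N k (Nat.succ_pos q) hT (Fin.cons t θ)))
      (θ ⟨0, hq⟩ + ieta N)
      (linkedFormFactor F φ (ψ 0 / (sh (ieta N) / 2)) c m p (insert A (chainLinks T k))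
          (chain N (k + 1) hq hT' θ) -
        linkedFormFactor F φ (ψ 0 / (sh (ieta N) / 2)) c m p (insert B (chainLinks T k))
          (chain N (k + 1) hq hT' θ)) := by
  set ρ := ψ 0 / (sh (ieta N) / 2) with hρ
  simp only [chain_cons hT, chain_succ hq hT hT']
  simp only [linkedFormFactor]
  rw [← mul_sub, ← Finset.sum_sub_distrib]
  refine HasSimplePole.const_mul (HasSimplePole.sum _ fun g _ => ?_) _
  set L := chainLinks T k with hL
  set Θ := chainCurve N k hT θ with hΘ
  set t₀ := θ ⟨0, hq⟩ + ieta N with ht₀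
  have hAB : A ≠ B := fun he => by rw [he, hB.1] at hA; omega
  have hAL : A ∉ L := by rw [hL, mem_chainLinks]; omega
  have hBL : B ∉ L := by rw [hL, mem_chainLinks]; omega
  have hBe : B ∈ (Finset.univ : Finset (Fin T × Fin T)).erase A :=
    Finset.mem_erase.2 ⟨hAB.symm, Finset.mem_univ _⟩
  have hsplit : ∀ (L' : Finset (Fin T × Fin T)) (Θ' : Fin T → ℂ),
      ∏ x, linkFactor φ ρ L' g Θ' x = (∏ x ∈ (Finset.univ.erase A).erase B,
        linkFactor φ ρ L' g Θ' x) * (linkFactor φ ρ L' g Θ' B * linkFactor φ ρ L' g Θ' A) := by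
    intro L' Θ'
    rw [← Finset.prod_erase_mul _ _ (Finset.mem_univ A), ← Finset.prod_erase_mul _ _ hBe, mul_assoc]
  have hsame : ∀ (C : Fin T × Fin T) (Θ' : Fin T → ℂ), C = A ∨ C = B →
      ∏ x ∈ (Finset.univ.erase A).erase B, linkFactor φ ρ (insert C L) g Θ' x =
      ∏ x ∈ (Finset.univ.erase A).erase B, linkFactor φ ρ L g Θ' x := by
    intro C Θ' hC
    refine Finset.prod_congr rfl fun x hx => ?_
    have hx1 := Finset.ne_of_mem_erase hx
    have hx2 := Finset.ne_of_mem_erase (Finset.mem_of_mem_erase hx)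
    have hne : x ≠ C := by rcases hC with rfl | rfl <;> assumption
    simp only [linkFactor, Finset.mem_insert, hne, false_or]
  have hrest : AnalyticAt ℂ (fun t => pairF F (Θ t) * fillMean (m T) (Θ t) g (p T (Θ t)) *
      ∏ x ∈ (Finset.univ.erase A).erase B, linkFactor φ ρ L g (Θ t) x) t₀ := by
    refine ((analyticAt_pairF_chainCurve hN hF (by omega) hq hT hθ).mul
      ((differentiable_fillMean_chainCurve hp hT θ g).analyticAt _)).mul
      (Finset.analyticAt_fun_prod _ fun x hx => ?_)
    refine analyticAt_linkFactor hN h (by omega) hq hT hθ ρ _ g (fun hx' => ?_) fun _ hx' => ?_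
    · exact Finset.ne_of_mem_erase (Finset.mem_of_mem_erase hx)
        (Prod.ext (Fin.ext (hx'.1.trans hA.1.symm)) (Fin.ext (hx'.2.trans hA.2.symm)))
    · exact Finset.ne_of_mem_erase hx
        (Prod.ext (Fin.ext (hx'.1.trans hB.1.symm)) (Fin.ext (hx'.2.trans hB.2.symm)))
  -- Both poles at once would need colours that increase all the way around the cycle of chain
  -- points. Then an earlier link must be violated and its factor vanishes, so no double pole
  -- arises.
  by_cases hboth : g A.2 < g A.1 ∧ g B.2 < g B.1
  · have hzero : ∀ Θ' : Fin T → ℂ, ∏ x ∈ (Finset.univ.erase A).erase B,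
        linkFactor φ ρ L g Θ' x = 0 := by
      intro Θ'
      have hAB2 : A.1 = B.2 := Fin.ext (hA.1.trans hB.2.symm)
      by_contra hne
      have hlink : ∀ i : ℕ, (hi : i ≤ k) → g B.1 ≤ g ⟨i, by omega⟩ := by
        intro i
        induction i with
        | zero =>
          intro _
          exact le_of_eq (congrArg g (Fin.ext hB.1))
        | succ i ih =>
          intro hi
          let x : Fin T × Fin T := (⟨i + 1, by omega⟩, ⟨i, by omega⟩)
          have hxL : x ∈ L := by rw [hL, mem_chainLinks]; simp [x, hi]
          have hxe : x ∈ (Finset.univ.erase A).erase B := by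
            refine Finset.mem_erase.2 ⟨?_, Finset.mem_erase.2 ⟨?_, Finset.mem_univ _⟩⟩
            · exact fun he => hBL (by rw [← he]; exact hxL)
            · exact fun he => hAL (by rw [← he]; exact hxL)
          have hfx := Finset.prod_ne_zero_iff.1 hne x hxe
          simp only [linkFactor, if_pos hxL] at hfx
          have hlt : g x.2 < g x.1 := by
            by_contra hnot
            exact hfx (if_neg hnot)
          exact (ih (by omega)).trans hlt.le
      have h1 := hlink k le_rfl
      have h2 : (⟨k, by omega⟩ : Fin T) = A.2 := Fin.ext hA.2.symm
      rw [h2] at h1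
      have h3 := hboth.2
      rw [← hAB2] at h3
      exact absurd (h1.trans_lt hboth.1) h3.not_gt
    simp only [hsplit, hsame A _ (Or.inl rfl), hsame B _ (Or.inr rfl), hzero, zero_mul, mul_zero,
      sub_zero]
    exact HasSimplePole.of_analyticAt analyticAt_const
  -- At most one of the two factors is a `φ`; the other is `1`, so the pole is simple.
  have hpole : HasSimplePole (fun t => linkFactor φ ρ L g (Θ t) B * linkFactor φ ρ L g (Θ t) A)
      t₀ (linkFactor φ ρ (insert A L) g (Θ t₀) B * linkFactor φ ρ (insert A L) g (Θ t₀) A -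
        linkFactor φ ρ (insert B L) g (Θ t₀) B * linkFactor φ ρ (insert B L) g (Θ t₀) A) := by
    have m1 : A ∈ insert A L := Finset.mem_insert_self _ _
    have m2 : B ∈ insert B L := Finset.mem_insert_self _ _
    have m3 : B ∉ insert A L := by simp [hAB.symm, hBL]
    have m4 : A ∉ insert B L := by simp [hAB, hAL]
    simp only [linkFactor, if_neg hAL, if_neg hBL, if_pos m1, if_pos m2, if_neg m3, if_neg m4]
    by_cases hgA : g A.2 < g A.1
    · have hgB : ¬ g B.2 < g B.1 := fun hgB => hboth ⟨hgA, hgB⟩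
      simp only [if_pos hgA, if_neg hgB, one_mul, zero_mul, sub_zero]
      exact hasSimplePole_phi_chainCurve_link hN h hq hT hA.1 hA.2
    · by_cases hgB : g B.2 < g B.1
      · simp only [if_neg hgA, if_pos hgB, mul_one, mul_zero, zero_sub]
        exact hasSimplePole_phi_chainCurve_close hN h hφ.periodic_phi hk hq hT hB.1 hB.2
      · simp only [if_neg hgA, if_neg hgB, mul_one, mul_zero, sub_zero]
        exact HasSimplePole.of_analyticAt analyticAt_const
  have hmul := hpole.mul_analyticAt hrest
  simp only [hsplit, hsame A _ (Or.inl rfl), hsame B _ (Or.inr rfl)]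
  simp only [mul_sub, ← mul_assoc] at hmul ⊢
  exact hmul

end Residues

/-! ### Evaluation of the residue on a closed chain -/

/-- There are `N - d` pairs at distance `d`. -/
theorem prod_fin_lt_eq_prod_pow (w : ℕ → ℂ) (N : ℕ) :
    (∏ i : Fin N, ∏ j : Fin N, if j < i then w (i - j) else 1) =
      ∏ d ∈ Finset.Icc 1 (N - 1), w d ^ (N - d) := by
  have hr : ∀ M, ∏ d ∈ Finset.Icc 1 M, w d ^ (N - d) =
      ∏ d ∈ Finset.range M, w (d + 1) ^ (N - (d + 1)) := by
    intro M
    rw [Finset.range_eq_Ico, Finset.prod_Ico_add' (fun d => w d ^ (N - d)) 0 M 1]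
    rfl
  rw [hr]
  clear hr
  induction N with
  | zero => simp
  | succ N ih =>
    have h1 : (∏ i : Fin (N + 1), ∏ j : Fin (N + 1), if j < i then w (i - j) else 1) =
        (∏ i : Fin N, ∏ j : Fin N, if j < i then w (i - j) else 1) *
          ∏ d ∈ Finset.range N, w (d + 1) := by
      have hl : ∀ i : Fin N, ¬ Fin.last N < i.castSucc := fun i => (Fin.castSucc_lt_last i).not_gt
      rw [Fin.prod_univ_castSucc]
      simp only [Fin.prod_univ_castSucc, hl, if_false, mul_one, Fin.castSucc_lt_castSucc_iff,
        Fin.castSucc_lt_last, if_true, lt_irrefl, Fin.val_castSucc, Fin.val_last]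
      congr 1
      rw [← Finset.prod_range_reflect, Finset.prod_range]
      refine Finset.prod_congr rfl fun i _ => ?_
      congr 1
      omega
    rw [h1, ih, Nat.add_sub_cancel]
    have h2 : ∏ d ∈ Finset.range (N - 1), w (d + 1) ^ (N - (d + 1)) =
        ∏ d ∈ Finset.range N, w (d + 1) ^ (N - (d + 1)) := by
      rcases N with _ | N
      · simp
      · rw [Finset.prod_range_succ]; simp
    rw [h2, ← Finset.prod_mul_distrib]
    refine Finset.prod_congr rfl fun d hd => ?_
    have := Finset.mem_range.1 hd
    rw [← pow_succ]
    congr 1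
    omega

theorem prod_range_skip (f : ℕ → ℂ) {c M : ℕ} (hc : c ≤ M) :
    (∏ r ∈ Finset.range (M + 1),
      (if r < c then f r else 1) * if c < r then f (r - 1) else 1) =
      ∏ k ∈ Finset.range M, f k := by
  induction M with
  | zero =>
    obtain rfl : c = 0 := by omega
    simp
  | succ M ih =>
    rw [Finset.prod_range_succ]
    rcases hc.lt_or_eq with h | rfl
    · rw [ih (by omega), Finset.prod_range_succ, if_neg (by omega), if_pos h]
      simp
    · rw [if_neg (lt_irrefl _), if_neg (lt_irrefl _), one_mul, mul_one]
      refine Finset.prod_congr rfl fun r hr => ?_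
      have := Finset.mem_range.1 hr
      rw [if_pos this, if_neg (by omega), mul_one]

/-- Colours above `c` supply the indices `0, …, N - 2 - c`, colours below `c` supply `N - 1 - c, …,
N - 2`; omitting `c` and lowering the latter by one leaves no gap. For this reason the weight
between a full chain and a free rapidity does not depend on the colour `c` of the latter. -/
theorem prod_fin_skip {N : ℕ} (v : Equiv.Perm (Fin N)) (f : ℕ → ℂ) (c : Fin N) :
    (∏ i, (if c < v i then f (N - 1 - v i) else 1) * if v i < c then f (N - 2 - v i) else 1) =
      ∏ k ∈ Finset.range (N - 1), f k := by
  rw [Equiv.prod_comp v fun a : Fin N =>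
    (if c < a then f (N - 1 - a) else 1) * if a < c then f (N - 2 - a) else 1]
  obtain ⟨M, rfl⟩ : ∃ M, N = M + 1 := ⟨N - 1, by have := c.2; omega⟩
  rw [Nat.add_sub_cancel, ← prod_range_skip f (c := M - c) (by omega), Finset.prod_range,
    ← Equiv.prod_comp Fin.revPerm]
  refine Finset.prod_congr rfl fun a _ => ?_
  have hc := c.2
  have ha := a.2
  simp only [Fin.revPerm_apply, Fin.lt_def, Fin.val_rev]
  congr 1
  · by_cases h : (a : ℕ) < M - c
    · rw [if_pos h, if_pos (by omega)]
      congr 1; omega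
    · rw [if_neg h, if_neg (by omega)]
  · by_cases h : M - (c : ℕ) < a
    · rw [if_pos h, if_pos (by omega)]
      congr 1; omega
    · rw [if_neg h, if_neg (by omega)]

/-- Climbing from the bottom gives `a ≤ u a`, descending from the top gives `u a ≤ a`. Hence `N`
linked points have no freedom of colouring. -/
theorem eq_id_of_forall_lt {N : ℕ} {u : Fin N → Fin N}
    (h : ∀ i j : Fin N, (i : ℕ) = j + 1 → u j < u i) : u = id := by
  have h1 : ∀ a : ℕ, ∀ ha : a < N, a ≤ (u ⟨a, ha⟩ : ℕ) := by
    intro a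
    induction a with
    | zero => intro _; omega
    | succ a ih =>
      intro ha
      have h2 := ih (by omega)
      have h3 := Fin.lt_def.1 (h ⟨a + 1, ha⟩ ⟨a, by omega⟩ rfl)
      omega
  have h2 : ∀ b : ℕ, ∀ hb : b < N, (u ⟨N - 1 - b, by omega⟩ : ℕ) ≤ N - 1 - b := by
    intro b
    induction b with
    | zero => intro _; omega
    | succ b ih =>
      intro hb
      have h2 := ih (by omega)
      have h3 := Fin.lt_def.1 (h ⟨N - 1 - b, by omega⟩ ⟨N - 1 - (b + 1), by omega⟩
        (by simp only; omega))
      omega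
  funext i
  refine Fin.ext (le_antisymm ?_ (h1 i i.2))
  have h3 := h2 (N - 1 - i) (by omega)
  have h4 : N - 1 - (N - 1 - (i : ℕ)) = i := by omega
  simp only [h4] at h3
  exact h3

/-- A nonempty set of fillings has `∏ m_k!` elements, so `fillMean` is a genuine mean. -/
theorem fillMean_eq_of_forall {N n : ℕ} {m : Fin (N - 1) → ℕ} {θ : Fin n → ℂ} {g : Fin n → Fin N}
    {G : ZVars N m → ℂ} {C : ℂ} (hne : Nonempty (Filling m g))
    (hG : ∀ ε : Filling m g, G (fillVars θ ε) = C) : fillMean m θ g G = C := by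
  obtain ⟨ε⟩ := hne
  have hcard : (Fintype.card (Filling m g) : ℂ) = ∏ k, ((m k).factorial : ℂ) := by
    rw [Fintype.card_pi, Nat.cast_prod]
    refine Finset.prod_congr rfl fun k _ => ?_
    rw [Fintype.card_equiv (ε k), Fintype.card_fin]
  have h0 : ∏ k, ((m k).factorial : ℂ) ≠ 0 :=
    Finset.prod_ne_zero_iff.2 fun k _ => Nat.cast_ne_zero.2 (Nat.factorial_ne_zero _)
  rw [fillMean, Finset.sum_congr rfl fun ε _ => hG ε, Finset.sum_const, Finset.card_univ,
    nsmul_eq_mul, hcard, Finset.prod_inv_distrib, inv_mul_cancel_left₀ h0]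

/-- The points of a colour, if a chain with one point of each colour is prepended. -/
def appendColorEquiv {N n : ℕ} (v : Equiv.Perm (Fin N)) (g : Fin n → Fin N) (k : Fin (N - 1)) :
    Option {f : Fin n // (g f : ℕ) = k + 1} ≃
      {i : Fin (N + n) // ((Fin.append v g i : Fin N) : ℕ) = k + 1} :=
  Equiv.ofBijective
    (fun o => match o with
      | none => ⟨Fin.castAdd n (v.symm ⟨k + 1, by omega⟩), by simp⟩
      | some f => ⟨Fin.natAdd N f.1, by simp [f.2]⟩) <| by
    constructor
    · rintro (_ | f) (_ | f') he
      · rfl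
      · have := Fin.ext_iff.1 (Subtype.ext_iff.1 he)
        simp only [Fin.val_castAdd, Fin.val_natAdd] at this
        omega
      · have := Fin.ext_iff.1 (Subtype.ext_iff.1 he)
        simp only [Fin.val_castAdd, Fin.val_natAdd] at this
        omega
      · have := Fin.ext_iff.1 (Subtype.ext_iff.1 he)
        simp only [Fin.val_natAdd] at this
        exact congrArg some (Subtype.ext (Fin.ext (by omega)))
    · rintro ⟨i, hi⟩
      revert hi
      refine Fin.addCases (fun a => ?_) (fun f => ?_) i
      · intro hi
        refine ⟨none, Subtype.ext ?_⟩
        simp only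
        congr 1
        rw [Equiv.symm_apply_eq]
        exact Fin.ext (by simpa using hi.symm)
      · intro hi
        exact ⟨some ⟨f, by simpa using hi⟩, rfl⟩

@[simp]
theorem appendColorEquiv_none {N n : ℕ} (v : Equiv.Perm (Fin N)) (g : Fin n → Fin N)
    (k : Fin (N - 1)) :
    (appendColorEquiv v g k none).1 = Fin.castAdd n (v.symm ⟨k + 1, by omega⟩) := rfl

@[simp]
theorem appendColorEquiv_some {N n : ℕ} (v : Equiv.Perm (Fin N)) (g : Fin n → Fin N)
    (k : Fin (N - 1)) (f : {f : Fin n // (g f : ℕ) = k + 1}) :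
    (appendColorEquiv v g k (some f)).1 = Fin.natAdd N f.1 := rfl

/-! ### Colourings of a linked chain of `N` points followed by free rapidities. -/

section Chain

variable {N : ℕ} {F φ τ κ ψ : ℂ → ℂ} {σ s : ℂ} {m : ℕ → Fin (N - 1) → ℕ}
  {hm : ∀ n k, m (N + n) k = m n k + 1} {p : (n : ℕ) → (Fin n → ℂ) → ZVars N (m n) → ℂ}

/-- The new variable `z_{k1}` goes to the chain point of its colour, and the old variables move up
by one index. -/
theorem exists_filling_append (hm : ∀ n k, m (N + n) k = m n k + 1) {n : ℕ}
    (v : Equiv.Perm (Fin N)) (g : Fin n → Fin N) (Θ : Fin (N + n) → ℂ) (ε : Filling (m n) g) :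
    ∃ ε' : Filling (m (N + n)) (Fin.append v g), fillVars Θ ε' =
      prepend (hm n) (fun k => Θ (Fin.castAdd n (v.symm ⟨k + 1, by omega⟩)))
        (fillVars (fun f => Θ (Fin.natAdd N f)) ε) := by
  refine ⟨fun k => (finCongr (hm n k)).trans ((finSuccEquiv _).trans
    ((Equiv.optionCongr (ε k)).trans (appendColorEquiv v g k))), ?_⟩
  funext k j
  simp only [fillVars, prepend, Equiv.trans_apply, finCongr_apply]
  refine Fin.cases ?_ (fun j => ?_) (Fin.cast (hm n k) j)
  · simp
  · simp [fillVars]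

/-- Two fillings of one colouring differ by permutations within the colours, under which `p` is
invariant. So the mean may be computed with every `z_{k1}` on the chain. -/
theorem fillMean_append (hp : IsPFunction N φ τ κ σ s m hm p) {n : ℕ} (v : Equiv.Perm (Fin N))
    (g : Fin n → Fin N) (Θ : Fin (N + n) → ℂ) :
    fillMean (m (N + n)) Θ (Fin.append v g) (p (N + n) Θ) =
      fillMean (m n) (fun f => Θ (Fin.natAdd N f)) g fun z => p (N + n) Θ
        (prepend (hm n) (fun k => Θ (Fin.castAdd n (v.symm ⟨k + 1, by omega⟩))) z) := by
  by_cases hne : Nonempty (Filling (m n) g)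
  · obtain ⟨ε⟩ := id hne
    obtain ⟨ε', _⟩ := exists_filling_append hm v g Θ ε
    have hall : ∀ ε₁ : Filling (m (N + n)) (Fin.append v g),
        p (N + n) Θ (fillVars Θ ε₁) = p (N + n) Θ (fillVars Θ ε') := by
      intro ε₁
      rw [← hp.symm_z_all Θ (fillVars Θ ε') fun k => (ε₁ k).trans (ε' k).symm]
      congr 1
      funext k j
      simp [fillVars]
    rw [fillMean_eq_of_forall ⟨ε'⟩ hall, fillMean_eq_of_forall hne]
    intro ε₂
    obtain ⟨ε₃, h₃⟩ := exists_filling_append hm v g Θ ε₂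
    rw [← h₃, hall]
  -- Each colour class gains one point, as `m` does, so fillings exist on both sides or on neither.
  · have hne' : ¬ Nonempty (Filling (m (N + n)) (Fin.append v g)) := by
      rintro ⟨ε⟩
      refine hne ⟨fun k => Fintype.equivOfCardEq ?_⟩
      have h1 := Fintype.card_congr (ε k)
      rw [← Fintype.card_congr (appendColorEquiv v g k), Fintype.card_option, Fintype.card_fin,
        hm] at h1
      rw [Fintype.card_fin]
      omega
    rw [not_nonempty_iff] at hne hne'
    simp [fillMean]

/-- Pairs inside the chain have a weight that depends only on the difference of colours. Pairs of a
chain point and a free rapidity are brought to one form by `φ(-z) = φ(z - iη)` and combined by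
`prod_fin_skip`. Pairs of free rapidities give their own weight. Positions matter only modulo `2πi`,
which lets the rotated chain be treated as well. -/
theorem prod_linkFactor_append (hφ : IsPhiTauKappa N F φ τ κ) (h : PhiShape N φ ψ) {n : ℕ}
    (ρ y : ℂ) (v : Equiv.Perm (Fin N)) (g : Fin n → Fin N) {Θ : Fin (N + n) → ℂ}
    {L : Finset (Fin (N + n) × Fin (N + n))}
    (hL : ∀ i j, (Fin.castAdd n i, Fin.castAdd n j) ∈ L ↔ (v i : ℕ) = v j + 1)
    (hL1 : ∀ i f, (i, Fin.natAdd N f) ∉ L) (hL2 : ∀ f i, (Fin.natAdd N f, i) ∉ L)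
    (hΘ : ∀ i : Fin N, ∃ l : ℤ,
      Θ (Fin.castAdd n i) = y + ((N : ℂ) - 1 - v i) * ieta N + l * (2 * Real.pi * I)) :
    ∏ x, linkFactor φ ρ L (Fin.append v g) Θ x =
      (∏ d ∈ Finset.Icc 1 (N - 1), (if d = 1 then ρ else φ (-(d * ieta N))) ^ (N - d)) *
        (∏ f, ∏ k ∈ Finset.range (N - 1), φ (y - Θ (Fin.natAdd N f) + k * ieta N)) *
        pairWeight φ (fun f => Θ (Fin.natAdd N f)) g := by
  have hper : ∀ (z : ℂ) (l : ℤ), φ (z + l * (2 * Real.pi * I)) = φ z := fun z l =>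
    hφ.periodic_phi.int_mul l z
  choose l hl using hΘ
  rw [Fintype.prod_prod_type, Fin.prod_univ_add]
  simp only [Fin.prod_univ_add, Finset.prod_mul_distrib]
  have hcc : ∏ i : Fin N, ∏ j : Fin N,
      linkFactor φ ρ L (Fin.append v g) Θ (Fin.castAdd n i, Fin.castAdd n j) =
      ∏ d ∈ Finset.Icc 1 (N - 1), (if d = 1 then ρ else φ (-(d * ieta N))) ^ (N - d) := by
    rw [← prod_fin_lt_eq_prod_pow (fun d => if d = 1 then ρ else φ (-(d * ieta N))) N]
    refine Fintype.prod_equiv v _ _ fun i => Fintype.prod_equiv v _ _ fun j => ?_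
    simp only [linkFactor, hL, Fin.append_left]
    by_cases hlt : v j < v i
    · have hlt' := Fin.lt_def.1 hlt
      simp only [if_pos hlt]
      by_cases h1 : (v i : ℕ) = v j + 1
      · rw [if_pos h1, if_pos (by omega)]
      · rw [if_neg h1, if_neg (by omega), hl, hl, Nat.cast_sub hlt'.le,
          ← hper (-(((v i : ℕ) - (v j : ℕ) : ℂ) * ieta N)) (l i - l j)]
        congr 1
        push_cast; ring
    · have hlt' := mt Fin.lt_def.2 hlt
      rw [if_neg hlt, if_neg (by omega), if_neg hlt, if_neg hlt]
  have hmix : (∏ i : Fin N, ∏ f : Fin n,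
        linkFactor φ ρ L (Fin.append v g) Θ (Fin.castAdd n i, Fin.natAdd N f)) *
      ∏ f : Fin n, ∏ i : Fin N,
        linkFactor φ ρ L (Fin.append v g) Θ (Fin.natAdd N f, Fin.castAdd n i) =
      ∏ f, ∏ k ∈ Finset.range (N - 1), φ (y - Θ (Fin.natAdd N f) + k * ieta N) := by
    rw [Finset.prod_comm, ← Finset.prod_mul_distrib]
    refine Finset.prod_congr rfl fun f _ => ?_
    rw [← Finset.prod_mul_distrib,
      ← prod_fin_skip v (fun k => φ (y - Θ (Fin.natAdd N f) + k * ieta N)) (g f)]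
    refine Finset.prod_congr rfl fun i _ => ?_
    simp only [linkFactor, hL1, hL2, if_false, Fin.append_left, Fin.append_right]
    have hi := (v i).2
    congr 1
    · split_ifs with hlt
      · rw [hl, Nat.cast_sub (by omega), Nat.cast_sub (by omega),
          ← hper (y - Θ (Fin.natAdd N f) + _) (l i)]
        congr 1
        push_cast; ring
      · rfl
    · split_ifs with hlt
      · have hlt' := Fin.lt_def.1 hlt
        have hg := (g f).2
        rw [hl, ← neg_sub, h.apply_neg, Nat.cast_sub (by omega), Nat.cast_sub (by omega),
          ← hper (y - Θ (Fin.natAdd N f) + _) (l i)]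
        congr 1
        push_cast; ring
      · rfl
  have hff : ∏ f : Fin n, ∏ f' : Fin n,
      linkFactor φ ρ L (Fin.append v g) Θ (Fin.natAdd N f, Fin.natAdd N f') =
      pairWeight φ (fun f => Θ (Fin.natAdd N f)) g := by
    simp only [linkFactor, hL1, if_false, Fin.append_right, pairWeight]
  rw [← hcc, ← hmix, ← hff]
  ring

/-- If no link factor vanished, `u ∘ v⁻¹` would be strictly increasing, hence the identity. -/
theorem prod_linkFactor_eq_zero {n : ℕ} {v : Equiv.Perm (Fin N)} {u : Fin N → Fin N} (hu : u ≠ v)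
    (ρ : ℂ) (g : Fin n → Fin N) (Θ : Fin (N + n) → ℂ) {L : Finset (Fin (N + n) × Fin (N + n))}
    (hL : ∀ i j, (Fin.castAdd n i, Fin.castAdd n j) ∈ L ↔ (v i : ℕ) = v j + 1) :
    ∏ x, linkFactor φ ρ L (Fin.append u g) Θ x = 0 := by
  by_contra hne
  refine hu ?_
  have hid : u ∘ v.symm = id := by
    refine eq_id_of_forall_lt fun i j hij => ?_
    have hmem : (Fin.castAdd n (v.symm i), Fin.castAdd n (v.symm j)) ∈ L :=
      (hL _ _).2 (by simpa using hij)
    have hx := Finset.prod_ne_zero_iff.1 hne _ (Finset.mem_univ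
      (Fin.castAdd n (v.symm i), Fin.castAdd n (v.symm j)))
    simp only [linkFactor, if_pos hmem, Fin.append_left] at hx
    by_contra hnot
    exact hx (if_neg hnot)
  funext i
  have := congrFun hid (v i)
  simpa using this

/-- The form factor with a chain of `N` linked points in the order of colours `v`. -/
theorem linkedFormFactor_chain (hφ : IsPhiTauKappa N F φ τ κ) (h : PhiShape N φ ψ)
    (hp : IsPFunction N φ τ κ σ s m hm p) (c : ℕ → ℂ) {n : ℕ}
    (ρ y : ℂ) (v : Equiv.Perm (Fin N)) {Θ : Fin (N + n) → ℂ}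
    {L : Finset (Fin (N + n) × Fin (N + n))}
    (hL : ∀ i j, (Fin.castAdd n i, Fin.castAdd n j) ∈ L ↔ (v i : ℕ) = v j + 1)
    (hL1 : ∀ i f, (i, Fin.natAdd N f) ∉ L) (hL2 : ∀ f i, (Fin.natAdd N f, i) ∉ L)
    (hΘ : ∀ i : Fin N, ∃ l : ℤ,
      Θ (Fin.castAdd n i) = y + ((N : ℂ) - 1 - v i) * ieta N + l * (2 * Real.pi * I)) :
    linkedFormFactor F φ ρ c m p L Θ = c (N + n) * pairF F Θ *
      ((∏ d ∈ Finset.Icc 1 (N - 1), (if d = 1 then ρ else φ (-(d * ieta N))) ^ (N - d)) *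
        (∏ f, ∏ k ∈ Finset.range (N - 1), φ (y - Θ (Fin.natAdd N f) + k * ieta N))) *
        colorSum φ (m n) (fun f => Θ (Fin.natAdd N f)) fun z => p (N + n) Θ
          (prepend (hm n) (fun k => Θ (Fin.castAdd n (v.symm ⟨k + 1, by omega⟩))) z) := by
  rw [linkedFormFactor, ← Equiv.sum_comp (Fin.appendEquiv N n), Fintype.sum_prod_type,
    Finset.sum_eq_single (v : Fin N → Fin N)]
  · simp only [Fin.appendEquiv, Equiv.coe_fn_mk,
      prod_linkFactor_append hφ h ρ y v _ hL hL1 hL2 hΘ, fillMean_append hp]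
    rw [colorSum, Finset.mul_sum, Finset.mul_sum]
    refine Finset.sum_congr rfl fun g _ => ?_
    ring
  · intro u _ hu
    refine Finset.sum_eq_zero fun g _ => ?_
    simp only [Fin.appendEquiv, Equiv.coe_fn_mk, prod_linkFactor_eq_zero hu ρ g Θ hL, mul_zero]
  · simp

theorem pairF_append {n : ℕ} (F : ℂ → ℂ) (x : ℂ) {Θ : Fin (N + n) → ℂ}
    (hΘ : ∀ i : Fin N, Θ (Fin.castAdd n i) = x + ((N : ℂ) - 1 - i) * ieta N) :
    pairF F Θ = (∏ d ∈ Finset.Icc 1 (N - 1), F (d * ieta N) ^ (N - d)) *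
      (∏ f, ∏ k ∈ Finset.range N, F (x - Θ (Fin.natAdd N f) + k * ieta N)) *
      pairF F fun f => Θ (Fin.natAdd N f) := by
  have hlt : ∀ (i : Fin N) (f : Fin n), Fin.castAdd n i < Fin.natAdd N f := fun i f => by
    rw [Fin.lt_def, Fin.val_castAdd, Fin.val_natAdd]; omega
  have hlt₁ : ∀ i j : Fin N, Fin.castAdd n i < Fin.castAdd n j ↔ i < j := fun i j => Iff.rfl
  have hlt₂ : ∀ f f' : Fin n, Fin.natAdd N f < Fin.natAdd N f' ↔ f < f' := fun f f' => by
    simp only [Fin.lt_def, Fin.val_natAdd]; omega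
  rw [pairF, Fin.prod_univ_add]
  simp only [Fin.prod_univ_add, Finset.prod_mul_distrib, hlt, hlt₁, hlt₂, (hlt _ _).not_gt,
    if_true, if_false, Finset.prod_const_one, one_mul]
  rw [pairF]
  congr 2
  · rw [← prod_fin_lt_eq_prod_pow (fun d => F (d * ieta N)) N, Finset.prod_comm]
    refine Finset.prod_congr rfl fun i _ => Finset.prod_congr rfl fun j _ => ?_
    by_cases hij : j < i
    · rw [if_pos hij, if_pos hij, hΘ, hΘ, Nat.cast_sub (Fin.lt_def.1 hij).le]
      congr 1; ring
    · rw [if_neg hij, if_neg hij]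
  · rw [Finset.prod_comm]
    refine Finset.prod_congr rfl fun f _ => ?_
    rw [← Finset.prod_range_reflect, Finset.prod_range]
    refine Finset.prod_congr rfl fun i _ => ?_
    have hi := i.2
    rw [hΘ, Nat.cast_sub (show (i : ℕ) ≤ N - 1 by omega), Nat.cast_sub (show 1 ≤ N by omega)]
    congr 1; push_cast; ring

/-- Adjacent colours give the `N - 1` residues; the other factors are rewritten by `φ(-d iη) = φ((N
- d) iη)` into the form used in `NormRecursion`. -/
theorem prod_chainWeight (hN : 2 ≤ N) (hφ : IsPhiTauKappa N F φ τ κ) (ρ : ℂ) :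
    ∏ d ∈ Finset.Icc 1 (N - 1), (if d = 1 then ρ else φ (-(d * ieta N))) ^ (N - d) =
      ρ ^ (N - 1) * ∏ k ∈ Finset.Icc 1 (N - 2), φ (k * ieta N) ^ k := by
  have h1 : Finset.Icc 1 (N - 1) = insert 1 (Finset.Icc 2 (N - 1)) := by
    ext d; simp only [Finset.mem_Icc, Finset.mem_insert]; omega
  rw [h1, Finset.prod_insert (by simp), if_pos rfl]
  congr 1
  refine Finset.prod_nbij' (fun d => N - d) (fun k => N - k) ?_ ?_ ?_ ?_ ?_
  · intro d hd; simp only [Finset.mem_Icc] at hd ⊢; omega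
  · intro d hd; simp only [Finset.mem_Icc] at hd ⊢; omega
  · intro d hd; simp only [Finset.mem_Icc] at hd; omega
  · intro d hd; simp only [Finset.mem_Icc] at hd; omega
  · intro d hd
    simp only [Finset.mem_Icc] at hd
    rw [if_neg (by omega), ← hφ.periodic_phi, ← natCast_mul_ieta hN, Nat.cast_sub (by omega)]
    congr 2; ring

/-- The two products differ only at their ends: `φ(u + (N - 1) iη) = φ(u - iη) = φ(u) S(u)` takes
the place of `φ(u)`. -/
theorem prod_phi_add_ieta (hN : 2 ≤ N) (hφ : IsPhiTauKappa N F φ τ κ) (h : PhiShape N φ ψ) {u : ℂ}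
    (hu : ∀ l : ℤ, u ≠ l * ieta N) :
    ∏ k ∈ Finset.range (N - 1), φ (u + ieta N + k * ieta N) =
      (∏ k ∈ Finset.range (N - 1), φ (u + k * ieta N)) * S N u := by
  have h0 : sh u ≠ 0 := by simpa using sh_ne_zero_of_forall_ne hN hu 0
  have h1 : sh (u + ieta N) ≠ 0 := by simpa using sh_ne_zero_of_forall_ne hN hu 1
  have h2 := Finset.prod_range_succ (fun k : ℕ => φ (u + k * ieta N)) (N - 1)
  rw [Finset.prod_range_succ', hφ.phi_add_pred_mul hN, h.apply_sub h1] at h2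
  have h3 : ∀ k : ℕ, u + ieta N + k * ieta N = u + ((k + 1 : ℕ) : ℂ) * ieta N := fun k => by
    push_cast; ring
  simp only [h3]
  refine mul_right_cancel₀ (h.apply_ne_zero h0 h1) ?_
  rw [Nat.cast_zero, zero_mul, add_zero] at h2
  rw [h2]; ring

theorem colorSum_add {n : ℕ} (m : Fin (N - 1) → ℕ) (θ : Fin n → ℂ) (G H : ZVars N m → ℂ) :
    colorSum φ m θ (fun z => G z + H z) = colorSum φ m θ G + colorSum φ m θ H := by
  simp only [colorSum, fillMean, Finset.sum_add_distrib, mul_add]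

theorem colorSum_const_mul {n : ℕ} (m : Fin (N - 1) → ℕ) (θ : Fin n → ℂ) (a : ℂ)
    (G : ZVars N m → ℂ) : colorSum φ m θ (fun z => a * G z) = a * colorSum φ m θ G := by
  simp only [colorSum, fillMean, ← Finset.mul_sum]
  rw [Finset.mul_sum]
  refine Finset.sum_congr rfl fun g _ => ?_
  ring

theorem Generic.regular {n : ℕ} {θ : Fin n → ℂ} (hN : 2 ≤ N) (hθ : Generic N θ) :
    Regular N θ := by
  intro i j hij l
  have h1 := natCast_mul_ieta hN
  refine ⟨fun he => hθ i j hij (l * N) ?_, fun he => hθ i j hij (1 + l * N) ?_⟩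
  · rw [he, ← ieta, ← h1]; push_cast; ring
  · rw [he, ← ieta, ← h1]; push_cast; ring

/-- The recursion for the p-functions, after summation. -/
theorem colorSum_recursion (hN : 2 ≤ N) (hσ : σ ≠ 0) (hφ : IsPhiTauKappa N F φ τ κ)
    (h : PhiShape N φ ψ) (hp : IsPFunction N φ τ κ σ s m hm p) {n : ℕ} {Θ : Fin (N + n) → ℂ}
    (hΘ : ∀ k, lower Θ k - upper Θ k = I * eta N)
    (hreg : Regular N fun f => Θ (Fin.natAdd N f)) :
    colorSum φ (m n) (fun f => Θ (Fin.natAdd N f))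
        (fun z => p (N + n) Θ (prepend (hm n) (upper Θ) z)) =
      colorSum φ (m n) (fun f => Θ (Fin.natAdd N f)) (p n fun f => Θ (Fin.natAdd N f)) ∧
    colorSum φ (m n) (fun f => Θ (Fin.natAdd N f))
        (fun z => p (N + n) Θ (prepend (hm n) (lower Θ) z)) =
      σ * colorSum φ (m n) (fun f => Θ (Fin.natAdd N f)) (p n fun f => Θ (Fin.natAdd N f)) := by
  obtain ⟨q, hq, hq0⟩ := hp.recursion n Θ hΘ
  set θ : Fin n → ℂ := fun f => Θ (Fin.natAdd N f) with hθ
  have hpre : Differentiable ℂ fun z : ZVars N (m n) =>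
      p (N + n) Θ (prepend (hm n) (lower Θ) z) := by
    refine (hp.differentiable_z Θ).comp ?_
    refine differentiable_pi.2 fun k => differentiable_pi.2 fun j => ?_
    simp only [prepend]
    refine Fin.cases ?_ (fun j => ?_) (Fin.cast (hm n k) j)
    · simp only [Fin.cons_zero]; fun_prop
    · simp only [Fin.cons_succ]; fun_prop
  -- Being a difference of entire functions, `q` is admissible in `blockI_eq_colorSum`, which turns
  -- its vanishing integral into a vanishing sum.
  have hqd : Differentiable ℂ q := by
    have : q = fun z => p (N + n) Θ (prepend (hm n) (lower Θ) z) - σ * p n θ z := by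
      funext z; rw [hq z]; ring
    rw [this]
    exact hpre.sub ((hp.differentiable_z θ).const_mul σ)
  have hqz : colorSum φ (m n) θ q = 0 := by
    rw [← blockI_eq_colorSum hN hφ h (m n) hreg hqd]; exact hq0 hreg
  have hlow : colorSum φ (m n) θ (fun z => p (N + n) Θ (prepend (hm n) (lower Θ) z)) =
      σ * colorSum φ (m n) θ (p n θ) := by
    simp only [hq]
    rw [colorSum_add, colorSum_const_mul, hqz, add_zero]
  -- By `fusion` the `lower` specialization is `σ` times the `upper` one, so dividing by `σ` gives
  -- the other half.
  refine ⟨mul_left_cancel₀ hσ ?_, hlow⟩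
  rw [← hlow, ← colorSum_const_mul]
  congr 1
  funext z
  exact (hp.fusion n Θ hΘ z).symm

theorem finRotate_val {N : ℕ} (i : Fin N) :
    ((finRotate N i : Fin N) : ℕ) = if (i : ℕ) + 1 = N then 0 else (i : ℕ) + 1 := by
  rcases N with _ | N
  · exact i.elim0
  · split_ifs with hi
    · rw [show i = Fin.last N from Fin.ext (by simp; omega), finRotate_last]; rfl
    · rw [coe_finRotate_of_ne_last]
      intro he; rw [he] at hi; simp at hi

/-- The last residue, in terms of the form factor of the free particles. -/
theorem linkedFormFactor_close (hN : 2 ≤ N) (hσ : σ ≠ 0) (hF : IsMinimalFormFactor N F)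
    (hφ : IsPhiTauKappa N F φ τ κ) (h : PhiShape N φ ψ)
    (hp : IsPFunction N φ τ κ σ s m hm p) {c : ℕ → ℂ} (hc : NormRecursion N F φ c)
    {k n T : ℕ} (hk : k + 2 = N) (hT' : T = n + 1 + (k + 1)) {θ : Fin (n + 1) → ℂ}
    (hθ : Generic N θ) {A B : Fin T × Fin T}
    (hA : (A.1 : ℕ) = k + 1 ∧ (A.2 : ℕ) = k) (hB : (B.1 : ℕ) = 0 ∧ (B.2 : ℕ) = k + 1) :
    linkedFormFactor F φ (ψ 0 / (sh (ieta N) / 2)) c m p (insert A (chainLinks T k))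
          (chain N (k + 1) (Nat.succ_pos n) hT' θ) -
        linkedFormFactor F φ (ψ 0 / (sh (ieta N) / 2)) c m p (insert B (chainLinks T k))
          (chain N (k + 1) (Nat.succ_pos n) hT' θ) =
      2 * I * formFactor N F φ τ κ c m p n (Fin.tail θ) *
        (1 - σ * ∏ i : Fin n, S N (θ 0 - θ i.succ)) *
        ∏ α ∈ Finset.Icc 1 (N - 2), (Real.sqrt 2 : ℂ) * Gam N α := by
  obtain rfl : T = N + n := by omega
  set ρ := ψ 0 / (sh (ieta N) / 2) with hρ
  set Θ := chain N (k + 1) (Nat.succ_pos n) hT' θ with hΘ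
  have hfree : ∀ f : Fin n, Θ (Fin.natAdd N f) = θ f.succ := by
    intro f
    rw [hΘ, chain, dif_neg (by simp; omega)]
    congr 1
    exact Fin.ext (by simp; omega)
  have hch : ∀ i : Fin N, Θ (Fin.castAdd n i) = θ 0 + ((N : ℂ) - 1 - i) * ieta N := by
    intro i
    have hNk : (N : ℂ) = k + 2 := by rw [← hk]; push_cast; ring
    rw [hΘ, chain, hNk]
    by_cases hi : (i : ℕ) < k + 1
    · rw [dif_pos (by simpa using hi)]
      simp only [Fin.val_castAdd]
      push_cast
      rw [show (⟨0, Nat.succ_pos n⟩ : Fin (n + 1)) = 0 from rfl]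
      ring
    · have hi' : (i : ℕ) = k + 1 := by omega
      have h0 : (⟨(Fin.castAdd n i : ℕ) - (k + 1), by simp; omega⟩ : Fin (n + 1)) = 0 :=
        Fin.ext (by simp [hi'])
      have hi₂ : ((i : ℕ) : ℂ) = k + 1 := by exact_mod_cast hi'
      rw [dif_neg (by simpa using hi), h0, hi₂]
      ring
  have hlu : ∀ j, lower Θ j - upper Θ j = I * eta N := by
    intro j
    have h1 : lower Θ j = Θ (Fin.castAdd n ⟨j, by omega⟩) := rfl
    have h2 : upper Θ j = Θ (Fin.castAdd n ⟨j + 1, by omega⟩) := rfl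
    rw [h1, h2, hch, hch, ← ieta]
    push_cast; ring
  have htail : (fun f => Θ (Fin.natAdd N f)) = Fin.tail θ := funext hfree
  have hgen : Generic N (Fin.tail θ) := fun i j hij l =>
    hθ i.succ j.succ (fun he => hij (Fin.succ_injective _ he)) l
  have hrec := colorSum_recursion hN hσ hφ h hp hlu (by rw [htail]; exact hgen.regular hN)
  have hu : ∀ f : Fin n, ∀ l : ℤ, θ 0 - θ f.succ ≠ l * ieta N := fun f l =>
    hθ 0 f.succ (Fin.succ_ne_zero f).symm l
  -- The colours are in order along the chain; the first point has colour `0`, so the variables sit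
  -- at `upper`.
  have hup : linkedFormFactor F φ ρ c m p (insert A (chainLinks (N + n) k)) Θ = _ :=
    linkedFormFactor_chain hφ h hp c ρ (θ 0) (Equiv.refl _) (L := insert A (chainLinks (N + n) k))
      (Θ := Θ) ?_ ?_ ?_ ?_
  rotate_left
  · intro i j
    simp only [Finset.mem_insert, mem_chainLinks, Prod.ext_iff, Fin.ext_iff, Fin.val_castAdd,
      Equiv.refl_apply]
    omega
  · intro i f
    simp only [Finset.mem_insert, mem_chainLinks, Prod.ext_iff, Fin.ext_iff, Fin.val_natAdd]
    omega
  · intro f i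
    simp only [Finset.mem_insert, mem_chainLinks, Prod.ext_iff, Fin.ext_iff, Fin.val_natAdd]
    omega
  · intro i
    exact ⟨0, by rw [hch]; simp⟩
  -- The closing link rotates the colours: the last point has colour `0`, so the variables sit at
  -- `lower`. In the order of colours the last rapidity counts as `θ 0 + 2πi`, which moves the base
  -- point of the chain to `θ 0 + iη`.
  have hlo : linkedFormFactor F φ ρ c m p (insert B (chainLinks (N + n) k)) Θ = _ :=
    linkedFormFactor_chain hφ h hp c ρ (θ 0 + ieta N) (finRotate N)
      (L := insert B (chainLinks (N + n) k)) (Θ := Θ) ?_ ?_ ?_ ?_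
  rotate_left
  · intro i j
    simp only [Finset.mem_insert, mem_chainLinks, Prod.ext_iff, Fin.ext_iff, Fin.val_castAdd,
      finRotate_val]
    have hi := i.2
    have hj := j.2
    by_cases h1 : (i : ℕ) + 1 = N <;> by_cases h2 : (j : ℕ) + 1 = N <;>
      simp only [h1, h2, if_true, if_false] <;> omega
  · intro i f
    simp only [Finset.mem_insert, mem_chainLinks, Prod.ext_iff, Fin.ext_iff, Fin.val_natAdd]
    omega
  · intro f i
    simp only [Finset.mem_insert, mem_chainLinks, Prod.ext_iff, Fin.ext_iff, Fin.val_natAdd]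
    omega
  · intro i
    rw [hch, finRotate_val]
    split_ifs with hi
    · refine ⟨-1, ?_⟩
      have : (N : ℂ) = (i : ℕ) + 1 := by exact_mod_cast hi.symm
      rw [← natCast_mul_ieta hN, this]; push_cast; ring
    · exact ⟨0, by push_cast; ring⟩
  have hUp : (fun j : Fin (N - 1) => Θ (Fin.castAdd n ((Equiv.refl (Fin N)).symm
      ⟨j + 1, by omega⟩))) = upper Θ := rfl
  have hLo : (fun j : Fin (N - 1) => Θ (Fin.castAdd n ((finRotate N).symm
      ⟨j + 1, by omega⟩))) = lower Θ := by
    funext j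
    have : (finRotate N).symm ⟨j + 1, by omega⟩ = ⟨j, by omega⟩ := by
      rw [Equiv.symm_apply_eq]
      refine Fin.ext ?_
      rw [finRotate_val, if_neg (by simp only; omega)]
    rw [this]; rfl
  rw [hUp, hrec.1, prod_chainWeight hN hφ, pairF_append F (θ 0) hch, htail] at hup
  rw [hLo, hrec.2, prod_chainWeight hN hφ, pairF_append F (θ 0) hch, htail] at hlo
  simp only [hfree] at hup hlo
  have hS : ∏ f : Fin n, ∏ k ∈ Finset.range (N - 1), φ (θ 0 + ieta N - θ f.succ + k * ieta N) =
      (∏ f : Fin n, ∏ k ∈ Finset.range (N - 1), φ (θ 0 - θ f.succ + k * ieta N)) *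
        ∏ f : Fin n, S N (θ 0 - θ f.succ) := by
    rw [← Finset.prod_mul_distrib]
    refine Finset.prod_congr rfl fun f _ => ?_
    rw [← prod_phi_add_ieta hN hφ h (hu f)]
    simp only [add_sub_right_comm]
  have hone : (∏ f : Fin n, ∏ k ∈ Finset.range (N - 1), φ (θ 0 - θ f.succ + k * ieta N)) *
      ∏ f : Fin n, ∏ k ∈ Finset.range N, F (θ 0 - θ f.succ + k * ieta N) = 1 := by
    rw [← Finset.prod_mul_distrib]
    exact Finset.prod_eq_one fun f _ => hφ.prod_phi_mul_prod_F hN hF h (hu f)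
  have hnorm := hc n
  rw [show I * (eta N : ℂ) = ieta N from rfl, (h.hasSimplePole_comp_neg hN).residue_eq, ← hρ]
    at hnorm
  rw [hup, hlo, hS, formFactor_eq_colorSum hN hφ h hp c (hgen.regular hN)]
  -- `hnorm` exchanges the factors inside the chain for the normalization, and `hone` cancels `φ`
  -- against `F` between chain and free rapidities.
  linear_combination (pairF F (Fin.tail θ) * colorSum φ (m n) (Fin.tail θ) (p n (Fin.tail θ)) *
    (1 - σ * ∏ f : Fin n, S N (θ 0 - θ f.succ))) * hnorm +
    (c (N + n) * ρ ^ (N - 1) * (∏ k ∈ Finset.Icc 1 (N - 2), φ (k * ieta N) ^ k) *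
      (∏ d ∈ Finset.Icc 1 (N - 1), F (d * ieta N) ^ (N - d)) * pairF F (Fin.tail θ) *
      colorSum φ (m n) (Fin.tail θ) (p n (Fin.tail θ)) *
      (1 - σ * ∏ f : Fin n, S N (θ 0 - θ f.succ))) * hone

end Chain

/-! ### Bound states -/

theorem HasResidue.congr {f g : ℂ → ℂ} {a c : ℂ} (hf : HasResidue f a c)
    (hfg : f =ᶠ[𝓝[≠] a] g) : HasResidue g a c := by
  refine ⟨hf.1.congr hfg, ?_⟩
  obtain ⟨ε, hε, hball⟩ := Metric.mem_nhdsWithin_iff.1 hfg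
  filter_upwards [hf.2, Ioo_mem_nhdsGT hε] with r hr hrε
  rw [← hr]
  congr 1
  refine circleIntegral.integral_congr hrε.1.le fun z hz => ?_
  have hz' : dist z a = r := hz
  refine (hball ⟨?_, fun he => ?_⟩).symm
  · rw [Metric.mem_ball, hz']; exact hrε.2
  · rw [Set.mem_singleton_iff.1 he, dist_self] at hz'
    exact hrε.1.ne hz'

/-- The forbidden set `θ_j + iηℤ` lies in the zero set of `sh (N (t - θ_j))`, which is discrete. -/
theorem Generic.eventually_cons {N q : ℕ} (hN : 2 ≤ N) {θ : Fin q → ℂ} (hθ : Generic N θ) (a : ℂ) :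
    ∀ᶠ t in 𝓝[≠] a, Generic N (Fin.cons t θ : Fin (q + 1) → ℂ) := by
  have hN0 : (N : ℂ) ≠ 0 := Nat.cast_ne_zero.2 (by omega)
  have key : ∀ j : Fin q, ∀ᶠ t in 𝓝[≠] a, sh (N * (t - θ j)) ≠ 0 := by
    intro j
    have ht : Tendsto (fun t : ℂ => N * (t - θ j)) (𝓝[≠] a) (𝓝[≠] (N * (a - θ j))) := by
      refine tendsto_nhdsWithin_iff.2 ⟨?_, ?_⟩
      · exact (Continuous.tendsto (by fun_prop) a).mono_left nhdsWithin_le_nhds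
      · filter_upwards [self_mem_nhdsWithin] with t ht he
        exact ht (sub_left_injective (mul_left_cancel₀ hN0 he))
    exact ht.eventually (eventually_sh_ne_zero _)
  have hne : ∀ (t : ℂ) (j : Fin q), sh (N * (t - θ j)) ≠ 0 → ∀ l : ℤ, t - θ j ≠ l * ieta N := by
    intro t j ht l he
    refine ht (sh_eq_zero_iff.2 ⟨l, ?_⟩)
    rw [he, ← natCast_mul_ieta hN]; ring
  filter_upwards [Filter.eventually_all.2 key] with t ht
  intro i j hij l
  rw [← ieta]
  revert hij
  refine Fin.cases ?_ (fun i => ?_) i <;> refine Fin.cases ?_ (fun j => ?_) j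
  · intro hij; exact absurd rfl hij
  · intro _
    simpa using hne t j (ht j) l
  · intro _ he
    refine hne t i (ht i) (-l) ?_
    simp only [Fin.cons_zero, Fin.cons_succ] at he
    push_cast; linear_combination -he
  · intro hij
    simpa [ieta] using hθ i j (fun he => hij (by rw [he])) l

theorem hasSimplePole_S {N : ℕ} :
    HasSimplePole (S N) (ieta N) (sh (ieta N + ieta N) / (1 / 2)) := by
  rw [show S N = fun z => sh (z + ieta N) / sh (z - ieta N) from funext (S_eq N)]
  refine hasSimplePole_div (g := fun z => sh (z - ieta N)) (analyticAt_sh_add _ _) ?_ ?_ ?_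
    (by norm_num)
  · simpa only [sub_eq_add_neg] using analyticAt_sh_add (-ieta N) (ieta N)
  · simp [sh_zero]
  · have h := HasDerivAt.comp_sub_const (ieta N) (ieta N) (hasDerivAt_sh (ieta N - ieta N))
    refine h.congr_deriv ?_
    simp

/-- At `iη_α` the factors have the arguments `iη, 2iη, …, α iη`, and only the first is a pole of
`S`. All remaining numerators and denominators are `sh (l iη)` with `0 < l ≤ α + 1 < N`, hence
non-zero. So the intertwiners may be divided out. -/
theorem residue_S1_ne_zero {N α : ℕ} (h1 : 1 ≤ α) (h2 : α + 2 ≤ N) :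
    residue (S1 N α) (I * etaB N α) ≠ 0 := by
  have hN : 2 ≤ N := by omega
  obtain ⟨a, rfl⟩ : ∃ a, α = a + 1 := ⟨α - 1, by omega⟩
  have hsh : ∀ l : ℕ, 1 ≤ l → l < N → sh (l * ieta N) ≠ 0 := by
    intro l hl hlN
    have := sh_int_mul_ieta_ne_zero hN (l := l) (int_not_dvd_of_pos_of_lt (by omega) (by omega))
    simpa using this
  set θ₀ : ℂ := I * etaB N (a + 1) with hθ₀
  have hθ : θ₀ = ((a : ℂ) + 2) * (ieta N / 2) := by
    rw [hθ₀, etaB, ieta, eta]; push_cast; ring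
  have hlast := (hasSimplePole_S (N := N)).comp_sub_const (a * (ieta N / 2))
  have hrest : AnalyticAt ℂ (fun θ => ∏ j ∈ Finset.range a,
      S N (θ + (((a + 1 : ℕ) : ℂ) - 1 - 2 * j) * (I * eta N / 2))) θ₀ ∧
      ∏ j ∈ Finset.range a, S N (θ₀ + (((a + 1 : ℕ) : ℂ) - 1 - 2 * j) * (I * eta N / 2)) ≠ 0 := by
    have hval : ∀ j ∈ Finset.range a, θ₀ + (((a + 1 : ℕ) : ℂ) - 1 - 2 * j) * (I * eta N / 2) =
        ((a + 1 - j : ℕ) : ℂ) * ieta N := by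
      intro j hj
      have := Finset.mem_range.1 hj
      rw [hθ, Nat.cast_sub (by omega), ← ieta]; push_cast; ring
    have hnum : ∀ j ∈ Finset.range a, sh (((a + 1 - j : ℕ) : ℂ) * ieta N + ieta N) ≠ 0 := by
      intro j hj
      have := Finset.mem_range.1 hj
      have h3 := hsh (a + 1 - j + 1) (by omega) (by omega)
      rwa [Nat.cast_add_one, add_one_mul] at h3
    have hden : ∀ j ∈ Finset.range a, sh (((a + 1 - j : ℕ) : ℂ) * ieta N - ieta N) ≠ 0 := by
      intro j hj
      have := Finset.mem_range.1 hj
      have h3 := hsh (a - j) (by omega) (by omega)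
      rwa [show ((a - j : ℕ) : ℂ) * ieta N = ((a + 1 - j : ℕ) : ℂ) * ieta N - ieta N by
        rw [Nat.cast_sub (by omega), Nat.cast_sub (by omega)]; push_cast; ring] at h3
    refine ⟨Finset.analyticAt_fun_prod _ fun j hj => ?_, Finset.prod_ne_zero_iff.2 fun j hj => ?_⟩
    · refine AnalyticAt.comp_of_eq (g := S N) ?_ (by fun_prop) (hval j hj)
      rw [show S N = fun z => sh (z + ieta N) / sh (z - ieta N) from funext (S_eq N)]
      refine (analyticAt_sh_add _ _).div ?_ (hden j hj)
      simpa only [sub_eq_add_neg] using analyticAt_sh_add (-ieta N) _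
    · rw [hval j hj, S_eq]
      exact div_ne_zero (hnum j hj) (hden j hj)
  have hpole : HasSimplePole (S1 N (a + 1)) θ₀ ((∏ j ∈ Finset.range a,
      S N (θ₀ + (((a + 1 : ℕ) : ℂ) - 1 - 2 * j) * (I * eta N / 2))) *
      (sh (ieta N + ieta N) / (1 / 2))) := by
    rw [show ieta N + a * (ieta N / 2) = θ₀ by rw [hθ]; ring] at hlast
    refine (hlast.mul_analyticAt hrest.1).congr (Eventually.of_forall fun θ => ?_)
    simp only [S1, Finset.prod_range_succ]
    congr 2
    rw [← ieta]; push_cast; ring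
  rw [hpole.residue_eq]
  refine mul_ne_zero hrest.2 (div_ne_zero ?_ (by norm_num))
  have := hsh 2 (by omega) (by omega)
  rwa [show ieta N + ieta N = ((2 : ℕ) : ℂ) * ieta N by push_cast; ring]

theorem sqrt_two_mul_Gam_ne_zero {N α : ℕ} (h1 : 1 ≤ α) (h2 : α + 2 ≤ N) :
    (Real.sqrt 2 : ℂ) * Gam N α ≠ 0 := by
  refine mul_ne_zero ?_ (mul_ne_zero I_ne_zero ?_)
  · exact_mod_cast (Real.sqrt_pos.2 two_pos).ne'
  · exact_mod_cast (Real.sqrt_pos.2 (norm_pos_iff.2 (residue_S1_ne_zero h1 h2))).ne'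

theorem chain_zero {N q : ℕ} (hq : 0 < q) (hT : q = q + 0) (θ : Fin q → ℂ) :
    chain N 0 hq hT θ = θ := by
  funext i
  rw [chain, dif_neg (by omega)]
  rfl

/-! ### Residues of the form factors and of their bound states. -/

section FormFactors

variable {N : ℕ} {F φ τ κ ψ : ℂ → ℂ} {σ s : ℂ} {m : ℕ → Fin (N - 1) → ℕ}
  {hm : ∀ n k, m (N + n) k = m n k + 1} {p : (n : ℕ) → (Fin n → ℂ) → ZVars N (m n) → ℂ}

theorem linkedFormFactor_chainLinks_zero (hN : 2 ≤ N) (hφ : IsPhiTauKappa N F φ τ κ)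
    (h : PhiShape N φ ψ) (hp : IsPFunction N φ τ κ σ s m hm p) (ρ : ℂ) (c : ℕ → ℂ) {T : ℕ}
    {θ : Fin T → ℂ} (hθ : Generic N θ) :
    linkedFormFactor F φ ρ c m p (chainLinks T 0) θ = formFactor N F φ τ κ c m p T θ := by
  rw [formFactor_eq_colorSum hN hφ h hp c (hθ.regular hN), linkedFormFactor, colorSum, mul_assoc,
    Finset.sum_mul]
  congr 1
  refine Finset.sum_congr rfl fun g _ => ?_
  have hw : ∏ x, linkFactor φ ρ (chainLinks T 0) g θ x = pairWeight φ θ g := by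
    rw [pairWeight, Fintype.prod_prod_type]
    refine Finset.prod_congr rfl fun i _ => Finset.prod_congr rfl fun j _ => ?_
    rw [linkFactor, if_neg]
    rw [mem_chainLinks]
    simp only
    omega
  rw [hw]; ring

/-- Here `k` links are already made and `r + 1` residues remain: all but the last add a link, and
the last closes the chain. -/
theorem hasIteratedResidue_linkedFormFactor (hN : 2 ≤ N) (hσ : σ ≠ 0)
    (hF : IsMinimalFormFactor N F) (hφ : IsPhiTauKappa N F φ τ κ) (h : PhiShape N φ ψ)
    (hp : IsPFunction N φ τ κ σ s m hm p) {c : ℕ → ℂ} (hc : NormRecursion N F φ c) (n r : ℕ) :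
    ∀ (k T : ℕ) (_ : k + r + 2 = N) (hT : T = n + 1 + (r + 1) + k), HasIteratedResidue N n
      (fun θ => 2 * I * formFactor N F φ τ κ c m p n (Fin.tail θ) *
        (1 - σ * ∏ i : Fin n, S N (θ 0 - θ i.succ)) *
        ∏ α ∈ Finset.Icc 1 (N - 2), (Real.sqrt 2 : ℂ) * Gam N α)
      (r + 1) (fun θ => linkedFormFactor F φ (ψ 0 / (sh (ieta N) / 2)) c m p (chainLinks T k)
        (chain N k (Nat.succ_pos _) hT θ)) := by
  induction r with
  | zero =>
    intro k T hk hT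
    refine ⟨_, fun θ hθ => ?_, fun θ _ => rfl⟩
    have hT' : T = n + 1 + (k + 1) := by omega
    have h1 := hasSimplePole_linkedFormFactor_close hN hF hφ h hp c (k := k) (by omega)
      (Nat.succ_pos n) hT hT' hθ (A := (⟨k + 1, by omega⟩, ⟨k, by omega⟩))
      (B := (⟨0, by omega⟩, ⟨k + 1, by omega⟩)) ⟨rfl, rfl⟩ ⟨rfl, rfl⟩
    rw [linkedFormFactor_close hN hσ hF hφ h hp hc (by omega) hT' hθ ⟨rfl, rfl⟩ ⟨rfl, rfl⟩] at h1
    exact h1.hasResidue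
  | succ r ih =>
    intro k T hk hT
    have hT' : T = n + 1 + (r + 1) + (k + 1) := by omega
    refine ⟨_, fun θ hθ => ?_, ih (k + 1) T (by omega) hT'⟩
    exact (hasSimplePole_linkedFormFactor hN hF h hp c (by omega) (Nat.succ_pos _) hT hT'
      hθ).hasResidue

theorem hasIteratedResidue_formFactor (hN : 2 ≤ N) (hσ : σ ≠ 0)
    (hF : IsMinimalFormFactor N F) (hφ : IsPhiTauKappa N F φ τ κ) (h : PhiShape N φ ψ)
    (hp : IsPFunction N φ τ κ σ s m hm p) {c : ℕ → ℂ} (hc : NormRecursion N F φ c) (n : ℕ) :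
    HasIteratedResidue N n
      (fun θ => 2 * I * formFactor N F φ τ κ c m p n (Fin.tail θ) *
        (1 - σ * ∏ i : Fin n, S N (θ 0 - θ i.succ)) *
        ∏ α ∈ Finset.Icc 1 (N - 2), (Real.sqrt 2 : ℂ) * Gam N α)
      (N - 1) (formFactor N F φ τ κ c m p (n + 1 + (N - 1))) := by
  obtain ⟨r, hr⟩ : ∃ r, N - 1 = r + 1 := ⟨N - 2, by omega⟩
  obtain ⟨f₁, h1, h2⟩ := hasIteratedResidue_linkedFormFactor hN hσ hF hφ h hp hc n r 0
    (n + 1 + (r + 1)) (by omega) rfl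
  rw [hr]
  refine ⟨f₁, fun θ hθ => (h1 θ hθ).congr ?_, h2⟩
  -- The form factor is compared with the unlinked sum at generic rapidities only, which fill a
  -- punctured neighbourhood of the pole.
  filter_upwards [hθ.eventually_cons hN (θ ⟨0, by omega⟩ + I * eta N)] with t ht
  rw [chain_zero]
  exact linkedFormFactor_chainLinks_zero hN hφ h hp _ c ht

/-- A residue of linked form factors, in terms of the rapidity of the bound state. -/
theorem hasSimplePole_boundFormFactor {Fn : (n : ℕ) → (Fin n → ℂ) → ℂ} (hN : 2 ≤ N) {a n : ℕ}
    {f : (Fin (n + 2) → ℂ) → ℂ} {C X : ℂ}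
    (hf : ∀ θ : Fin (n + 2) → ℂ,
      Generic N (Fin.cons (θ 0 - a * (ieta N / 2)) (Fin.tail θ) : Fin (n + 2) → ℂ) →
      boundFormFactor N Fn a (n + 1) θ =
        C * f (Fin.cons (θ 0 - a * (ieta N / 2)) (Fin.tail θ)))
    {θ : Fin (n + 1) → ℂ} (hθ : Generic N θ)
    (hX : HasSimplePole (fun t => f (Fin.cons t θ)) (θ 0 + ieta N) X) :
    HasSimplePole (fun t => boundFormFactor N Fn a (n + 1) (Fin.cons t θ))
      (θ 0 + I * etaB N (a + 1)) (C * X) := by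
  have h1 := (hX.comp_sub_const (a * (ieta N / 2))).const_mul C
  have ha : θ 0 + ieta N + a * (ieta N / 2) = θ 0 + I * etaB N (a + 1) := by
    rw [etaB, ieta, eta]; push_cast; ring
  rw [ha] at h1
  refine h1.congr ?_
  have hg : ∀ b, ∀ᶠ t in 𝓝[≠] b, Generic N (Fin.cons t θ : Fin (n + 2) → ℂ) :=
    hθ.eventually_cons hN
  filter_upwards [eventually_nhdsNE_add hg (-(a * (ieta N / 2))) (θ 0 + I * etaB N (a + 1))]
    with t ht
  rw [← sub_eq_add_neg] at ht
  rw [hf (Fin.cons t θ) (by simpa using ht)]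
  simp

/-- A particle of type `a + 1` is a chain of `a + 1` rapidities spaced by `iη` and centred at its
own, so the last of them lies `a iη/2` below it. Each fusion adds a link and divides by one
intertwiner. -/
theorem boundFormFactor_eq (hN : 2 ≤ N) (hF : IsMinimalFormFactor N F)
    (hφ : IsPhiTauKappa N F φ τ κ) (h : PhiShape N φ ψ)
    (hp : IsPFunction N φ τ κ σ s m hm p) (c : ℕ → ℂ) (a : ℕ) :
    ∀ (_ : a + 2 ≤ N) (n T : ℕ) (hT : T = n + 1 + a) (θ : Fin (n + 1) → ℂ),
      Generic N (Fin.cons (θ 0 - a * (ieta N / 2)) (Fin.tail θ) : Fin (n + 1) → ℂ) →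
      boundFormFactor N (formFactor N F φ τ κ c m p) a n θ =
        (∏ b ∈ Finset.Icc 1 a, (Real.sqrt 2 : ℂ) * Gam N b)⁻¹ *
          linkedFormFactor F φ (ψ 0 / (sh (ieta N) / 2)) c m p (chainLinks T a)
            (chain N a (Nat.succ_pos n) hT
              (Fin.cons (θ 0 - a * (ieta N / 2)) (Fin.tail θ))) := by
  induction a with
  | zero =>
    intro _ n T hT θ hθ
    subst hT
    have h0 : (Fin.cons (θ 0 - ((0 : ℕ) : ℂ) * (ieta N / 2)) (Fin.tail θ) : Fin (n + 1) → ℂ) =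
        θ := by simp
    rw [h0] at hθ ⊢
    rw [chain_zero, linkedFormFactor_chainLinks_zero hN hφ h hp _ c hθ]
    simp [boundFormFactor]
  | succ a ih =>
    intro ha n T hT θ hθ
    have hT' : T = n + 1 + 1 + a := by omega
    set u : ℂ := θ 0 - (a + 1) * (I * eta N / 2) with hu
    have hu' : θ 0 - ((a + 1 : ℕ) : ℂ) * (ieta N / 2) = u := by rw [hu, ieta]; push_cast; ring
    rw [hu'] at hθ ⊢
    have h1 := hasSimplePole_boundFormFactor hN
      (f := fun θ => linkedFormFactor F φ (ψ 0 / (sh (ieta N) / 2)) c m p (chainLinks T a)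
        (chain N a (Nat.succ_pos _) hT' θ))
      (ih (by omega) (n + 1) T hT') hθ
      (hasSimplePole_linkedFormFactor hN hF h hp c (by omega) (Nat.succ_pos n) hT' hT hθ)
    rw [Fin.cons_zero] at h1
    have h2 : boundFormFactor N (formFactor N F φ τ κ c m p) (a + 1) n θ =
        ((Real.sqrt 2 : ℂ) * Gam N (a + 1))⁻¹ *
          residue (fun t => boundFormFactor N (formFactor N F φ τ κ c m p) a (n + 1)
            (Fin.cons t (Fin.cons u (Fin.tail θ)))) (u + I * etaB N (a + 1)) := rfl
    rw [h2, h1.residue_eq, Finset.prod_Icc_succ_top (by omega), mul_inv]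
    ring

/-- The value of the residue is built into `boundFormFactor`; the content is that the pole is
simple, and that the intertwiner is non-zero, which undoes the division in the definition. -/
theorem hasResidue_boundFormFactor (hN : 2 ≤ N) (hF : IsMinimalFormFactor N F)
    (hφ : IsPhiTauKappa N F φ τ κ) (h : PhiShape N φ ψ)
    (hp : IsPFunction N φ τ κ σ s m hm p) (c : ℕ → ℂ) {a n : ℕ} (ha : a + 2 < N)
    {θ : Fin (n + 1) → ℂ} (hθ : Generic N θ) :
    HasResidue (fun t => boundFormFactor N (formFactor N F φ τ κ c m p) a (n + 1) (Fin.cons t θ))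
      (θ 0 + I * etaB N (a + 1))
      ((Real.sqrt 2 : ℂ) * Gam N (a + 1) *
        boundFormFactor N (formFactor N F φ τ κ c m p) (a + 1) n
          (Fin.cons (θ 0 + (a + 1) * (I * eta N / 2)) (Fin.tail θ))) := by
  have hT : n + 1 + 1 + a = n + 1 + (a + 1) := by omega
  have h1 := hasSimplePole_boundFormFactor hN
      (f := fun θ => linkedFormFactor F φ (ψ 0 / (sh (ieta N) / 2)) c m p (chainLinks (n + 1 + 1 + a) a)
        (chain N a (Nat.succ_pos _) rfl θ))
    (boundFormFactor_eq hN hF hφ h hp c a ha.le (n + 1) _ rfl) hθ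
    (hasSimplePole_linkedFormFactor hN hF h hp c ha (Nat.succ_pos n) rfl hT hθ)
  have hcons : (Fin.cons ((Fin.cons (θ 0 + (a + 1) * (I * eta N / 2)) (Fin.tail θ) :
      Fin (n + 1) → ℂ) 0 - ((a + 1 : ℕ) : ℂ) * (ieta N / 2))
      (Fin.tail (Fin.cons (θ 0 + (a + 1) * (I * eta N / 2)) (Fin.tail θ) : Fin (n + 1) → ℂ)) :
      Fin (n + 1) → ℂ) = θ := by
    rw [Fin.cons_zero, Fin.tail_cons, ieta]
    rw [show θ 0 + (a + 1) * (I * eta N / 2) - ((a + 1 : ℕ) : ℂ) * (I * eta N / 2) = θ 0 by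
      push_cast; ring]
    exact Fin.cons_self_tail θ
  rw [boundFormFactor_eq hN hF hφ h hp c (a + 1) ha n _ hT _ (by rw [hcons]; exact hθ), hcons,
    Finset.prod_Icc_succ_top (by omega), mul_inv, mul_comm (∏ b ∈ Finset.Icc 1 a, _)⁻¹ _,
    ← mul_assoc, mul_inv_cancel_left₀ (sqrt_two_mul_Gam_ne_zero (by omega) ha)]
  exact h1.hasResidue

/-- The last residue closes the chain. The intertwiners divided out in the earlier fusions cancel
those in `linkedFormFactor_close`, and the fusion angle `η_{N-1}` is `π`. -/
theorem hasResidue_annihilation (hN : 2 ≤ N) (hσ : σ ≠ 0) (hF : IsMinimalFormFactor N F)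
    (hφ : IsPhiTauKappa N F φ τ κ) (h : PhiShape N φ ψ)
    (hp : IsPFunction N φ τ κ σ s m hm p) {c : ℕ → ℂ} (hc : NormRecursion N F φ c) {n : ℕ}
    {θ : Fin (n + 1) → ℂ} (hθ : Generic N θ) :
    HasResidue (fun t => boundFormFactor N (formFactor N F φ τ κ c m p) (N - 2) (n + 1)
        (Fin.cons t θ)) (θ 0 + I * Real.pi)
      (2 * I * formFactor N F φ τ κ c m p n (Fin.tail θ) *
        (1 - σ * ∏ i : Fin n, S N (θ 0 - θ i.succ))) := by
  obtain ⟨k, hk⟩ : ∃ k, k + 2 = N := ⟨N - 2, by omega⟩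
  obtain hk' : N - 2 = k := by omega
  have hT' : n + 1 + 1 + k = n + 1 + (k + 1) := by omega
  have hX := hasSimplePole_linkedFormFactor_close hN hF hφ h hp c hk
    (Nat.succ_pos n) rfl hT' hθ (A := (⟨k + 1, by omega⟩, ⟨k, by omega⟩))
    (B := (⟨0, by omega⟩, ⟨k + 1, by omega⟩)) ⟨rfl, rfl⟩ ⟨rfl, rfl⟩
  rw [linkedFormFactor_close hN hσ hF hφ h hp hc hk hT' hθ ⟨rfl, rfl⟩ ⟨rfl, rfl⟩] at hX
  have h1 := hasSimplePole_boundFormFactor hN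
      (f := fun θ => linkedFormFactor F φ (ψ 0 / (sh (ieta N) / 2)) c m p (chainLinks (n + 1 + 1 + k) k)
        (chain N k (Nat.succ_pos _) rfl θ))
    (boundFormFactor_eq hN hF hφ h hp c k hk.le (n + 1) _ rfl) hθ hX
  have h0 : ∏ b ∈ Finset.Icc 1 k, (Real.sqrt 2 : ℂ) * Gam N b ≠ 0 :=
    Finset.prod_ne_zero_iff.2 fun b hb => by
      have := Finset.mem_Icc.1 hb
      exact sqrt_two_mul_Gam_ne_zero this.1 (by omega)
  have hpi : I * (etaB N (k + 1) : ℂ) = I * Real.pi := by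
    have hN0 : (N : ℝ) ≠ 0 := Nat.cast_ne_zero.2 (by omega)
    have : etaB N (k + 1) = Real.pi := by
      rw [etaB, div_eq_iff hN0, ← hk]; push_cast; ring
    rw [this]
  rw [hk', hpi, mul_comm _ (∏ b ∈ Finset.Icc 1 k, _), inv_mul_cancel_left₀ h0] at h1
  rw [hk']
  exact h1.hasResidue

end FormFactors

end

end ZNIsing

/-! ### The theorem. -/

theorem lemma4 (N : ℕ) (hN : 2 ≤ N) (F φ τ κ : ℂ → ℂ)
    (hF : ZNIsing.IsMinimalFormFactor N F)
    (hφ : ZNIsing.IsPhiTauKappa N F φ τ κ)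
    (σ s : ℂ) (hσ : σ ≠ 0)
    (m : ℕ → Fin (N - 1) → ℕ) (hm : ∀ n k, m (N + n) k = m n k + 1)
    (p : (n : ℕ) → (Fin n → ℂ) → ZNIsing.ZVars N (m n) → ℂ)
    (hp : ZNIsing.IsPFunction N φ τ κ σ s m hm p)
    (c : ℕ → ℂ) (hc : ZNIsing.NormRecursion N F φ c) :
    ZNIsing.FormFactorEquations N σ s (ZNIsing.formFactor N F φ τ κ c m p) := by
  obtain ⟨ψ, h⟩ := hφ.exists_phiShape hN hF
  exact {
    watson := fun n θ hθ i j hij => ZNIsing.formFactor_watson hN hF hp c hθ hij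
    crossing := fun n θ₁ θ hθ => ZNIsing.formFactor_crossing hN hF hφ h hp c θ₁ hθ
    annihilation := fun n θ hθ => ZNIsing.hasResidue_annihilation hN hσ hF hφ h hp hc hθ
    bound := fun a ha n θ hθ => ZNIsing.hasResidue_boundFormFactor hN hF hφ h hp c ha hθ
    combined := fun n => ZNIsing.hasIteratedResidue_formFactor hN hσ hF hφ h hp hc n
    boost := fun n θ hθ μ => ZNIsing.formFactor_boost hN hφ h hp c hθ μ }
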